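/- Let $V:\mathbb R^n\to\mathbb R$ be differentiable and such that $d\mu(x)=e^{-V(x)}dx$ is a probability measure. Let $L=\Delta-\nabla V\cdot\nabla$ be the associated symmetric diffusion generator, i.e. the self-adjoint operator in $L^2(\mu)$ given by the Dirichlet form $\int\nabla u\cdot\nabla v\,d\mu$ (the closure of this form on $C_c^\infty(\mathbb R^n)$), and let $(P_t)_{t\ge 0}$ be the semigroup generated by $L$ on $L^2(\mu)$, extended by continuity to $L^1(\mu)$. Let $\Phi:\mathbb R\to[0,\infty)$ be a Young function (convex, even, $\Phi(0)=0$, $\Phi(x)\to\infty$ as $x\to\infty$) of class $C^2$ such that, for some constant $B$, $x\Phi'(x)\le B\,\Phi(x)$ for every $x\in\mathbb R$. Write $\mu(f)=\int f\,d\mu$, let $L_\Phi(\mu)$ be the Orlicz space of measurable $f$ with $\int\Phi(\alpha f)\,d\mu<\infty$ for some $\alpha>0$, and let $\|f\|_\Phi=\inf\{\lambda>0:\int\Phi(f/\lambda)\,d\mu\le 1\}$ be the Luxemburg norm. Then the following two properties are equivalent. (i) There is a constant $C\in(0,\infty)$ such that for every $C^\infty$ function $f:\mathbb R^n\to\mathbb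 R$ in $L_\Phi(\mu)$, $$\|f-\mu(f)\|_\Phi^2\le C\int|\nabla f|^2\,\Phi''\!\left(\frac{f-\mu(f)}{\|f-\mu(f)\|_\Phi}\right)d\mu ,$$ where the right-hand side takes values in $[0,\infty]$ (for constant $f$ both sides are $0$). (ii) There is a constant $M\in(0,\infty)$ such that for every $C^\infty$ function $f:\mathbb R^n\to\mathbb R$ in $L_\Phi(\mu)$ and every $t\ge 0$, $$\|P_tf-\mu(f)\|_\Phi^2\le e^{-Mt}\,\|f-\mu(f)\|_\Phi^2 .$$ Moreover, if (i) holds with constant $C$, then (ii) holds with $M=2/(BC)$; and if (ii) holds with constant $M$, then (i) holds with $C=2/M$. -/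

import Mathlib

open MeasureTheory Filter Topology
open scoped ENNReal ContDiff Gradient RealInnerProductSpace InnerProductSpace

noncomputable section

namespace OrliczDecay

/-! ### Young functions and Orlicz norms -/

/-- Finite-valued Young functions: convex, even, nonnegative functions vanishing at `0` and
tending to infinity at infinity. -/
structure IsYoung (Φ : ℝ → ℝ) : Prop where
  convex : ConvexOn ℝ Set.univ Φ
  even : ∀ x, Φ (-x) = Φ x
  nonneg : ∀ x, 0 ≤ Φ x
  zero : Φ 0 = 0
  tendsto : Tendsto Φ atTop atTop

/-- Membership in the Orlicz space `L_Φ(μ)`. -/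
def MemOrlicz {X : Type*} [MeasurableSpace X] (Φ : ℝ → ℝ) (μ : Measure X) (f : X → ℝ) : Prop :=
  Measurable f ∧ ∃ α : ℝ, 0 < α ∧ ∫⁻ x, ENNReal.ofReal (Φ (α * f x)) ∂μ < ⊤

/-- The Luxemburg norm `inf {l > 0 : ∫ Φ(f / l) dμ ≤ 1}`, with value `∞` if there is no
such `l`. -/
def luxemburgNorm {X : Type*} [MeasurableSpace X] (Φ : ℝ → ℝ) (μ : Measure X) (f : X → ℝ) :
    ℝ≥0∞ :=
  ⨅ (l : ℝ) (_ : 0 < l ∧ ∫⁻ x, ENNReal.ofReal (Φ (f x / l)) ∂μ ≤ 1), ENNReal.ofReal l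

/-! ### The measure, the generator and the Dirichlet form -/

variable {n : ℕ}

/-- The measure `e^{-V} dx` on `ℝⁿ`. -/
def gibbs (V : EuclideanSpace ℝ (Fin n) → ℝ) : Measure (EuclideanSpace ℝ (Fin n)) :=
  volume.withDensity fun x => ENNReal.ofReal (Real.exp (-V x))

/-- The differential operator `L f = Δ f - ∇V · ∇f`. -/
def diffusionOperator (V f : EuclideanSpace ℝ (Fin n) → ℝ) (x : EuclideanSpace ℝ (Fin n)) : ℝ :=
  Laplacian.laplacian f x - ⟪∇ V x, ∇ f x⟫

/-- Integration by parts: `L` is symmetric in `L²(μ)` with Dirichlet form `∫ ∇u · ∇φ dμ`. -/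
theorem integral_mul_diffusionOperator (V : EuclideanSpace ℝ (Fin n) → ℝ)
    (hV : Differentiable ℝ V) (hV' : LocallyIntegrable (∇ V) volume)
    (u φ : EuclideanSpace ℝ (Fin n) → ℝ) (hu : ContDiff ℝ 1 u) (hφ : ContDiff ℝ 2 φ)
    (hc : HasCompactSupport φ) :
    ∫ x, u x * diffusionOperator V φ x ∂gibbs V = -∫ x, ⟪∇ u x, ∇ φ x⟫ ∂gibbs V := by
  set b := EuclideanSpace.basisFun (Fin n) ℝ
  have hdens : ∀ g : EuclideanSpace ℝ (Fin n) → ℝ,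
      ∫ x, g x ∂gibbs V = ∫ x, Real.exp (-V x) * g x := by
    intro g
    have hm : Measurable fun x => ENNReal.ofReal (Real.exp (-V x)) :=
      (Real.continuous_exp.comp hV.continuous.neg).measurable.ennreal_ofReal
    rw [gibbs, integral_withDensity_eq_integral_toReal_smul hm
      (Eventually.of_forall fun x => ENNReal.ofReal_lt_top)]
    simp [ENNReal.toReal_ofReal (Real.exp_pos _).le]
  set w : EuclideanSpace ℝ (Fin n) → ℝ := fun x => Real.exp (-V x) * u x with hw
  have hud : Differentiable ℝ u := hu.differentiable one_ne_zero
  have hwc : Continuous w := (Real.continuous_exp.comp hV.continuous.neg).mul hu.continuous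
  have hwd : Differentiable ℝ w := hV.neg.exp.mul hud
  have hφ1 : ∀ v, ContDiff ℝ 1 fun x => fderiv ℝ φ x v := fun v =>
    (hφ.fderiv_right (m := 1) (by norm_num)).clm_apply contDiff_const
  have hcs : ∀ v, HasCompactSupport fun x => fderiv ℝ φ x v := fun v =>
    hc.fderiv_apply ℝ v
  have hw' : ∀ x v, fderiv ℝ w x v =
      Real.exp (-V x) * fderiv ℝ u x v - w x * fderiv ℝ V x v := by
    intro x v
    have h1 : HasFDerivAt w _ x := ((hV x).hasFDerivAt.neg.exp).mul (hud x).hasFDerivAt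
    rw [h1.fderiv]
    simp [hw]
    ring
  have hint1 : ∀ v, Integrable (fun x => w x * fderiv ℝ (fun y => fderiv ℝ φ y v) x v) := by
    intro v
    refine Continuous.integrable_of_hasCompactSupport ?_ ?_
    · exact hwc.mul (((hφ1 v).continuous_fderiv one_ne_zero).clm_apply continuous_const)
    · exact ((hcs v).fderiv_apply ℝ v).mul_left
  have hVi : ∀ v, Integrable (fun x => fderiv ℝ V x v * (w x * fderiv ℝ φ x v)) := by
    intro v
    have h2 : Integrable (fun x => (w x * fderiv ℝ φ x v) • ∇ V x) :=
      hV'.integrable_smul_left_of_hasCompactSupport (hwc.mul (hφ1 v).continuous)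
        ((hcs v).mul_left)
    have h3 := h2.inner_const (𝕜 := ℝ) v
    refine h3.congr (Eventually.of_forall fun x => ?_)
    simp only [inner_smul_left, inner_gradient_left]
    simp
    ring
  have hui : ∀ v, Integrable (fun x => Real.exp (-V x) * (fderiv ℝ u x v * fderiv ℝ φ x v)) := by
    intro v
    refine Continuous.integrable_of_hasCompactSupport ?_ ?_
    · exact (Real.continuous_exp.comp hV.continuous.neg).mul
        (((hu.continuous_fderiv one_ne_zero).clm_apply continuous_const).mul (hφ1 v).continuous)
    · exact ((hcs v).mul_left).mul_left
  have hibp : ∀ v, ∫ x, w x * fderiv ℝ (fun y => fderiv ℝ φ y v) x v =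
      -∫ x, fderiv ℝ w x v * fderiv ℝ φ x v := by
    intro v
    refine integral_mul_fderiv_eq_neg_fderiv_mul_of_integrable ?_ (hint1 v) ?_
      (fun x _ => hwd x) (fun x _ => (hφ1 v).differentiable one_ne_zero x)
    · refine ((hui v).sub (hVi v)).congr (Eventually.of_forall fun x => ?_)
      simp only [hw', Pi.sub_apply]
      ring
    · exact Continuous.integrable_of_hasCompactSupport (hwc.mul (hφ1 v).continuous)
        ((hcs v).mul_left)
  have hin : ∀ (g h : EuclideanSpace ℝ (Fin n) → ℝ) x,
      ⟪∇ g x, ∇ h x⟫ = ∑ i, fderiv ℝ g x (b i) * fderiv ℝ h x (b i) := by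
    intro g h x
    rw [← b.sum_inner_mul_inner]
    refine Finset.sum_congr rfl fun i _ => ?_
    rw [inner_gradient_left, real_inner_comm, inner_gradient_left]
  have hlap : ∀ x, Laplacian.laplacian φ x =
      ∑ i, fderiv ℝ (fun y => fderiv ℝ φ y (b i)) x (b i) := by
    intro x
    rw [InnerProductSpace.laplacian_eq_iteratedFDeriv_orthonormalBasis φ b]
    refine Finset.sum_congr rfl fun i _ => ?_
    rw [iteratedFDeriv_two_apply, fderiv_clm_apply
      ((hφ.fderiv_right (m := 1) (by norm_num)).differentiable one_ne_zero x)
      (differentiableAt_const _)]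
    simp
  rw [hdens, hdens]
  have e1 : ∀ x, Real.exp (-V x) * (u x * diffusionOperator V φ x) =
      ∑ i, (w x * fderiv ℝ (fun y => fderiv ℝ φ y (b i)) x (b i) -
        fderiv ℝ V x (b i) * (w x * fderiv ℝ φ x (b i))) := by
    intro x
    rw [diffusionOperator, hlap, hin, Finset.sum_sub_distrib, ← Finset.mul_sum, ← mul_assoc,
      mul_sub, Finset.mul_sum]
    congr 1
    rw [Finset.mul_sum]
    exact Finset.sum_congr rfl fun i _ => by simp only [hw]; ring
  have e2 : ∀ x, Real.exp (-V x) * ⟪∇ u x, ∇ φ x⟫ =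
      ∑ i, Real.exp (-V x) * (fderiv ℝ u x (b i) * fderiv ℝ φ x (b i)) := by
    intro x
    rw [hin, Finset.mul_sum]
  simp_rw [e1, e2]
  have hsub : ∀ v, Integrable (fun x => w x * fderiv ℝ (fun y => fderiv ℝ φ y v) x v -
      fderiv ℝ V x v * (w x * fderiv ℝ φ x v)) := fun v => (hint1 v).sub (hVi v)
  rw [integral_finsetSum _ fun i _ => hsub _,
    integral_finsetSum _ fun i _ => hui _, ← Finset.sum_neg_distrib]
  refine Finset.sum_congr rfl fun i _ => ?_
  rw [integral_sub (hint1 _) (hVi _), hibp]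
  have e3 : ∫ x, fderiv ℝ w x (b i) * fderiv ℝ φ x (b i) =
      (∫ x, Real.exp (-V x) * (fderiv ℝ u x (b i) * fderiv ℝ φ x (b i))) -
        ∫ x, fderiv ℝ V x (b i) * (w x * fderiv ℝ φ x (b i)) := by
    rw [← integral_sub (hui _) (hVi _)]
    refine integral_congr_ae (Eventually.of_forall fun x => ?_)
    simp only [hw']
    ring
  rw [e3]
  ring

/-- For `s = 1` this is the graph of the closed gradient in `L²(μ) × L²(μ; ℝⁿ)`, the closure of
`{(φ, ∇φ) : φ ∈ C_c^∞}`, where `μ = e^{-V} dx`; in general it is the closure of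
`{(φ, s ∇φ) : φ ∈ C_c^∞}`. -/
def gradientGraph (V : EuclideanSpace ℝ (Fin n) → ℝ) (s : ℝ) :
    Submodule ℝ (WithLp 2
      (Lp ℝ 2 (gibbs V) × Lp (EuclideanSpace ℝ (Fin n)) 2 (gibbs V))) :=
  (Submodule.span ℝ {p | ∃ φ : EuclideanSpace ℝ (Fin n) → ℝ,
    ContDiff ℝ ∞ φ ∧ HasCompactSupport φ ∧
    p.fst =ᵐ[gibbs V] φ ∧ p.snd =ᵐ[gibbs V] fun x => s • ∇ φ x}).topologicalClosure

instance (V : EuclideanSpace ℝ (Fin n) → ℝ) (s : ℝ) :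
    (gradientGraph V s).HasOrthogonalProjection :=
  haveI : CompleteSpace (gradientGraph V s) :=
    (Submodule.isClosed_topologicalClosure _).completeSpace_coe
  Submodule.HasOrthogonalProjection.ofCompleteSpace _

/-- The resolvent `(1 - l L)⁻¹` on `L²(μ)`, `l > 0`, where `L` is the self-adjoint generator of
the Dirichlet form `∫ ∇u · ∇v dμ`, the closure of the form on `C_c^∞`. The orthogonal projection
of `(f, 0)` onto `{(v, √l ∇v)}` is `(u, √l ∇u)` with `∫ u v dμ + l ∫ ∇u · ∇v dμ = ∫ f v dμ` for
all `v` in the form domain; and `-∫ ∇u · ∇φ dμ = ∫ u Lφ dμ` by integration by parts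
(see `integral_mul_diffusionOperator`). -/
def formResolvent (V : EuclideanSpace ℝ (Fin n) → ℝ) (l : ℝ) :
    Lp ℝ 2 (gibbs V) →L[ℝ] Lp ℝ 2 (gibbs V) :=
  WithLp.fstL 2 ℝ (Lp ℝ 2 (gibbs V)) (Lp (EuclideanSpace ℝ (Fin n)) 2 (gibbs V)) ∘L
    (gradientGraph V (Real.sqrt l)).starProjection ∘L
    (WithLp.prodContinuousLinearEquiv 2 ℝ (Lp ℝ 2 (gibbs V))
      (Lp (EuclideanSpace ℝ (Fin n)) 2 (gibbs V))).symm.toContinuousLinearMap ∘L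
    ContinuousLinearMap.inl ℝ (Lp ℝ 2 (gibbs V)) (Lp (EuclideanSpace ℝ (Fin n)) 2 (gibbs V))

/-- The semigroup `P_t = e^{tL}` on `L²(μ)`, as the limit when `l → 0+` of `e^{t L_l} f`, where
`L_l = ((1 - l L)⁻¹ - 1) / l` is the (bounded) Yosida approximation of `L`. -/
def semigroupL2 (V : EuclideanSpace ℝ (Fin n) → ℝ) (t : ℝ) (f : Lp ℝ 2 (gibbs V)) :
    Lp ℝ 2 (gibbs V) :=
  limUnder (𝓝[>] (0 : ℝ)) fun l => NormedSpace.exp ((t / l) • (formResolvent V l - 1)) f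

/-- The semigroup `P_t` on `L¹(μ)`: the extension by continuity of the semigroup on `L²(μ)`, that
is, `P_t f` is the limit in `L¹(μ)` of `P_t g` as `g ∈ L²(μ)` tends to `f` in `L¹(μ)`. -/
def semigroup (V : EuclideanSpace ℝ (Fin n) → ℝ) [IsProbabilityMeasure (gibbs V)] (t : ℝ)
    (f : EuclideanSpace ℝ (Fin n) → ℝ) : Lp ℝ 1 (gibbs V) :=
  limUnder (comap (fun g : Lp ℝ 2 (gibbs V) => eLpNorm (fun x => g x - f x) 1 (gibbs V)) (𝓝 0))
    fun g => AddSubgroup.inclusion (Lp.antitone one_le_two) (semigroupL2 V t g)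

/-! ### The two properties -/

/-- The modified Orlicz-Sobolev inequality with constant `C`. Both sides are elements
of `[0, ∞]`. -/
def ModifiedOrliczSobolev (V : EuclideanSpace ℝ (Fin n) → ℝ) (Φ : ℝ → ℝ) (C : ℝ) : Prop :=
  ∀ f : EuclideanSpace ℝ (Fin n) → ℝ, ContDiff ℝ ∞ f → MemOrlicz Φ (gibbs V) f →
    luxemburgNorm Φ (gibbs V) (fun x => f x - ∫ y, f y ∂gibbs V) ^ 2 ≤
      ENNReal.ofReal C * ∫⁻ x, ENNReal.ofReal (‖∇ f x‖ ^ 2 * deriv (deriv Φ)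
        ((f x - ∫ y, f y ∂gibbs V) /
          (luxemburgNorm Φ (gibbs V) (fun z => f z - ∫ y, f y ∂gibbs V)).toReal)) ∂gibbs V

/-- Exponential decay of the semigroup in the Luxemburg norm, with rate `M`. -/
def ExponentialDecay (V : EuclideanSpace ℝ (Fin n) → ℝ) [IsProbabilityMeasure (gibbs V)]
    (Φ : ℝ → ℝ) (M : ℝ) : Prop :=
  ∀ f : EuclideanSpace ℝ (Fin n) → ℝ, ContDiff ℝ ∞ f → MemOrlicz Φ (gibbs V) f →
    ∀ t : ℝ, 0 ≤ t →
      luxemburgNorm Φ (gibbs V) (fun x => semigroup V t f x - ∫ y, f y ∂gibbs V) ^ 2 ≤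
        ENNReal.ofReal (Real.exp (-M * t)) *
          luxemburgNorm Φ (gibbs V) (fun x => f x - ∫ y, f y ∂gibbs V) ^ 2

end OrliczDecay

end

set_option linter.unusedSectionVars false

noncomputable section

namespace OrliczDecay

/-! ### Exponentials of bounded operators and the Yosida approximation -/

section Yosida

variable {H : Type*} [NormedAddCommGroup H] [NormedSpace ℝ H] [CompleteSpace H]

/-! Both properties are compared with the same inequality on a more flexible class,
`FormInequality`: 1 ≤ C ∫ |∇v|² Φ''(v) dμ for bounded v in the form domain with mean 0 and ∫ Φ(v) dμ
= 1. Unlike the class of smooth functions, this domain is visibly stable under truncation and under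
the resolvents R_l = (1 - lL)⁻¹. No regularity of P_t f is used: L enters only through the weak
equation ∫ (f - R_l f) v dμ = l ∫ ∇R_l f · ∇v dμ. Formally everything rests on -d/dt ∫ Φ(P_t f) dμ =
∫ |∇P_t f|² Φ''(P_t f) dμ.

From the inequality to decay, time is discretised by the implicit Euler scheme. Let f be bounded
with mean 0 and u = R_l f. Testing the equation of u with Φ'(u) and using the tangent inequality
Φ(f) ≥ Φ(u) + Φ'(u)(f - u) gives ∫ Φ(f) ≥ ∫ Φ(u) + l ∫ |∇u|² Φ''(u), hence ∫ Φ(f) ≥ 1 + l/C when ∫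
Φ(u) = 1 (`one_add_le_integral_young`). The growth condition integrates to Φ(cx) ≤ c^B Φ(x) for c ≥
1, which turns this gain into a contraction of the Luxemburg norm by ρ = (1 + l/C)^(-1/B)
(`formResolvent_mem_luxemburgBall`). The Yosida exponential is a Poisson mixture of powers of R_l
with parameter t/l, so it contracts by exp(-(t/l)(1 - ρ)), which tends to exp(-t/(BC)) as l → 0.
Clipping, Fatou's lemma and the L¹ contraction property remove boundedness.

From decay to the inequality, let w = R_l² v be bounded and normalised. Decay gives ∫ Φ(P_t w) ≤
exp(-Mt/2), while the tangent inequality bounds the same integral below by 1 - ∫ Φ'(w)(w - P_t w).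
The second resolvent makes P_t w = w + tLw + O(t²), so letting t → 0 yields M/2 ≤ ∫ |∇w|² Φ''(w)
(`decay_le_energy_of_normalized`); the elements R_l² v approximate v in the form norm
(`exists_resolvent_sq_near`).

It remains to return to smooth unbounded functions (`FormInequality.one_le_energy`). No growth of
Φ'' is assumed, so rescaling on the whole space could destroy the domination of the energy
densities. The function is truncated with a density at most its own plus 1, and its mean and modular
are then repaired by small compactly supported perturbations. -/

theorem hasSum_exp_sub_one_apply (R : H →L[ℝ] H) (c : ℝ) (f : H) :
    HasSum (fun k : ℕ => (Real.exp (-c) * (c ^ k / k.factorial)) • (R ^ k) f)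
      (NormedSpace.exp (c • (R - 1)) f) := by
  have h1 : NormedSpace.exp (c • (R - 1)) =
      Real.exp (-c) • NormedSpace.exp (c • R) := by
    have h2 : c • (R - 1) = (-c) • (1 : H →L[ℝ] H) + c • R := by
      rw [smul_sub]; module
    have h3 : Commute ((-c) • (1 : H →L[ℝ] H)) (c • R) :=
      ((Commute.one_left R).smul_left _).smul_right _
    let := NormedAlgebra.restrictScalars ℚ ℝ (H →L[ℝ] H)
    rw [h2, NormedSpace.exp_add_of_commute h3]
    have h4 : NormedSpace.exp ((-c) • (1 : H →L[ℝ] H)) = Real.exp (-c) • 1 := by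
      rw [Real.exp_eq_exp_ℝ, ← Algebra.algebraMap_eq_smul_one, ← Algebra.algebraMap_eq_smul_one,
        NormedSpace.algebraMap_exp_comm]
    rw [h4, smul_one_mul]
  rw [h1]
  have h5 := (NormedSpace.exp_series_hasSum_exp' (𝕂 := ℝ) (c • R)).const_smul (Real.exp (-c))
  have h6 := h5.mapL (ContinuousLinearMap.apply ℝ H f)
  convert! h6 using 1
  · funext k
    simp only [ContinuousLinearMap.apply_apply, smul_apply, smul_pow, smul_smul]
    congr 1
    field_simp

theorem hasSum_exp_weights (c : ℝ) :
    HasSum (fun k : ℕ => Real.exp (-c) * (c ^ k / k.factorial)) 1 := by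
  have h := (NormedSpace.expSeries_div_hasSum_exp (c : ℝ)).mul_left (Real.exp (-c))
  rwa [← Real.exp_eq_exp_ℝ, ← Real.exp_add, neg_add_cancel, Real.exp_zero] at h

theorem norm_pow_apply_le {R : H →L[ℝ] H} (hR : ‖R‖ ≤ 1) (k : ℕ) (f : H) :
    ‖(R ^ k) f‖ ≤ ‖f‖ := by
  induction k with
  | zero => simp
  | succ k ih =>
    rw [pow_succ', mul_apply_eq_comp]
    exact ((R.le_of_opNorm_le hR _).trans_eq (one_mul _)).trans ih

/-- The exponential is a Poisson mixture of the contractions `R ^ k`. -/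
theorem norm_exp_sub_one_apply_le {R : H →L[ℝ] H} (hR : ‖R‖ ≤ 1) {c : ℝ} (hc : 0 ≤ c) (f : H) :
    ‖NormedSpace.exp (c • (R - 1)) f‖ ≤ ‖f‖ := by
  have h1 := hasSum_exp_sub_one_apply R c f
  have h2 := (hasSum_exp_weights c).mul_right ‖f‖
  rw [one_mul] at h2
  rw [← h1.tsum_eq]
  refine tsum_of_norm_bounded h2 fun k => ?_
  have hw : 0 ≤ Real.exp (-c) * (c ^ k / k.factorial) := by positivity
  rw [norm_smul, Real.norm_of_nonneg hw]
  exact mul_le_mul_of_nonneg_left (norm_pow_apply_le hR k f) hw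

theorem hasDerivAt_exp_smul_apply (X : H →L[ℝ] H) (w : H) (s : ℝ) :
    HasDerivAt (fun s : ℝ => NormedSpace.exp (s • X) w) (NormedSpace.exp (s • X) (X w)) s := by
  have h := (hasDerivAt_exp_smul_const (𝕂 := ℝ) X s).clm_apply (hasDerivAt_const s w)
  simpa using h

/-- `X` generates a semigroup of contractions. -/
def IsContractive (X : H →L[ℝ] H) : Prop :=
  ∀ s : ℝ, 0 ≤ s → ∀ f, ‖NormedSpace.exp (s • X) f‖ ≤ ‖f‖

theorem IsContractive.norm_exp_sub_le {X : H →L[ℝ] H} (hX : IsContractive X) {t : ℝ} (ht : 0 ≤ t)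
    (w : H) : ‖NormedSpace.exp (t • X) w - w‖ ≤ ‖X w‖ * t := by
  have h := norm_image_sub_le_of_norm_deriv_le_segment' (a := 0) (b := t)
    (f := fun s : ℝ => NormedSpace.exp (s • X) w) (f' := fun s => NormedSpace.exp (s • X) (X w))
    (C := ‖X w‖) (fun s _ => (hasDerivAt_exp_smul_apply X w s).hasDerivWithinAt)
    (fun s hs => hX s hs.1 _) t ⟨ht, le_rfl⟩
  simpa using h

/-- The derivative of the left-hand expression is `exp (s X) (X w) - X w`, of norm at most `‖X (X
w)‖ * s`; bounding `s` by `t` loses a harmless factor 1/2. -/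
theorem IsContractive.norm_exp_sub_sub_le {X : H →L[ℝ] H} (hX : IsContractive X) {t : ℝ}
    (ht : 0 ≤ t) (w : H) :
    ‖NormedSpace.exp (t • X) w - w - t • X w‖ ≤ ‖X (X w)‖ * t ^ 2 := by
  have h := norm_image_sub_le_of_norm_deriv_le_segment' (a := 0) (b := t)
    (f := fun s : ℝ => NormedSpace.exp (s • X) w - s • X w)
    (f' := fun s => NormedSpace.exp (s • X) (X w) - X w)
    (C := ‖X (X w)‖ * t) (fun s _ => by
      have h1 := (hasDerivAt_exp_smul_apply X w s).sub ((hasDerivAt_id s).smul_const (X w))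
      simpa using! h1.hasDerivWithinAt)
    (fun s hs => (hX.norm_exp_sub_le hs.1 _).trans
      (mul_le_mul_of_nonneg_left hs.2.le (norm_nonneg _))) t ⟨ht, le_rfl⟩
  have e : NormedSpace.exp (t • X) w - w - t • X w =
      NormedSpace.exp (t • X) w - t • X w - (NormedSpace.exp ((0 : ℝ) • X) w - (0 : ℝ) • X w) := by
    simp; abel
  rw [e]
  refine h.trans_eq (by ring)

/-- Duhamel: interpolate by s ↦ exp(sX) exp((t - s)Y) w, whose derivative, by commutation, is the
image of Xw - Yw under two contractions. -/
theorem IsContractive.norm_exp_sub_exp_le {X Y : H →L[ℝ] H} (hX : IsContractive X)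
    (hY : IsContractive Y) (hXY : Commute X Y) {t : ℝ} (ht : 0 ≤ t) (w : H) :
    ‖NormedSpace.exp (t • X) w - NormedSpace.exp (t • Y) w‖ ≤ ‖X w - Y w‖ * t := by
  have hd : ∀ s : ℝ, HasDerivAt
      (fun s : ℝ => NormedSpace.exp (s • X) (NormedSpace.exp ((t - s) • Y) w))
      (NormedSpace.exp (s • X) (NormedSpace.exp ((t - s) • Y) (X w - Y w))) s := by
    intro s
    have h1 := (hasDerivAt_exp_smul_const (𝕂 := ℝ) X s)
    have h2 : HasDerivAt (fun s : ℝ => NormedSpace.exp ((t - s) • Y) w)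
        (-(NormedSpace.exp ((t - s) • Y) (Y w))) s := by
      have h3 := (hasDerivAt_exp_smul_apply Y w (t - s)).scomp s ((hasDerivAt_id s).const_sub t)
      simpa using! h3
    have h4 := h1.clm_apply h2
    have hc : Commute X (NormedSpace.exp ((t - s) • Y)) := (hXY.smul_right _).exp_right
    have hc' := congrArg (fun T : H →L[ℝ] H => T w) hc.eq
    simp only [mul_apply_eq_comp] at hc'
    convert! h4 using 1
    simp [hc']
    abel
  have h := norm_image_sub_le_of_norm_deriv_le_segment' (a := 0) (b := t)
    (C := ‖X w - Y w‖) (fun s _ => (hd s).hasDerivWithinAt)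
    (fun s hs => (hX s hs.1 _).trans (hY (t - s) (sub_nonneg.2 hs.2.le) _)) t ⟨ht, le_rfl⟩
  simpa using h

/-- A strongly continuous family of contractions satisfying the resolvent identity. -/
structure IsContractionResolvent (R : ℝ → H →L[ℝ] H) : Prop where
  norm_le : ∀ l, 0 < l → ‖R l‖ ≤ 1
  resolvent_eq : ∀ l m, 0 < l → 0 < m → R l = R m * ((m / l) • 1 + (1 - m / l) • R l)
  tendsto : ∀ f, Tendsto (fun l => R l f) (𝓝[>] 0) (𝓝 f)

/-- The Yosida approximation of the generator. -/
def yosida (R : ℝ → H →L[ℝ] H) (l : ℝ) : H →L[ℝ] H := (1 / l) • (R l - 1)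

theorem smul_yosida (R : ℝ → H →L[ℝ] H) (t l : ℝ) :
    t • yosida R l = (t / l) • (R l - 1) := by
  rw [yosida, smul_smul, mul_one_div]

namespace IsContractionResolvent

variable {R : ℝ → H →L[ℝ] H} (hR : IsContractionResolvent R)
include hR

theorem norm_apply_le {l : ℝ} (hl : 0 < l) (f : H) : ‖R l f‖ ≤ ‖f‖ :=
  ((R l).le_of_opNorm_le (hR.norm_le l hl) f).trans_eq (one_mul _)

theorem isContractive {l : ℝ} (hl : 0 < l) : IsContractive (yosida R l) := by
  intro s hs f
  rw [smul_yosida]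
  exact norm_exp_sub_one_apply_le (hR.norm_le l hl) (by positivity) f

theorem mul_eq {l m : ℝ} (hl : 0 < l) (hm : 0 < m) :
    (1 - m / l) • (R m * R l) = R l - (m / l) • R m := by
  have h := hR.resolvent_eq l m hl hm
  rw [mul_add, mul_smul_comm, mul_smul_comm, mul_one] at h
  rw [eq_sub_iff_add_eq, add_comm]
  exact h.symm

/-- Exchanging l and m in `mul_eq` and multiplying by -(m/l) gives the same right-hand side for the
product in the other order. The common factor 1 - m/l vanishes only for l = m, which is treated
apart. -/
theorem commute {l m : ℝ} (hl : 0 < l) (hm : 0 < m) : Commute (R l) (R m) := by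
  rcases eq_or_ne l m with rfl | hlm
  · exact Commute.refl _
  have h1 := hR.mul_eq hl hm
  have h2 := congrArg (fun T => (-(m / l)) • T) (hR.mul_eq hm hl)
  simp only [smul_smul, smul_sub] at h2
  have e1 : -(m / l) * (1 - l / m) = 1 - m / l := by field_simp; ring
  have e2 : -(m / l) * (l / m) = -1 := by field_simp
  rw [e1, e2] at h2
  have h3 : (1 - m / l) • (R l * R m) = (1 - m / l) • (R m * R l) := by
    rw [h1, h2]; module
  have h4 : (1 - m / l) ≠ 0 := by
    rw [sub_ne_zero]; intro h; apply hlm; field_simp at h; exact h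
  exact smul_right_injective _ h4 h3

/-- Formally both sides are L R_l R_m. This is why the Yosida approximations converge on the range
of a resolvent. -/
theorem yosida_mul {l m : ℝ} (hl : 0 < l) (hm : 0 < m) :
    yosida R l * R m = R l * yosida R m := by
  have h := hR.mul_eq hm hl
  have h' : R l * R m - R m = (l / m) • (R l * R m - R l) := by
    rw [smul_sub]; rw [sub_smul, one_smul] at h
    exact sub_eq_sub_iff_sub_eq_sub.2 h
  simp only [yosida, smul_mul_assoc, mul_smul_comm, sub_mul, mul_sub, one_mul, mul_one]
  rw [h', smul_smul]
  congr 1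
  field_simp

theorem yosida_apply {l m : ℝ} (hl : 0 < l) (hm : 0 < m) (f : H) :
    yosida R l (R m f) = R l (yosida R m f) :=
  congrArg (fun T : H →L[ℝ] H => T f) (hR.yosida_mul hl hm)

theorem commute_yosida {l m : ℝ} (hl : 0 < l) (hm : 0 < m) :
    Commute (yosida R l) (yosida R m) :=
  ((((hR.commute hl hm).sub_left (Commute.one_left _)).sub_right
    (Commute.one_right _)).smul_left _).smul_right _

theorem tendsto_yosida {m : ℝ} (hm : 0 < m) (f : H) :
    Tendsto (fun l => yosida R l (R m f)) (𝓝[>] 0) (𝓝 (yosida R m f)) := by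
  refine (hR.tendsto (yosida R m f)).congr' ?_
  filter_upwards [self_mem_nhdsWithin] with l hl
  exact (hR.yosida_apply hl hm f).symm

/-- Cauchy criterion: replace f by R_m f, at a cost controlled by contractivity uniformly in l, then
compare the exponentials by Duhamel, the Yosida approximations converging at R_m f. -/
theorem exists_tendsto_exp {t : ℝ} (ht : 0 ≤ t) (f : H) :
    ∃ g, Tendsto (fun l => NormedSpace.exp ((t / l) • (R l - 1)) f) (𝓝[>] 0) (𝓝 g) := by
  simp_rw [← smul_yosida]
  refine cauchy_map_iff_exists_tendsto.1 (Metric.cauchy_iff.2 ⟨inferInstance, fun ε hε => ?_⟩)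
  have h1 : ∀ᶠ m in 𝓝[>] (0 : ℝ), dist (R m f) f < ε / 4 :=
    (hR.tendsto f).eventually (Metric.ball_mem_nhds _ (by positivity))
  obtain ⟨m, hm1, hm⟩ := (h1.and self_mem_nhdsWithin).exists
  have hm : 0 < m := hm
  rw [dist_eq_norm] at hm1
  -- The denominator has t + 1 rather than t so that t = 0 needs no separate case.
  have h2 : ∀ᶠ l in 𝓝[>] (0 : ℝ), dist (yosida R l (R m f)) (yosida R m f) < ε / (4 * (t + 1)) :=
    (hR.tendsto_yosida hm f).eventually (Metric.ball_mem_nhds _ (by positivity))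
  refine ⟨_, image_mem_map (h2.and self_mem_nhdsWithin), ?_⟩
  rintro _ ⟨l, ⟨hl1, hl⟩, rfl⟩ _ ⟨k, ⟨hk1, hk⟩, rfl⟩
  have hl : 0 < l := hl
  have hk : 0 < k := hk
  have hXl := hR.isContractive hl
  have hXk := hR.isContractive hk
  have h3 := hXl.norm_exp_sub_exp_le hXk (hR.commute_yosida hl hk) ht (R m f)
  have h4 := hXl t ht (R m f - f)
  have h5 := hXk t ht (R m f - f)
  rw [map_sub] at h4 h5
  have h6 : ‖yosida R l (R m f) - yosida R k (R m f)‖ < 2 * (ε / (4 * (t + 1))) := by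
    rw [← dist_eq_norm]
    have := dist_triangle_right (yosida R l (R m f)) (yosida R k (R m f)) (yosida R m f)
    linarith
  have h7 : ‖yosida R l (R m f) - yosida R k (R m f)‖ * t ≤ ε / 2 := by
    calc _ ≤ 2 * (ε / (4 * (t + 1))) * t := by gcongr
      _ ≤ 2 * (ε / (4 * (t + 1))) * (t + 1) := by gcongr; linarith
      _ = ε / 2 := by field_simp; norm_num
  rw [dist_eq_norm]
  have e : NormedSpace.exp (t • yosida R l) f - NormedSpace.exp (t • yosida R k) f =
      (NormedSpace.exp (t • yosida R l) (R m f) - NormedSpace.exp (t • yosida R k) (R m f)) -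
      (NormedSpace.exp (t • yosida R l) (R m f) - NormedSpace.exp (t • yosida R l) f) +
      (NormedSpace.exp (t • yosida R k) (R m f) - NormedSpace.exp (t • yosida R k) f) := by abel
  rw [e]
  refine (norm_add_le _ _).trans_lt ?_
  have := norm_sub_le
    (NormedSpace.exp (t • yosida R l) (R m f) - NormedSpace.exp (t • yosida R k) (R m f))
    (NormedSpace.exp (t • yosida R l) (R m f) - NormedSpace.exp (t • yosida R l) f)
  linarith

/-- On the range of R_l² the square of the m-th Yosida approximation is R_m² applied to a vector
independent of m. The second-order error is therefore uniform in m and survives the limit m → 0. -/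
theorem norm_exp_yosida_sub_le {l m t : ℝ} (hl : 0 < l) (hm : 0 < m) (ht : 0 ≤ t) (v : H) :
    ‖NormedSpace.exp (t • yosida R m) (R l (R l v)) - R l (R l v) -
      t • yosida R m (R l (R l v))‖ ≤ ‖yosida R l (yosida R l v)‖ * t ^ 2 := by
  refine ((hR.isContractive hm).norm_exp_sub_sub_le ht _).trans ?_
  refine mul_le_mul_of_nonneg_right ?_ (sq_nonneg t)
  have e1 : yosida R m (yosida R m (R l (R l v))) = R m (R m (yosida R l (yosida R l v))) := by
    rw [hR.yosida_apply hm hl]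
    have hc : Commute (yosida R m) (R m) :=
      ((Commute.refl (R m)).sub_left (Commute.one_left _)).smul_left _
    have hc' := congrArg (fun T : H →L[ℝ] H => T (yosida R l (R l v))) hc.eq
    simp only [mul_apply_eq_comp] at hc'
    rw [hc', hR.yosida_apply hl hl, hR.yosida_apply hm hl]
  rw [e1]
  exact (hR.norm_apply_le hm _).trans (hR.norm_apply_le hm _)

theorem norm_limit_sub_le {l t : ℝ} (hl : 0 < l) (ht : 0 ≤ t) (v : H) {g : H}
    (hg : Tendsto (fun m => NormedSpace.exp ((t / m) • (R m - 1)) (R l (R l v))) (𝓝[>] 0) (𝓝 g)) :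
    ‖g - R l (R l v) - t • yosida R l (R l v)‖ ≤ ‖yosida R l (yosida R l v)‖ * t ^ 2 := by
  have h1 := hR.tendsto_yosida hl (R l v)
  have h2 := ((hg.sub_const (R l (R l v))).sub (h1.const_smul t)).norm
  refine le_of_tendsto h2 ?_
  filter_upwards [self_mem_nhdsWithin] with m hm
  rw [← smul_yosida]
  exact hR.norm_exp_yosida_sub_le hl hm ht v

end IsContractionResolvent

end Yosida

end OrliczDecay

namespace OrliczDecay

/-! ### Convergence in `Lᵖ` -/

section Convergence

variable {X : Type*} [MeasurableSpace X] {μ : Measure X} {F F' : Type*}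
  [NormedAddCommGroup F] [NormedSpace ℝ F] [NormedAddCommGroup F']

theorem tendsto_eLpNorm_zero_of_dominated {p : ℝ≥0∞} (hp : p ≠ 0) (hp' : p ≠ ⊤)
    {f : ℕ → X → F} {g : X → F'} (hf : ∀ k, AEStronglyMeasurable (f k) μ) (hg : MemLp g p μ)
    (hb : ∀ k, ∀ᵐ x ∂μ, ‖f k x‖ ≤ ‖g x‖)
    (hlim : ∀ᵐ x ∂μ, Tendsto (fun k => f k x) atTop (𝓝 0)) :
    Tendsto (fun k => eLpNorm (f k) p μ) atTop (𝓝 0) := by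
  have hpos : 0 < p.toReal := ENNReal.toReal_pos hp hp'
  have h1 : Tendsto (fun k => ∫⁻ x, ‖f k x‖ₑ ^ p.toReal ∂μ) atTop
      (𝓝 (∫⁻ _, (0 : ℝ≥0∞) ∂μ)) := by
    refine tendsto_lintegral_of_dominated_convergence' (fun x => ‖g x‖ₑ ^ p.toReal)
      (fun k => (hf k).enorm.pow_const _) (fun k => ?_) ?_ ?_
    · filter_upwards [hb k] with x hx
      exact ENNReal.rpow_le_rpow (enorm_le_iff_norm_le.2 hx) hpos.le
    · exact (lintegral_rpow_enorm_lt_top_of_eLpNorm_lt_top hp hp' hg.2).ne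
    · filter_upwards [hlim] with x hx
      have h2 := hx.enorm.ennrpow_const p.toReal
      simpa [hpos] using h2
  have h3 := h1.ennrpow_const (1 / p.toReal)
  simp only [lintegral_zero] at h3
  rw [ENNReal.zero_rpow_of_pos (by positivity)] at h3
  simpa only [eLpNorm_eq_lintegral_rpow_enorm_toReal hp hp'] using h3

/-- Split θ_k G_k - ηK = θ_k (G_k - K) + (θ_k - η) K; the first term is small because θ_k is
bounded, the second by dominated convergence. -/
theorem tendsto_eLpNorm_smul_sub {p : ℝ≥0∞} [Fact (1 ≤ p)] (hp' : p ≠ ⊤) {θ : ℕ → X → ℝ}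
    {η : X → ℝ} {G : ℕ → X → F} {K : X → F} {M : ℝ}
    (hθ : ∀ k, AEStronglyMeasurable (θ k) μ) (hη : AEStronglyMeasurable η μ)
    (hG : ∀ k, AEStronglyMeasurable (G k) μ) (hK : MemLp K p μ)
    (hb : ∀ k, ∀ᵐ x ∂μ, |θ k x| ≤ M)
    (hlim : ∀ᵐ x ∂μ, Tendsto (fun k => θ k x) atTop (𝓝 (η x)))
    (hGK : Tendsto (fun k => eLpNorm (fun x => G k x - K x) p μ) atTop (𝓝 0)) :
    Tendsto (fun k => eLpNorm (fun x => θ k x • G k x - η x • K x) p μ) atTop (𝓝 0) := by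
  have hp1 : 1 ≤ p := Fact.out
  have hp : p ≠ 0 := (zero_lt_one.trans_le hp1).ne'
  have hbη : ∀ᵐ x ∂μ, |η x| ≤ M := by
    filter_upwards [hlim, ae_all_iff.2 hb] with x hx hbx
    exact le_of_tendsto hx.abs (Eventually.of_forall hbx)
  have h1 : Tendsto (fun k => eLpNorm (fun x => (θ k x - η x) • K x) p μ) atTop (𝓝 0) := by
    refine tendsto_eLpNorm_zero_of_dominated hp hp' (g := fun x => (2 * M) • K x)
      (fun k => ((hθ k).sub hη).smul hK.1) (hK.const_smul (2 * M)) (fun k => ?_) ?_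
    · filter_upwards [hb k, hbη] with x hx hx'
      rw [norm_smul, norm_smul]
      refine mul_le_mul_of_nonneg_right ?_ (norm_nonneg _)
      rw [Real.norm_eq_abs, Real.norm_eq_abs]
      exact (abs_sub _ _).trans ((by linarith : |θ k x| + |η x| ≤ 2 * M).trans (le_abs_self _))
    · filter_upwards [hlim] with x hx
      have := (hx.sub_const (η x)).smul_const (K x)
      simpa using this
  have h2 : Tendsto (fun k => ENNReal.ofReal M * eLpNorm (fun x => G k x - K x) p μ +
      eLpNorm (fun x => (θ k x - η x) • K x) p μ) atTop (𝓝 0) := by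
    have := (ENNReal.Tendsto.const_mul hGK (Or.inr (ENNReal.ofReal_ne_top (r := M)))).add h1
    simpa using this
  refine tendsto_of_tendsto_of_tendsto_of_le_of_le tendsto_const_nhds h2 (fun _ => zero_le)
    fun k => ?_
  have e : (fun x => θ k x • G k x - η x • K x) =
      (fun x => θ k x • (G k x - K x)) + fun x => (θ k x - η x) • K x := by
    funext x; simp only [Pi.add_apply, smul_sub, sub_smul]; abel
  rw [e]
  refine (eLpNorm_add_le ((hθ k).smul ((hG k).sub hK.1)) (((hθ k).sub hη).smul hK.1) hp1).trans ?_
  refine add_le_add_left (eLpNorm_le_mul_eLpNorm_of_ae_le_mul ?_ p) _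
  filter_upwards [hb k] with x hx
  refine (norm_smul (θ k x) (G k x - K x)).trans_le ?_
  exact mul_le_mul_of_nonneg_right hx (norm_nonneg _)

theorem exists_seq_tendsto_ae_of_eLpNorm {p : ℝ≥0∞} (hp : p ≠ 0) {f : ℕ → X → F} {g : X → F}
    (hf : ∀ k, AEStronglyMeasurable (f k) μ) (hg : AEStronglyMeasurable g μ)
    (h : Tendsto (fun k => eLpNorm (fun x => f k x - g x) p μ) atTop (𝓝 0)) :
    ∃ ns : ℕ → ℕ, StrictMono ns ∧ ∀ᵐ x ∂μ, Tendsto (fun k => f (ns k) x) atTop (𝓝 (g x)) :=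
  (tendstoInMeasure_of_tendsto_eLpNorm hp hf hg h).exists_seq_tendsto_ae

end Convergence

variable {n : ℕ} {V : EuclideanSpace ℝ (Fin n) → ℝ}

/-! ### Gradients -/

section Gradients

variable {E : Type*} [NormedAddCommGroup E] [InnerProductSpace ℝ E] [CompleteSpace E]

theorem gradient_add {f g : E → ℝ} {x : E} (hf : DifferentiableAt ℝ f x)
    (hg : DifferentiableAt ℝ g x) : ∇ (fun y => f y + g y) x = ∇ f x + ∇ g x := by
  refine HasGradientAt.gradient ?_
  rw [hasGradientAt_iff_hasFDerivAt, map_add]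
  exact hf.hasGradientAt.hasFDerivAt.add hg.hasGradientAt.hasFDerivAt

theorem gradient_const_mul {f : E → ℝ} {x : E} (c : ℝ) (hf : DifferentiableAt ℝ f x) :
    ∇ (fun y => c * f y) x = c • ∇ f x := by
  refine HasGradientAt.gradient ?_
  rw [hasGradientAt_iff_hasFDerivAt, map_smulₛₗ]
  exact hf.hasGradientAt.hasFDerivAt.const_mul c

theorem gradient_comp {F : ℝ → ℝ} {f : E → ℝ} {x : E} (hF : DifferentiableAt ℝ F (f x))
    (hf : DifferentiableAt ℝ f x) : ∇ (fun y => F (f y)) x = deriv F (f x) • ∇ f x := by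
  refine HasGradientAt.gradient ?_
  rw [hasGradientAt_iff_hasFDerivAt, map_smulₛₗ]
  exact hF.hasDerivAt.comp_hasFDerivAt x hf.hasGradientAt.hasFDerivAt

theorem continuous_gradient {f : E → ℝ} (hf : ContDiff ℝ ∞ f) : Continuous (∇ f) :=
  (InnerProductSpace.toDual ℝ E).symm.continuous.comp (hf.continuous_fderiv (by simp))

theorem hasCompactSupport_gradient {f : E → ℝ} (hf : HasCompactSupport f) :
    HasCompactSupport (∇ f) :=
  (hf.fderiv (𝕜 := ℝ)).comp_left (g := (InnerProductSpace.toDual ℝ E).symm) (map_zero _)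

end Gradients

/-! ### The form domain -/

/-- `φ` is a smooth compactly supported function. -/
structure IsTest (φ : EuclideanSpace ℝ (Fin n) → ℝ) : Prop where
  contDiff : ContDiff ℝ ∞ φ
  hasCompactSupport : HasCompactSupport φ

namespace IsTest

variable {φ ψ : EuclideanSpace ℝ (Fin n) → ℝ}

theorem add (hφ : IsTest φ) (hψ : IsTest ψ) : IsTest fun x => φ x + ψ x :=
  ⟨hφ.1.add hψ.1, hφ.2.add hψ.2⟩

theorem const_mul (hφ : IsTest φ) (c : ℝ) : IsTest fun x => c * φ x :=
  ⟨contDiff_const.mul hφ.1, hφ.2.mul_left⟩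

theorem zero : IsTest fun _ : EuclideanSpace ℝ (Fin n) => 0 :=
  ⟨contDiff_const, HasCompactSupport.zero⟩

theorem comp {F : ℝ → ℝ} (hφ : IsTest φ) (hF : ContDiff ℝ ∞ F) (h0 : F 0 = 0) :
    IsTest fun x => F (φ x) :=
  ⟨hF.comp hφ.1, hφ.2.comp_left h0⟩

theorem differentiable (hφ : IsTest φ) : Differentiable ℝ φ := hφ.1.differentiable (by simp)

variable {μ : Measure (EuclideanSpace ℝ (Fin n))} [IsFiniteMeasureOnCompacts μ]

theorem memLp (hφ : IsTest φ) (p : ℝ≥0∞) : MemLp φ p μ :=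
  hφ.1.continuous.memLp_of_hasCompactSupport hφ.2

theorem memLp_gradient (hφ : IsTest φ) (p : ℝ≥0∞) : MemLp (∇ φ) p μ :=
  (continuous_gradient hφ.1).memLp_of_hasCompactSupport (hasCompactSupport_gradient hφ.2)

end IsTest

/-- `v` belongs to the domain of the closure of the Dirichlet form, with gradient `G`. -/
structure IsFormPair (V : EuclideanSpace ℝ (Fin n) → ℝ) (v : EuclideanSpace ℝ (Fin n) → ℝ)
    (G : EuclideanSpace ℝ (Fin n) → EuclideanSpace ℝ (Fin n)) : Prop where
  memLp : MemLp v 2 (gibbs V)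
  memLp_grad : MemLp G 2 (gibbs V)
  exists_test : ∀ ε : ℝ≥0∞, ε ≠ 0 → ∃ φ, IsTest φ ∧
    eLpNorm (fun x => φ x - v x) 2 (gibbs V) ≤ ε ∧ eLpNorm (fun x => ∇ φ x - G x) 2 (gibbs V) ≤ ε

namespace IsFormPair

variable {v w : EuclideanSpace ℝ (Fin n) → ℝ}
  {G K : EuclideanSpace ℝ (Fin n) → EuclideanSpace ℝ (Fin n)}

theorem exists_seq (h : IsFormPair V v G) : ∃ φ : ℕ → EuclideanSpace ℝ (Fin n) → ℝ,
    (∀ k, IsTest (φ k)) ∧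
    Tendsto (fun k => eLpNorm (fun x => φ k x - v x) 2 (gibbs V)) atTop (𝓝 0) ∧
    Tendsto (fun k => eLpNorm (fun x => ∇ (φ k) x - G x) 2 (gibbs V)) atTop (𝓝 0) := by
  have h1 : ∀ k : ℕ, ((k : ℝ≥0∞) + 1)⁻¹ ≠ 0 := fun k => by simp
  choose φ h2 h3 h4 using fun k => h.exists_test _ (h1 k)
  have h5 : Tendsto (fun k : ℕ => ((k : ℝ≥0∞) + 1)⁻¹) atTop (𝓝 0) := by
    have := (tendsto_add_atTop_iff_nat 1).2 ENNReal.tendsto_inv_nat_nhds_zero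
    simpa using this
  exact ⟨φ, h2,
    tendsto_of_tendsto_of_tendsto_of_le_of_le tendsto_const_nhds h5 (fun _ => zero_le) h3,
    tendsto_of_tendsto_of_tendsto_of_le_of_le tendsto_const_nhds h5 (fun _ => zero_le) h4⟩

theorem congr_ae (h : IsFormPair V v G) (hv : w =ᵐ[gibbs V] v) (hG : K =ᵐ[gibbs V] G) :
    IsFormPair V w K := by
  refine ⟨h.1.ae_eq hv.symm, h.2.ae_eq hG.symm, fun ε hε => ?_⟩
  obtain ⟨φ, h1, h2, h3⟩ := h.3 ε hε
  refine ⟨φ, h1, (eLpNorm_congr_ae ?_).trans_le h2, (eLpNorm_congr_ae ?_).trans_le h3⟩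
  · filter_upwards [hv] with x hx; rw [hx]
  · filter_upwards [hG] with x hx; rw [hx]

theorem eLpNorm_sub_le_half {F : Type*} [NormedAddCommGroup F]
    {μ : Measure (EuclideanSpace ℝ (Fin n))}
    {a b c : EuclideanSpace ℝ (Fin n) → F} (ha : AEStronglyMeasurable a μ)
    (hb : AEStronglyMeasurable b μ) (hc : AEStronglyMeasurable c μ) {ε : ℝ≥0∞}
    (h1 : eLpNorm (fun x => a x - b x) 2 μ ≤ ε / 2)
    (h2 : eLpNorm (fun x => b x - c x) 2 μ ≤ ε / 2) :
    eLpNorm (fun x => a x - c x) 2 μ ≤ ε := by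
  have e : (fun x => a x - c x) = (fun x => a x - b x) + fun x => b x - c x := by
    funext x; simp
  rw [e]
  refine (eLpNorm_add_le (ha.sub hb) (hb.sub hc) one_le_two).trans ?_
  exact (add_le_add h1 h2).trans_eq (ENNReal.add_halves ε)

variable [IsProbabilityMeasure (gibbs V)]

theorem of_isTest {φ : EuclideanSpace ℝ (Fin n) → ℝ} (hφ : IsTest φ) : IsFormPair V φ (∇ φ) :=
  ⟨hφ.memLp 2, hφ.memLp_gradient 2, fun ε _ => ⟨φ, hφ, by simp, by simp⟩⟩

theorem of_tendsto {v' : ℕ → EuclideanSpace ℝ (Fin n) → ℝ}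
    {G' : ℕ → EuclideanSpace ℝ (Fin n) → EuclideanSpace ℝ (Fin n)}
    (h : ∀ k, IsFormPair V (v' k) (G' k)) (hv : AEStronglyMeasurable v (gibbs V))
    (hG : AEStronglyMeasurable G (gibbs V))
    (h1 : Tendsto (fun k => eLpNorm (fun x => v' k x - v x) 2 (gibbs V)) atTop (𝓝 0))
    (h2 : Tendsto (fun k => eLpNorm (fun x => G' k x - G x) 2 (gibbs V)) atTop (𝓝 0)) :
    IsFormPair V v G := by
  have mem : ∀ {F : Type} [NormedAddCommGroup F] {a : ℕ → EuclideanSpace ℝ (Fin n) → F}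
      {b : EuclideanSpace ℝ (Fin n) → F}, (∀ k, MemLp (a k) 2 (gibbs V)) →
      AEStronglyMeasurable b (gibbs V) →
      Tendsto (fun k => eLpNorm (fun x => a k x - b x) 2 (gibbs V)) atTop (𝓝 0) →
      MemLp b 2 (gibbs V) := by
    intro F _ a b ha hb hab
    obtain ⟨k, hk⟩ := (hab.eventually (gt_mem_nhds zero_lt_one)).exists
    have h3 : MemLp (fun x => a k x - b x) 2 (gibbs V) :=
      ⟨(ha k).1.sub hb, hk.trans ENNReal.one_lt_top⟩
    have h4 := (ha k).sub h3
    refine h4.ae_eq (Eventually.of_forall fun x => ?_)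
    simp
  refine ⟨mem (fun k => (h k).1) hv h1, mem (fun k => (h k).2) hG h2, fun ε hε => ?_⟩
  have hε2 : 0 < ε / 2 := ENNReal.half_pos hε
  obtain ⟨k, hk1, hk2⟩ := ((ENNReal.tendsto_nhds_zero.1 h1 _ hε2).and
    (ENNReal.tendsto_nhds_zero.1 h2 _ hε2)).exists
  obtain ⟨φ, h3, h4, h5⟩ := (h k).3 _ hε2.ne'
  exact ⟨φ, h3, eLpNorm_sub_le_half (h3.memLp 2).1 (h k).1.1 hv h4 hk1,
    eLpNorm_sub_le_half (h3.memLp_gradient 2).1 (h k).2.1 hG h5 hk2⟩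

theorem add (h : IsFormPair V v G) (h' : IsFormPair V w K) :
    IsFormPair V (fun x => v x + w x) (fun x => G x + K x) := by
  refine ⟨h.1.add h'.1, h.2.add h'.2, fun ε hε => ?_⟩
  have hε2 : 0 < ε / 2 := ENNReal.half_pos hε
  obtain ⟨φ, a1, a2, a3⟩ := h.3 _ hε2.ne'
  obtain ⟨ψ, b1, b2, b3⟩ := h'.3 _ hε2.ne'
  refine ⟨fun x => φ x + ψ x, a1.add b1, ?_, ?_⟩
  · have e : (fun x => φ x + ψ x - (v x + w x)) =
        (fun x => φ x - v x) + fun x => ψ x - w x := by funext x; simp; ring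
    rw [e]
    refine (eLpNorm_add_le ((a1.memLp 2).1.sub h.1.1) ((b1.memLp 2).1.sub h'.1.1)
      one_le_two).trans ?_
    exact (add_le_add a2 b2).trans_eq (ENNReal.add_halves ε)
  · have e : (fun x => ∇ (fun x => φ x + ψ x) x - (G x + K x)) =
        (fun x => ∇ φ x - G x) + fun x => ∇ ψ x - K x := by
      funext x
      rw [gradient_add (a1.differentiable x) (b1.differentiable x)]
      simp; abel
    rw [e]
    refine (eLpNorm_add_le ((a1.memLp_gradient 2).1.sub h.2.1)
      ((b1.memLp_gradient 2).1.sub h'.2.1) one_le_two).trans ?_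
    exact (add_le_add a3 b3).trans_eq (ENNReal.add_halves ε)

theorem const_mul (h : IsFormPair V v G) (c : ℝ) :
    IsFormPair V (fun x => c * v x) (fun x => c • G x) := by
  obtain ⟨φ, h1, h2, h3⟩ := h.exists_seq
  refine of_tendsto (fun k => of_isTest ((h1 k).const_mul c)) (h.1.1.const_mul c)
    (h.2.1.const_smul c) ?_ ?_
  · have := ENNReal.Tendsto.const_mul h2 (Or.inr (enorm_ne_top (x := c)))
    rw [mul_zero] at this
    refine this.congr fun k => ?_
    rw [← eLpNorm_const_smul]
    congr 1; funext x; simp [mul_sub]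
  · have := ENNReal.Tendsto.const_mul h3 (Or.inr (enorm_ne_top (x := c)))
    rw [mul_zero] at this
    refine this.congr fun k => ?_
    rw [← eLpNorm_const_smul]
    congr 1; funext x
    rw [gradient_const_mul c ((h1 k).differentiable x)]
    simp [smul_sub]

theorem sub (h : IsFormPair V v G) (h' : IsFormPair V w K) :
    IsFormPair V (fun x => v x - w x) (fun x => G x - K x) := by
  have := h.add (h'.const_mul (-1))
  simpa [sub_eq_add_neg] using this

/-- Passing to an almost everywhere convergent subsequence makes F'(φ_k) converge to F'(v); being
bounded, it then acts as a multiplier on the L²-convergent gradients. -/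
theorem exists_seq_comp {F : ℝ → ℝ} (hF : ContDiff ℝ ∞ F) {M : ℝ}
    (hM : ∀ y, |deriv F y| ≤ M) (h : IsFormPair V v G) :
    ∃ φ : ℕ → EuclideanSpace ℝ (Fin n) → ℝ, (∀ k, IsTest (φ k)) ∧
      (∀ᵐ x ∂gibbs V, Tendsto (fun k => φ k x) atTop (𝓝 (v x))) ∧
      Tendsto (fun k => eLpNorm (fun x => F (φ k x) - F (v x)) 2 (gibbs V)) atTop (𝓝 0) ∧
      Tendsto (fun k => eLpNorm (fun x => ∇ (fun y => F (φ k y)) x - deriv F (v x) • G x) 2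
        (gibbs V)) atTop (𝓝 0) := by
  obtain ⟨φ', h1', h2', h3'⟩ := h.exists_seq
  obtain ⟨ns, hns, hae⟩ := exists_seq_tendsto_ae_of_eLpNorm two_ne_zero
    (fun k => ((h1' k).memLp (μ := gibbs V) 2).1) h.1.1 h2'
  set φ := fun k => φ' (ns k) with hφ
  have h1 : ∀ k, IsTest (φ k) := fun k => h1' _
  have h2 := h2'.comp hns.tendsto_atTop
  have h3 := h3'.comp hns.tendsto_atTop
  have hF' : Continuous (deriv F) := hF.continuous_deriv (by simp)
  have hFd : Differentiable ℝ F := hF.differentiable (by simp)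
  refine ⟨φ, h1, hae, ?_, ?_⟩
  · have h4 : Tendsto (fun k => ENNReal.ofReal M *
        eLpNorm (fun x => φ k x - v x) 2 (gibbs V)) atTop (𝓝 0) := by
      have := ENNReal.Tendsto.const_mul h2 (Or.inr (ENNReal.ofReal_ne_top (r := M)))
      simpa using this
    refine tendsto_of_tendsto_of_tendsto_of_le_of_le tendsto_const_nhds h4 (fun _ => zero_le)
      fun k => ?_
    refine eLpNorm_le_mul_eLpNorm_of_ae_le_mul (Eventually.of_forall fun x => ?_) 2
    exact Convex.norm_image_sub_le_of_norm_deriv_le (s := Set.univ) (fun y _ => hFd y)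
      (fun y _ => hM y) convex_univ trivial trivial
  · refine (tendsto_eLpNorm_smul_sub (by simp) (θ := fun k x => deriv F (φ k x))
      (G := fun k => ∇ (φ k)) (K := G) (M := M)
      (fun k => (hF'.comp (h1 k).1.continuous).aestronglyMeasurable)
      (hF'.comp_aestronglyMeasurable h.1.1) (fun k => ((h1 k).memLp_gradient 2).1) h.2
      (fun k => Eventually.of_forall fun x => hM _) ?_ h3).congr fun k => ?_
    · filter_upwards [hae] with x hx using (hF'.tendsto _).comp hx
    · congr 1; funext x
      rw [gradient_comp (hFd _) ((h1 k).differentiable x)]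

/-- The chain rule for smooth functions with bounded derivative. -/
theorem comp_smooth {F : ℝ → ℝ} (hF : ContDiff ℝ ∞ F) (h0 : F 0 = 0) {M : ℝ}
    (hM : ∀ y, |deriv F y| ≤ M) (h : IsFormPair V v G) :
    IsFormPair V (fun x => F (v x)) (fun x => deriv F (v x) • G x) := by
  obtain ⟨φ, h1, -, h2, h3⟩ := h.exists_seq_comp hF hM
  exact of_tendsto (fun k => of_isTest ((h1 k).comp hF h0))
    (hF.continuous.comp_aestronglyMeasurable h.1.1)
    (((hF.continuous_deriv (by simp)).comp_aestronglyMeasurable h.1.1).smul h.2.1) h2 h3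

end IsFormPair

end OrliczDecay

/-! ### Cutoffs, the C¹ chain rule and lattice operations in the form domain -/

namespace OrliczDecay

variable {n : ℕ} {V : EuclideanSpace ℝ (Fin n) → ℝ}

theorem norm_gradient {E : Type*} [NormedAddCommGroup E] [InnerProductSpace ℝ E] [CompleteSpace E]
    (f : E → ℝ) (x : E) : ‖∇ f x‖ = ‖fderiv ℝ f x‖ :=
  (InnerProductSpace.toDual ℝ E).symm.norm_map _

/-- A fixed bump equal to 1 on the unit ball is dilated by R, which divides its gradient by R; the
constant is thus independent of R. -/
theorem exists_cutoff (n : ℕ) : ∃ C : ℝ, 0 ≤ C ∧ ∀ R : ℝ, 0 < R →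
    ∃ χ : EuclideanSpace ℝ (Fin n) → ℝ, IsTest χ ∧ (∀ x, 0 ≤ χ x ∧ χ x ≤ 1) ∧
      (∀ x, ‖x‖ ≤ R → χ x = 1) ∧ ∀ x, ‖∇ χ x‖ ≤ C / R := by
  let b : ContDiffBump (0 : EuclideanSpace ℝ (Fin n)) := ⟨1, 2, one_pos, one_lt_two⟩
  have hb : ContDiff ℝ ∞ b := b.contDiff
  obtain ⟨C, hC⟩ := (hb.continuous_fderiv (by simp)).bounded_above_of_compact_support
    (b.hasCompactSupport.fderiv (𝕜 := ℝ))
  refine ⟨C, (norm_nonneg _).trans (hC 0), fun R hR => ⟨fun x => b (R⁻¹ • x), ⟨?_, ?_⟩, ?_, ?_, ?_⟩⟩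
  · exact hb.comp (contDiff_const_smul _)
  · exact b.hasCompactSupport.comp_smul (inv_ne_zero hR.ne')
  · exact fun x => ⟨b.nonneg, b.le_one⟩
  · intro x hx
    refine b.one_of_mem_closedBall ?_
    rw [mem_closedBall_zero_iff, norm_smul, norm_inv, Real.norm_of_nonneg hR.le,
      inv_mul_le_iff₀ hR]
    exact hx.trans_eq (mul_one R).symm
  · intro x
    rw [norm_gradient]
    have h1 : HasFDerivAt (fun x => b (R⁻¹ • x))
        ((fderiv ℝ b (R⁻¹ • x)).comp (R⁻¹ • ContinuousLinearMap.id ℝ _)) x :=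
      ((hb.differentiable (by simp)) _).hasFDerivAt.comp x
        ((hasFDerivAt_id x).const_smul R⁻¹)
    rw [h1.fderiv]
    refine (ContinuousLinearMap.opNorm_comp_le _ _).trans ?_
    rw [div_eq_mul_inv]
    refine mul_le_mul (hC _) ?_ (norm_nonneg _) ((norm_nonneg _).trans (hC 0))
    rw [norm_smul, norm_inv, Real.norm_of_nonneg hR.le]
    exact mul_le_of_le_one_right (inv_nonneg.2 hR.le) ContinuousLinearMap.norm_id_le

/-- A smooth bounded function with bounded derivative that is the identity on `[-K, K]`. -/
theorem exists_smooth_truncation (K : ℝ) : ∃ F : ℝ → ℝ, ∃ M : ℝ, ContDiff ℝ ∞ F ∧ F 0 = 0 ∧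
    (∀ y, |F y| ≤ M) ∧ (∀ y, |deriv F y| ≤ M) ∧ ∀ y, |y| ≤ K → F y = y ∧ deriv F y = 1 := by
  let b : ContDiffBump (0 : ℝ) := ⟨|K| + 1, |K| + 2, by positivity, by linarith⟩
  have hb : ContDiff ℝ ∞ fun y => y * b y := contDiff_id.mul b.contDiff
  have hc : HasCompactSupport fun y => y * b y := b.hasCompactSupport.mul_left
  obtain ⟨C, hC⟩ := hb.continuous.bounded_above_of_compact_support hc
  obtain ⟨D, hD⟩ := (hb.continuous_deriv (by simp)).bounded_above_of_compact_support hc.deriv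
  refine ⟨_, max C D, hb, by simp, fun y => (hC y).trans (le_max_left _ _),
    fun y => (hD y).trans (le_max_right _ _), fun y hy => ?_⟩
  have h1 : (fun y => y * b y) =ᶠ[𝓝 y] id := by
    have : Metric.ball (0 : ℝ) (|K| + 1) ∈ 𝓝 y := by
      refine Metric.isOpen_ball.mem_nhds ?_
      rw [mem_ball_zero_iff, Real.norm_eq_abs]
      linarith [le_abs_self K]
    filter_upwards [this] with z hz
    rw [b.one_of_mem_closedBall (Metric.ball_subset_closedBall hz), mul_one, id]
  exact ⟨h1.eq_of_nhds, by rw [h1.deriv_eq, deriv_id]⟩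

section Convergence

variable {X : Type*} [MeasurableSpace X] {μ : Measure X} [IsProbabilityMeasure μ] {F : Type*}
  [NormedAddCommGroup F] [NormedSpace ℝ F]

theorem tendsto_eLpNorm_zero_of_bound {p : ℝ≥0∞} {f : ℕ → X → F} {c : ℕ → ℝ}
    (hc : Tendsto c atTop (𝓝 0))
    (h : ∀ k, ∀ᵐ x ∂μ, ‖f k x‖ ≤ c k) : Tendsto (fun k => eLpNorm (f k) p μ) atTop (𝓝 0) := by
  have h1 : Tendsto (fun k => ENNReal.ofReal (c k)) atTop (𝓝 0) := by
    simpa using ENNReal.tendsto_ofReal hc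
  refine tendsto_of_tendsto_of_tendsto_of_le_of_le tendsto_const_nhds h1 (fun _ => zero_le)
    fun k => ?_
  simpa using eLpNorm_le_of_ae_bound (p := p) (h k)

theorem tendsto_integral_smul {θ : ℕ → X → ℝ}
    {η : X → ℝ} {G : ℕ → X → F} {K : X → F} {M : ℝ}
    (hθ : ∀ k, AEStronglyMeasurable (θ k) μ) (hη : AEStronglyMeasurable η μ)
    (hG : ∀ k, MemLp (G k) 2 μ) (hK : MemLp K 2 μ)
    (hb : ∀ k, ∀ᵐ x ∂μ, |θ k x| ≤ M)
    (hlim : ∀ᵐ x ∂μ, Tendsto (fun k => θ k x) atTop (𝓝 (η x)))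
    (hGK : Tendsto (fun k => eLpNorm (fun x => G k x - K x) 2 μ) atTop (𝓝 0)) :
    Tendsto (fun k => ∫ x, θ k x • G k x ∂μ) atTop (𝓝 (∫ x, η x • K x ∂μ)) := by
  have h1 := tendsto_eLpNorm_smul_sub (by simp) hθ hη (fun k => (hG k).1) hK hb hlim hGK
  refine tendsto_integral_of_L1' _ (hη.smul hK.1) (Eventually.of_forall fun k => ?_) ?_
  · exact Integrable.bdd_smul ((hG k).integrable one_le_two) M (hθ k) (hb k)
  · refine tendsto_of_tendsto_of_tendsto_of_le_of_le tendsto_const_nhds h1 (fun _ => zero_le)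
      fun k => ?_
    exact eLpNorm_le_eLpNorm_of_exponent_le one_le_two
      (((hθ k).smul (hG k).1).sub (hη.smul hK.1))

end Convergence

namespace IsFormPair

variable {v w : EuclideanSpace ℝ (Fin n) → ℝ}
  {G K : EuclideanSpace ℝ (Fin n) → EuclideanSpace ℝ (Fin n)}
  [IsProbabilityMeasure (gibbs V)]

/-- Cutoffs χ_k tend to 1 in L² because μ is finite, and their gradients tend to 0 uniformly. This
membership is what makes the resolvents conserve mass. -/
theorem const (c : ℝ) : IsFormPair V (fun _ => c) (fun _ => 0) := by
  suffices h : IsFormPair V (fun _ => 1) (fun _ => 0) by simpa using h.const_mul c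
  obtain ⟨C, hC, hcut⟩ := exists_cutoff n
  choose χ h1 h2 h3 h4 using fun k : ℕ => hcut ((k : ℝ) + 1) (by positivity)
  have hk : Tendsto (fun k : ℕ => C / ((k : ℝ) + 1)) atTop (𝓝 0) := by
    have := tendsto_one_div_add_atTop_nhds_zero_nat.const_mul C
    simpa [div_eq_mul_inv] using this
  refine of_tendsto (fun k => of_isTest (h1 k)) aestronglyMeasurable_const
    aestronglyMeasurable_const ?_ ?_
  · refine tendsto_eLpNorm_zero_of_dominated (g := fun _ => (1 : ℝ)) two_ne_zero (by simp)
      (fun k => ((h1 k).1.continuous.sub continuous_const).aestronglyMeasurable)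
      (memLp_const 1) (fun k => Eventually.of_forall fun x => ?_) (Eventually.of_forall fun x => ?_)
    · rw [Real.norm_eq_abs, norm_one, abs_le]
      constructor <;> linarith [(h2 k x).1, (h2 k x).2]
    · refine tendsto_const_nhds.congr' ?_
      filter_upwards [eventually_ge_atTop ⌈‖x‖⌉₊] with k hk
      rw [h3 k x (by linarith [(Nat.ceil_le.1 hk : ‖x‖ ≤ k)]), sub_self]
  · refine tendsto_eLpNorm_zero_of_bound hk fun k => Eventually.of_forall fun x => ?_
    simpa using h4 k x

/-- Compose the approximants with a smooth bounded function equal to the identity on [-C, C]: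
neither the limit nor its gradient changes. -/
theorem exists_bounded_seq (h : IsFormPair V v G) {C : ℝ} (hC : ∀ᵐ x ∂gibbs V, |v x| ≤ C) :
    ∃ φ : ℕ → EuclideanSpace ℝ (Fin n) → ℝ, ∃ M : ℝ, (∀ k, IsTest (φ k)) ∧
      (∀ k x, |φ k x| ≤ M) ∧
      (∀ᵐ x ∂gibbs V, Tendsto (fun k => φ k x) atTop (𝓝 (v x))) ∧
      Tendsto (fun k => eLpNorm (fun x => φ k x - v x) 2 (gibbs V)) atTop (𝓝 0) ∧
      Tendsto (fun k => eLpNorm (fun x => ∇ (φ k) x - G x) 2 (gibbs V)) atTop (𝓝 0) := by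
  obtain ⟨F, M, hF, h0, hM, hM', hid⟩ := exists_smooth_truncation C
  obtain ⟨φ, h1, h2, h3, h4⟩ := h.exists_seq_comp hF hM'
  refine ⟨fun k x => F (φ k x), M, fun k => (h1 k).comp hF h0, fun k x => hM _, ?_, ?_, ?_⟩
  · filter_upwards [h2, hC] with x hx hCx
    have := (hF.continuous.tendsto _).comp hx
    rwa [(hid _ hCx).1] at this
  · refine h3.congr fun k => eLpNorm_congr_ae ?_
    filter_upwards [hC] with x hx
    rw [(hid _ hx).1]
  · refine h4.congr fun k => eLpNorm_congr_ae ?_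
    filter_upwards [hC] with x hx
    rw [(hid _ hx).2, one_smul]

/-- The chain rule for `C¹` functions of a bounded element of the form domain. -/
theorem comp_of_bounded (h : IsFormPair V v G) {C : ℝ} (hC : ∀ᵐ x ∂gibbs V, |v x| ≤ C)
    {F : ℝ → ℝ} (hF : ContDiff ℝ 1 F) :
    IsFormPair V (fun x => F (v x)) (fun x => deriv F (v x) • G x) := by
  obtain ⟨T, M, hT, hT0, hTM, hTM', hid⟩ := exists_smooth_truncation C
  have hF' : Continuous (deriv F) := hF.continuous_deriv le_rfl
  have hFd : Differentiable ℝ F := hF.differentiable one_ne_zero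
  have hpos : ∀ k : ℕ, (0 : ℝ) < 1 / ((k : ℝ) + 1) := fun k => by positivity
  -- F being only C¹, its derivative is approximated by polynomials, uniformly on [-C, C]. Their
  -- antiderivatives are smooth, and precomposing them with the truncation T makes the derivatives
  -- globally bounded, as `comp_smooth` requires.
  choose p hp using fun k : ℕ => exists_polynomial_near_of_continuousOn (-C) C (deriv F)
    hF'.continuousOn _ (hpos k)
  have hpc : ∀ k, Continuous fun y => (p k).eval y := fun k => (p k).continuous
  set Q : ℕ → ℝ → ℝ := fun k y => ∫ t in (0 : ℝ)..y, (p k).eval t with hQ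
  have hQd : ∀ k y, HasDerivAt (Q k) ((p k).eval y) y := fun k y =>
    intervalIntegral.integral_hasDerivAt_right ((hpc k).intervalIntegrable _ _)
      ((hpc k).stronglyMeasurableAtFilter _ _) (hpc k).continuousAt
  have hQs : ∀ k, ContDiff ℝ ∞ (Q k) := fun k => by
    rw [contDiff_infty_iff_deriv]
    refine ⟨fun y => (hQd k y).differentiableAt, ?_⟩
    rw [funext fun y => (hQd k y).deriv]
    exact (p k).contDiff_aeval ∞
  have hQ0 : ∀ k, Q k 0 = 0 := fun k => by simp [hQ]
  have hcomp : ∀ k, IsFormPair V (fun x => Q k (T (v x)))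
      (fun x => deriv (fun y => Q k (T y)) (v x) • G x) := by
    intro k
    have hd : ∀ y, deriv (fun y => Q k (T y)) y = (p k).eval (T y) * deriv T y := fun y =>
      ((hQd k (T y)).comp y (hT.differentiable (by simp) y).hasDerivAt).deriv
    obtain ⟨D, hD⟩ := (isCompact_Icc (a := -M) (b := M)).exists_bound_of_continuousOn
      (hpc k).continuousOn
    refine comp_smooth (F := fun y => Q k (T y)) ((hQs k).comp hT) (by simp [hT0, hQ0])
      (M := D * M) (fun y => ?_) h
    rw [hd, abs_mul]
    exact mul_le_mul (hD _ (abs_le.1 (hTM y))) (hTM' y) (abs_nonneg _)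
      ((norm_nonneg _).trans (hD _ (abs_le.1 (hTM y))))
  have hk : Tendsto (fun k : ℕ => 1 / ((k : ℝ) + 1)) atTop (𝓝 0) :=
    tendsto_one_div_add_atTop_nhds_zero_nat
  -- The antiderivatives vanish at 0, so the value F 0 is restored by adding a constant, which
  -- belongs to the form domain.
  have hpair : ∀ k, IsFormPair V (fun x => Q k (v x) + F 0) (fun x => (p k).eval (v x) • G x) := by
    intro k
    refine ((hcomp k).add (const (F 0))).congr_ae ?_ ?_
    · filter_upwards [hC] with x hx
      rw [(hid _ hx).1]
    · filter_upwards [hC] with x hx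
      have := ((hQd k (T (v x))).comp (v x) (hT.differentiable (by simp) (v x)).hasDerivAt).deriv
      rw [add_zero]
      refine congrArg (· • G x) ?_
      refine Eq.trans ?_ this.symm
      rw [(hid _ hx).1, (hid _ hx).2, mul_one]
  refine of_tendsto hpair (hF.continuous.comp_aestronglyMeasurable h.1.1)
    ((hF'.comp_aestronglyMeasurable h.1.1).smul h.2.1) ?_ ?_
  · have hk' : Tendsto (fun k : ℕ => 1 / ((k : ℝ) + 1) * C) atTop (𝓝 0) := by
      simpa using hk.mul_const C
    refine tendsto_eLpNorm_zero_of_bound hk' fun k => ?_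
    filter_upwards [hC] with x hx
    have hC0 : 0 ≤ C := (abs_nonneg _).trans hx
    have h3 := Convex.norm_image_sub_le_of_norm_hasDerivWithin_le (s := Set.Icc (-C) C)
      (f := fun y => Q k y - F y) (f' := fun y => (p k).eval y - deriv F y) (C := 1 / ((k : ℝ) + 1))
      (fun y _ => ((hQd k y).sub (hFd y).hasDerivAt).hasDerivWithinAt)
      (fun y hy => (hp k y hy).le) (convex_Icc _ _) (x := 0) (y := v x)
      ⟨by linarith, hC0⟩ (abs_le.1 hx)
    have e : Q k (v x) + F 0 - F (v x) = Q k (v x) - F (v x) - (Q k 0 - F 0) := by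
      rw [hQ0]; ring
    rw [e]
    refine h3.trans (mul_le_mul_of_nonneg_left ?_ (hpos k).le)
    simpa using hx
  · have hGM := h.2
    have h5 := ENNReal.Tendsto.mul_const (b := eLpNorm G 2 (gibbs V)) (ENNReal.tendsto_ofReal hk)
      (Or.inr hGM.2.ne)
    rw [ENNReal.ofReal_zero, zero_mul] at h5
    refine tendsto_of_tendsto_of_tendsto_of_le_of_le tendsto_const_nhds h5 (fun _ => zero_le)
      fun k => ?_
    refine eLpNorm_le_mul_eLpNorm_of_ae_le_mul ?_ 2
    filter_upwards [hC] with x hx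
    rw [← sub_smul, norm_smul]
    exact mul_le_mul_of_nonneg_right (hp k _ (abs_le.1 hx)).le (norm_nonneg _)

/-- Approximate |y| by √(y² + d²) - d, smooth and zero at 0; its derivatives are bounded by 1 and
tend to the sign, with value 0 at y = 0. -/
theorem abs (h : IsFormPair V v G) :
    IsFormPair V (fun x => |v x|) (fun x => Real.sign (v x) • G x) := by
  have hd : ∀ k : ℕ, (0 : ℝ) < 1 / ((k : ℝ) + 1) := fun k => by positivity
  have hk : Tendsto (fun k : ℕ => 1 / ((k : ℝ) + 1)) atTop (𝓝 0) :=
    tendsto_one_div_add_atTop_nhds_zero_nat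
  set d : ℕ → ℝ := fun k => 1 / ((k : ℝ) + 1)
  have hp : ∀ k y, 0 < y ^ 2 + d k ^ 2 := fun k y => by
    have := hd k; positivity
  set F : ℕ → ℝ → ℝ := fun k y => Real.sqrt (y ^ 2 + d k ^ 2) - d k with hF
  have hFs : ∀ k, ContDiff ℝ ∞ (F k) := fun k =>
    (((contDiff_id.pow 2).add contDiff_const).sqrt fun y => (hp k y).ne').sub contDiff_const
  have hFd : ∀ k y, deriv (F k) y = y / Real.sqrt (y ^ 2 + d k ^ 2) := fun k y => by
    have h1 : HasDerivAt (F k) _ y :=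
      ((((hasDerivAt_id y).pow 2).add_const (d k ^ 2)).sqrt (hp k y).ne').sub_const (d k)
    rw [h1.deriv]
    simp
    field_simp
  have habs : ∀ k y, |y| ≤ Real.sqrt (y ^ 2 + d k ^ 2) := fun k y =>
    Real.abs_le_sqrt (by nlinarith [sq_nonneg (d k)])
  have hFb : ∀ k y, |deriv (F k) y| ≤ 1 := fun k y => by
    rw [hFd, abs_div, abs_of_nonneg (Real.sqrt_nonneg _)]
    exact div_le_one_of_le₀ (habs k y) (Real.sqrt_nonneg _)
  have hlim : ∀ y, Tendsto (fun k => deriv (F k) y) atTop (𝓝 (Real.sign y)) := by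
    intro y
    simp only [hFd]
    rcases eq_or_ne y 0 with rfl | hy
    · simp
    have h1 : Tendsto (fun k => Real.sqrt (y ^ 2 + d k ^ 2)) atTop (𝓝 |y|) := by
      have h2 : Tendsto (fun k => y ^ 2 + d k ^ 2) atTop (𝓝 (y ^ 2 + 0 ^ 2)) :=
        (hk.pow 2).const_add _
      have := h2.sqrt
      rwa [zero_pow two_ne_zero, add_zero, Real.sqrt_sq_eq_abs] at this
    have h3 := (tendsto_const_nhds (x := y)).div h1 (abs_ne_zero.2 hy)
    have e : y / |y| = Real.sign y := by
      rcases lt_or_gt_of_ne hy with hy | hy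
      · rw [abs_of_neg hy, Real.sign_of_neg hy, div_neg, div_self hy.ne]
      · rw [abs_of_pos hy, Real.sign_of_pos hy, div_self hy.ne']
    rwa [e] at h3
  have hF0 : ∀ k, F k 0 = 0 := fun k => by
    simp only [hF]
    rw [zero_pow two_ne_zero, zero_add, Real.sqrt_sq (hd k).le, sub_self]
  have hpair := fun k => h.comp_smooth (hFs k) (hF0 k) (hFb k)
  have hm : ∀ k, AEStronglyMeasurable (fun x => deriv (F k) (v x)) (gibbs V) := fun k =>
    ((hFs k).continuous_deriv (by simp)).comp_aestronglyMeasurable h.1.1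
  have hsm : AEStronglyMeasurable (fun x => Real.sign (v x)) (gibbs V) :=
    aestronglyMeasurable_of_tendsto_ae atTop hm (Eventually.of_forall fun x => hlim _)
  refine of_tendsto hpair h.1.1.norm (hsm.smul h.2.1) ?_ ?_
  · refine tendsto_eLpNorm_zero_of_bound hk fun k => Eventually.of_forall fun x => ?_
    rw [Real.norm_eq_abs, abs_le]
    have h1 : Real.sqrt (v x ^ 2 + d k ^ 2) ≤ |v x| + d k := by
      rw [← Real.sqrt_sq (add_nonneg (abs_nonneg (v x)) (hd k).le)]
      refine Real.sqrt_le_sqrt ?_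
      nlinarith [sq_abs (v x), mul_nonneg (abs_nonneg (v x)) (hd k).le]
    constructor <;> simp only [hF] <;> linarith [habs k (v x), hd k]
  · exact tendsto_eLpNorm_smul_sub (by simp) hm hsm (fun _ => h.2.1) h.2
      (fun k => Eventually.of_forall fun x => hFb k _) (Eventually.of_forall fun x => hlim _)
      (by simp)

theorem neg (h : IsFormPair V v G) : IsFormPair V (fun x => -v x) (fun x => -G x) := by
  simpa using h.const_mul (-1)

/-- From min(v, w) = (v + w - |v - w|)/2, the gradient is pointwise a convex combination of G and K.
The norm bound is what the maximum principle needs. -/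
theorem inf (h : IsFormPair V v G) (h' : IsFormPair V w K) :
    ∃ J, IsFormPair V (fun x => min (v x) (w x)) J ∧ ∀ x, ‖J x‖ ≤ max ‖G x‖ ‖K x‖ := by
  have h1 := ((h.add h').sub (h.sub h').abs).const_mul (1 / 2)
  have key : ∀ x, (1 / 2 : ℝ) • (G x + K x - Real.sign (v x - w x) • (G x - K x)) =
      ((1 - Real.sign (v x - w x)) / 2) • G x + ((1 + Real.sign (v x - w x)) / 2) • K x := by
    intro x; module
  simp only [key] at h1
  refine ⟨_, h1.congr_ae (Eventually.of_forall fun x => ?_) EventuallyEq.rfl, fun x => ?_⟩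
  · rcases le_total (v x) (w x) with hx | hx
    · simp only [min_eq_left hx, abs_of_nonpos (sub_nonpos.2 hx)]; ring
    · simp only [min_eq_right hx, abs_of_nonneg (sub_nonneg.2 hx)]; ring
  · have hs : |Real.sign (v x - w x)| ≤ 1 := by
      rcases Real.sign_apply_eq (v x - w x) with h | h | h <;> simp [h]
    obtain ⟨hs1, hs2⟩ := abs_le.1 hs
    set s := Real.sign (v x - w x)
    refine (norm_add_le _ _).trans ?_
    rw [norm_smul, norm_smul, Real.norm_of_nonneg (by linarith), Real.norm_of_nonneg (by linarith)]
    have a1 := mul_le_mul_of_nonneg_left (le_max_left ‖G x‖ ‖K x‖) (by linarith : 0 ≤ (1 - s) / 2)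
    have a2 := mul_le_mul_of_nonneg_left (le_max_right ‖G x‖ ‖K x‖) (by linarith : 0 ≤ (1 + s) / 2)
    linarith

theorem sup (h : IsFormPair V v G) (h' : IsFormPair V w K) :
    ∃ J, IsFormPair V (fun x => max (v x) (w x)) J := by
  obtain ⟨J, hJ, -⟩ := h.neg.inf h'.neg
  refine ⟨_, hJ.neg.congr_ae (Eventually.of_forall fun x => ?_) EventuallyEq.rfl⟩
  simp [min_neg_neg]

end IsFormPair

end OrliczDecay

namespace OrliczDecay

variable {n : ℕ} {V : EuclideanSpace ℝ (Fin n) → ℝ}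

/-! ### Closability of the form -/

theorem integral_gibbs {F : Type*} [NormedAddCommGroup F] [NormedSpace ℝ F] (hV : Continuous V)
    (g : EuclideanSpace ℝ (Fin n) → F) :
    ∫ x, g x ∂gibbs V = ∫ x, Real.exp (-V x) • g x := by
  have hm : Measurable fun x => ENNReal.ofReal (Real.exp (-V x)) :=
    (Real.continuous_exp.comp hV.neg).measurable.ennreal_ofReal
  rw [gibbs, integral_withDensity_eq_integral_toReal_smul hm
    (Eventually.of_forall fun x => ENNReal.ofReal_lt_top)]
  simp [ENNReal.toReal_ofReal (Real.exp_pos _).le]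

theorem integrable_gibbs {F : Type*} [NormedAddCommGroup F] [NormedSpace ℝ F] (hV : Continuous V)
    {g : EuclideanSpace ℝ (Fin n) → F} (hg : Integrable g (gibbs V)) :
    Integrable fun x => Real.exp (-V x) • g x := by
  have hm : Measurable fun x => ENNReal.ofReal (Real.exp (-V x)) :=
    (Real.continuous_exp.comp hV.neg).measurable.ennreal_ofReal
  rw [gibbs, integrable_withDensity_iff_integrable_smul' hm
    (Eventually.of_forall fun x => ENNReal.ofReal_lt_top)] at hg
  simpa [ENNReal.toReal_ofReal (Real.exp_pos _).le] using hg

theorem volume_absolutelyContinuous_gibbs (hV : Continuous V) :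
    (volume : Measure (EuclideanSpace ℝ (Fin n))) ≪ gibbs V :=
  withDensity_absolutelyContinuous'
    (Real.continuous_exp.comp hV.neg).measurable.ennreal_ofReal.aemeasurable
    (Eventually.of_forall fun _ => (ENNReal.ofReal_pos.2 (Real.exp_pos _)).ne')

theorem gibbs_absolutelyContinuous : gibbs V ≪ volume := withDensity_absolutelyContinuous _ _

theorem integral_test_smul_gradient {φ ψ : EuclideanSpace ℝ (Fin n) → ℝ} (hφ : IsTest φ)
    (hψ : IsTest ψ) : ∫ x, ψ x • ∇ φ x = -∫ x, φ x • ∇ ψ x := by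
  have hi : ∀ {a b : EuclideanSpace ℝ (Fin n) → ℝ}, IsTest a → IsTest b →
      Integrable (fun x => a x • ∇ b x) := fun ha hb =>
    ((ha.1.continuous.smul (continuous_gradient hb.1)).integrable_of_hasCompactSupport
      (ha.2.smul_right))
  refine ext_inner_left ℝ fun e => ?_
  rw [inner_neg_right, ← integral_inner (hi hψ hφ), ← integral_inner (hi hφ hψ)]
  have hi' : ∀ {a b : EuclideanSpace ℝ (Fin n) → ℝ}, IsTest a → IsTest b →
      Integrable (fun x => a x * fderiv ℝ b x e) := fun ha hb => by
    refine ((hi ha hb).inner_const e).congr (Eventually.of_forall fun x => ?_)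
    simp only [inner_smul_left, inner_gradient_left]; simp
  have h := integral_mul_fderiv_eq_neg_fderiv_mul_of_integrable (f := ψ) (g := φ) (v := e)
    (μ := volume) ?_ (hi' hψ hφ) ?_ (fun x _ => hψ.differentiable x)
    (fun x _ => hφ.differentiable x)
  · simp only [inner_smul_right, inner_gradient_right, conj_trivial]
    rw [h]
    simp only [mul_comm]
  · simpa only [mul_comm] using hi' hφ hψ
  · exact (hψ.1.continuous.mul hφ.1.continuous).integrable_of_hasCompactSupport (hψ.2.mul_right)

/-- Closability. Rewriting dx = e^V dμ, the integrals ∫ ψ ∇φ_k dx converge to ∫ ψ G dx, and after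
integration by parts in Lebesgue measure they tend to 0; so G vanishes against every test function.
Only the continuity of V enters, through the boundedness of e^V on the support of ψ. -/
theorem IsFormPair.grad_eq_zero [IsProbabilityMeasure (gibbs V)] (hV : Continuous V)
    {G : EuclideanSpace ℝ (Fin n) → EuclideanSpace ℝ (Fin n)}
    (h : IsFormPair V (fun _ => 0) G) : G =ᵐ[gibbs V] 0 := by
  obtain ⟨φ, h1, h2, h3⟩ := h.exists_seq
  have hVe : ∀ {F : Type} [NormedAddCommGroup F] [NormedSpace ℝ F]
      (ψ : EuclideanSpace ℝ (Fin n) → ℝ) (g : EuclideanSpace ℝ (Fin n) → F),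
      ∫ x, ψ x • g x = ∫ x, (Real.exp (V x) * ψ x) • g x ∂gibbs V := by
    intro F _ _ ψ g
    rw [integral_gibbs hV]
    refine integral_congr_ae (Eventually.of_forall fun x => ?_)
    simp only [smul_smul, ← mul_assoc, ← Real.exp_add, neg_add_cancel, Real.exp_zero, one_mul]
  have hloc : LocallyIntegrable G volume := by
    have h4 := (integrable_gibbs hV (h.2.integrable one_le_two)).locallyIntegrable
    have h5 := h4.continuous_smul (g := fun x => Real.exp (V x)) (Real.continuous_exp.comp hV)
    refine h5.congr (Eventually.of_forall fun x => ?_)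
    simp [smul_smul, ← Real.exp_add]
  refine gibbs_absolutelyContinuous.ae_le
    (ae_eq_zero_of_integral_contDiff_smul_eq_zero hloc fun ψ hψ1 hψ2 => ?_)
  have hψ : IsTest ψ := ⟨hψ1, hψ2⟩
  have hlim : ∀ {F : Type} [NormedAddCommGroup F] [NormedSpace ℝ F]
      {g : EuclideanSpace ℝ (Fin n) → F}, Continuous g → HasCompactSupport g →
      ∃ M, ∀ x, ‖Real.exp (V x) • g x‖ ≤ M := fun hg hc =>
    ((Real.continuous_exp.comp hV).smul hg).bounded_above_of_compact_support hc.smul_left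
  obtain ⟨M, hM⟩ := hlim hψ.1.continuous hψ.2
  have hc : Continuous fun x => Real.exp (V x) * ψ x :=
    (Real.continuous_exp.comp hV).mul hψ.1.continuous
  have a1 : Tendsto (fun k => ∫ x, (Real.exp (V x) * ψ x) • ∇ (φ k) x ∂gibbs V) atTop
      (𝓝 (∫ x, (Real.exp (V x) * ψ x) • G x ∂gibbs V)) :=
    tendsto_integral_smul (M := M) (fun _ => hc.aestronglyMeasurable) hc.aestronglyMeasurable
      (fun k => (h1 k).memLp_gradient 2) h.2 (fun _ => Eventually.of_forall hM)
      (Eventually.of_forall fun x => tendsto_const_nhds) h3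
  have a2 : Tendsto (fun k => ∫ x, φ k x • Real.exp (V x) • ∇ ψ x ∂gibbs V) atTop (𝓝 0) := by
    obtain ⟨D, hD⟩ := hlim (continuous_gradient hψ.1) (hasCompactSupport_gradient hψ.2)
    have hcg : Continuous fun x => Real.exp (V x) • ∇ ψ x :=
      (Real.continuous_exp.comp hV).smul (continuous_gradient hψ.1)
    have := tendsto_integral_of_L1' (μ := gibbs V) (l := atTop)
      (F := fun k x => φ k x • Real.exp (V x) • ∇ ψ x) (fun _ => (0 : EuclideanSpace ℝ (Fin n)))
      aestronglyMeasurable_const (Eventually.of_forall fun k => ?_) ?_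
    · simpa using this
    · exact memLp_one_iff_integrable.1 (((h1 k).1.continuous.smul hcg).memLp_of_hasCompactSupport
        (h1 k).2.smul_right)
    · have h6 := ENNReal.Tendsto.const_mul h2 (Or.inr (ENNReal.ofReal_ne_top (r := D)))
      rw [mul_zero] at h6
      refine tendsto_of_tendsto_of_tendsto_of_le_of_le tendsto_const_nhds h6 (fun _ => zero_le)
        fun k => ?_
      refine (eLpNorm_le_eLpNorm_of_exponent_le one_le_two
        (((h1 k).1.continuous.smul hcg).sub continuous_const).aestronglyMeasurable).trans ?_
      refine eLpNorm_le_mul_eLpNorm_of_ae_le_mul (Eventually.of_forall fun x => ?_) 2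
      simp only [Pi.sub_apply, sub_zero]
      refine (norm_smul (φ k x) (Real.exp (V x) • ∇ ψ x)).trans_le ?_
      rw [mul_comm]
      exact mul_le_mul_of_nonneg_right (hD x) (norm_nonneg _)
  have a3 : ∀ k, ∫ x, (Real.exp (V x) * ψ x) • ∇ (φ k) x ∂gibbs V =
      -∫ x, φ k x • Real.exp (V x) • ∇ ψ x ∂gibbs V := by
    intro k
    rw [← hVe, integral_test_smul_gradient (h1 k) hψ, hVe]
    simp only [smul_smul, mul_comm]
  rw [hVe]
  refine tendsto_nhds_unique a1 ?_
  simp only [a3]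
  simpa using a2.neg

/-! ### The gradient graph -/

/-- Test functions already form a vector space, so the span adds no new elements. -/
theorem span_eq (V : EuclideanSpace ℝ (Fin n) → ℝ) (s : ℝ)
    {p : WithLp 2 (Lp ℝ 2 (gibbs V) × Lp (EuclideanSpace ℝ (Fin n)) 2 (gibbs V))}
    (hp : p ∈ Submodule.span ℝ {p : WithLp 2
      (Lp ℝ 2 (gibbs V) × Lp (EuclideanSpace ℝ (Fin n)) 2 (gibbs V)) |
        ∃ φ : EuclideanSpace ℝ (Fin n) → ℝ, ContDiff ℝ ∞ φ ∧ HasCompactSupport φ ∧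
    p.fst =ᵐ[gibbs V] φ ∧ p.snd =ᵐ[gibbs V] fun x => s • ∇ φ x}) :
    ∃ φ, IsTest φ ∧ p.fst =ᵐ[gibbs V] φ ∧ p.snd =ᵐ[gibbs V] fun x => s • ∇ φ x := by
  induction hp using Submodule.span_induction with
  | mem p hp =>
    obtain ⟨φ, h1, h2, h3, h4⟩ := hp
    exact ⟨φ, ⟨h1, h2⟩, h3, h4⟩
  | zero =>
    refine ⟨_, IsTest.zero, Lp.coeFn_zero _ _ _, (Lp.coeFn_zero _ _ _).trans
      (Eventually.of_forall fun x => ?_)⟩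
    simp [gradient]
  | add p q _ _ hp hq =>
    obtain ⟨φ, a1, a2, a3⟩ := hp
    obtain ⟨ψ, b1, b2, b3⟩ := hq
    refine ⟨_, a1.add b1, ?_, ?_⟩
    · filter_upwards [Lp.coeFn_add p.fst q.fst, a2, b2] with x h1 h2 h3
      rw [WithLp.add_fst, h1, Pi.add_apply, h2, h3]
    · filter_upwards [Lp.coeFn_add p.snd q.snd, a3, b3] with x h1 h2 h3
      rw [WithLp.add_snd, h1, Pi.add_apply, h2, h3,
        gradient_add (a1.differentiable x) (b1.differentiable x), smul_add]
  | smul c p _ hp =>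
    obtain ⟨φ, a1, a2, a3⟩ := hp
    refine ⟨_, a1.const_mul c, ?_, ?_⟩
    · filter_upwards [Lp.coeFn_smul c p.fst, a2] with x h1 h2
      rw [WithLp.smul_fst, h1, Pi.smul_apply, h2, smul_eq_mul]
    · filter_upwards [Lp.coeFn_smul c p.snd, a3] with x h1 h2
      rw [WithLp.smul_snd, h1, Pi.smul_apply, h2, gradient_const_mul c (a1.differentiable x),
        smul_comm]

theorem coe_gradientGraph (V : EuclideanSpace ℝ (Fin n) → ℝ) (s : ℝ) :
    (gradientGraph V s : Set (WithLp 2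
      (Lp ℝ 2 (gibbs V) × Lp (EuclideanSpace ℝ (Fin n)) 2 (gibbs V)))) =
    closure {p | ∃ φ, IsTest φ ∧ p.fst =ᵐ[gibbs V] φ ∧
      p.snd =ᵐ[gibbs V] fun x => s • ∇ φ x} := by
  rw [gradientGraph, Submodule.topologicalClosure_coe]
  congr 1
  ext p
  exact ⟨fun hp => span_eq V s hp, fun ⟨φ, h1, h2, h3⟩ =>
    Submodule.subset_span ⟨φ, h1.1, h1.2, h2, h3⟩⟩

theorem isFormPair_of_tendsto_Lp [IsProbabilityMeasure (gibbs V)] {s : ℝ} (hs : 0 < s)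
    {φ : ℕ → EuclideanSpace ℝ (Fin n) → ℝ} {v' : ℕ → Lp ℝ 2 (gibbs V)}
    {G' : ℕ → Lp (EuclideanSpace ℝ (Fin n)) 2 (gibbs V)} {v : Lp ℝ 2 (gibbs V)}
    {G : Lp (EuclideanSpace ℝ (Fin n)) 2 (gibbs V)} (h1 : ∀ k, IsTest (φ k))
    (h2 : ∀ k, v' k =ᵐ[gibbs V] φ k) (h3 : ∀ k, G' k =ᵐ[gibbs V] fun x => s • ∇ (φ k) x)
    (hf : Tendsto v' atTop (𝓝 v)) (hg : Tendsto G' atTop (𝓝 G)) :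
    IsFormPair V v (fun x => s⁻¹ • G x) := by
  rw [Lp.tendsto_Lp_iff_tendsto_eLpNorm'] at hf hg
  refine IsFormPair.of_tendsto (fun k => IsFormPair.of_isTest (h1 k)) (Lp.memLp v).1
    ((Lp.memLp G).1.const_smul s⁻¹) ?_ ?_
  · refine hf.congr fun k => eLpNorm_congr_ae ?_
    filter_upwards [h2 k] with x hx
    simp [hx]
  · have h4 := ENNReal.Tendsto.const_mul hg (Or.inr (enorm_ne_top (x := s⁻¹)))
    rw [mul_zero] at h4
    refine h4.congr fun k => ?_
    rw [← eLpNorm_const_smul]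
    refine eLpNorm_congr_ae ?_
    filter_upwards [h3 k] with x hx
    simp [hx, smul_sub, smul_smul, inv_mul_cancel₀ hs.ne']

theorem isFormPair_of_mem [IsProbabilityMeasure (gibbs V)] {s : ℝ} (hs : 0 < s)
    {p : WithLp 2 (Lp ℝ 2 (gibbs V) × Lp (EuclideanSpace ℝ (Fin n)) 2 (gibbs V))}
    (hp : p ∈ gradientGraph V s) : IsFormPair V p.fst (fun x => s⁻¹ • p.snd x) := by
  rw [← SetLike.mem_coe, coe_gradientGraph, mem_closure_iff_seq_limit] at hp
  obtain ⟨q, hq, hqp⟩ := hp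
  choose φ h1 h2 h3 using hq
  have hf : Tendsto (fun k => (q k).fst) atTop (𝓝 p.fst) := by
    have h := (WithLp.fstL 2 ℝ (Lp ℝ 2 (gibbs V)) (Lp (EuclideanSpace ℝ (Fin n)) 2
      (gibbs V))).continuous
    exact h.continuousAt.tendsto.comp hqp
  have hg : Tendsto (fun k => (q k).snd) atTop (𝓝 p.snd) := by
    have h := (WithLp.sndL 2 ℝ (Lp ℝ 2 (gibbs V)) (Lp (EuclideanSpace ℝ (Fin n)) 2
      (gibbs V))).continuous
    exact h.continuousAt.tendsto.comp hqp
  exact isFormPair_of_tendsto_Lp hs h1 h2 h3 hf hg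

theorem IsFormPair.mem_gradientGraph [IsProbabilityMeasure (gibbs V)] {s : ℝ}
    {v : EuclideanSpace ℝ (Fin n) → ℝ} {G : EuclideanSpace ℝ (Fin n) → EuclideanSpace ℝ (Fin n)}
    (h : IsFormPair V v G) :
    WithLp.toLp 2 (h.1.toLp v, s • h.2.toLp G) ∈ gradientGraph V s := by
  obtain ⟨φ, h1, h2, h3⟩ := h.exists_seq
  rw [← SetLike.mem_coe, coe_gradientGraph, mem_closure_iff_seq_limit]
  have m1 := fun k => (h1 k).memLp (μ := gibbs V) 2
  have m2 := fun k => (h1 k).memLp_gradient (μ := gibbs V) 2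
  refine ⟨fun k => WithLp.toLp 2 ((m1 k).toLp (φ k), s • (m2 k).toLp (∇ (φ k))),
    fun k => ⟨φ k, h1 k, (m1 k).coeFn_toLp, ?_⟩, ?_⟩
  · refine (Lp.coeFn_smul s _).trans ?_
    filter_upwards [(m2 k).coeFn_toLp] with x hx
    simp [hx]
  · refine ((WithLp.prodContinuousLinearEquiv 2 ℝ (Lp ℝ 2 (gibbs V))
      (Lp (EuclideanSpace ℝ (Fin n)) 2 (gibbs V))).symm.continuous.tendsto _).comp
      (Tendsto.prodMk_nhds ?_ (Tendsto.const_smul ?_ s))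
    · rw [Lp.tendsto_Lp_iff_tendsto_eLpNorm'']
      exact h2
    · rw [Lp.tendsto_Lp_iff_tendsto_eLpNorm'']
      exact h3

/-! ### The resolvent -/

theorem integrable_inner {X F : Type*} [MeasurableSpace X] [NormedAddCommGroup F]
    [InnerProductSpace ℝ F] {μ : Measure X} {a b : X → F}
    (ha : MemLp a 2 μ) (hb : MemLp b 2 μ) : Integrable (fun x => ⟪a x, b x⟫) μ := by
  refine (L2.integrable_inner (𝕜 := ℝ) (ha.toLp a) (hb.toLp b)).congr ?_
  filter_upwards [ha.coeFn_toLp, hb.coeFn_toLp] with x hx hx'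
  rw [hx, hx']

theorem integral_inner_eq {F : Type*} [NormedAddCommGroup F] [InnerProductSpace ℝ F]
    {μ : Measure (EuclideanSpace ℝ (Fin n))} {a b : EuclideanSpace ℝ (Fin n) → F}
    {a' b' : Lp F 2 μ} (ha : a' =ᵐ[μ] a) (hb : b' =ᵐ[μ] b) : ⟪a', b'⟫ = ∫ x, ⟪a x, b x⟫ ∂μ := by
  rw [L2.inner_def]
  refine integral_congr_ae ?_
  filter_upwards [ha, hb] with x h1 h2
  rw [h1, h2]

section Resolvent

variable [IsProbabilityMeasure (gibbs V)]

/-- The weak formulation of `u - l L u = f`. -/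
theorem exists_formResolvent {l : ℝ} (hl : 0 < l) (f : Lp ℝ 2 (gibbs V)) :
    ∃ G, IsFormPair V (formResolvent V l f) G ∧ ∀ v H, IsFormPair V v H →
      ∫ x, (f x - formResolvent V l f x) * v x ∂gibbs V = l * ∫ x, ⟪G x, H x⟫ ∂gibbs V := by
  have hs := Real.sqrt_pos.2 hl
  set s := Real.sqrt l
  set y : WithLp 2 (Lp ℝ 2 (gibbs V) × Lp (EuclideanSpace ℝ (Fin n)) 2 (gibbs V)) :=
    WithLp.toLp 2 (f, 0) with hy
  set p := (gradientGraph V s).starProjection y with hp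
  have hp1 : formResolvent V l f = p.fst := rfl
  have hmem : p ∈ gradientGraph V s := Submodule.starProjection_apply_mem _ _
  refine ⟨fun x => s⁻¹ • p.snd x, isFormPair_of_mem hs hmem, fun v H h => ?_⟩
  -- The residual (f - u, -s∇u) is orthogonal to every (v, s∇v) of the graph; as s² = l, this is the
  -- weak equation.
  have h1 := (gradientGraph V s).starProjection_inner_eq_zero y _ (h.mem_gradientGraph (s := s))
  rw [← hp, WithLp.prod_inner_apply] at h1
  have e1 : (y - p).fst = f - formResolvent V l f := rfl
  have e2 : (y - p).snd = -p.snd := by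
    change (0 : Lp (EuclideanSpace ℝ (Fin n)) 2 (gibbs V)) - p.snd = _
    rw [zero_sub]
  change ⟪(y - p).fst, h.1.toLp v⟫ + ⟪(y - p).snd, s • h.2.toLp H⟫ = 0 at h1
  rw [e1, e2, inner_neg_left, inner_smul_right,
    integral_inner_eq (Lp.coeFn_sub _ _) h.1.coeFn_toLp,
    integral_inner_eq EventuallyEq.rfl h.2.coeFn_toLp] at h1
  have e3 : ∫ x, ⟪s⁻¹ • p.snd x, H x⟫ ∂gibbs V = s⁻¹ * ∫ x, ⟪p.snd x, H x⟫ ∂gibbs V := by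
    rw [← integral_const_mul]
    refine integral_congr_ae (Eventually.of_forall fun x => ?_)
    simp only [inner_smul_left, conj_trivial]
  rw [e3]
  have e4 : l = s * s := (Real.mul_self_sqrt hl.le).symm
  have e6 : ∀ c : ℝ, l * (s⁻¹ * c) = s * c := fun c => by
    rw [e4, mul_assoc, mul_inv_cancel_left₀ hs.ne']
  rw [e6]
  have e5 : ∀ a b : ℝ, ⟪a, b⟫ = a * b := fun a b => by simp [mul_comm]
  simp only [e5, Pi.sub_apply] at h1
  linarith

/-- Subtract the two weak equations and test with the difference: its squared L² norm equals minus l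
times its energy. -/
theorem formResolvent_unique {l : ℝ} (hl : 0 < l) {f u : Lp ℝ 2 (gibbs V)}
    {G : EuclideanSpace ℝ (Fin n) → EuclideanSpace ℝ (Fin n)} (hu : IsFormPair V u G)
    (h : ∀ v H, IsFormPair V v H →
      ∫ x, (f x - u x) * v x ∂gibbs V = l * ∫ x, ⟪G x, H x⟫ ∂gibbs V) :
    formResolvent V l f = u := by
  obtain ⟨K, h1, h2⟩ := exists_formResolvent hl f
  set w := formResolvent V l f
  have h3 := hu.sub h1
  have h4 := h _ _ h3
  have h5 := h2 _ _ h3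
  have i1 : ∀ a b : Lp ℝ 2 (gibbs V), Integrable (fun x => a x * b x) (gibbs V) := fun a b =>
    (Lp.memLp a).integrable_mul (Lp.memLp b)
  have h6 : ∫ x, (u x - w x) * (u x - w x) ∂gibbs V =
      -(l * ∫ x, ⟪G x - K x, G x - K x⟫ ∂gibbs V) := by
    have e1 : ∀ x, (u x - w x) * (u x - w x) =
        (f x - w x) * (u x - w x) - (f x - u x) * (u x - w x) := fun x => by ring
    have e2 : ∀ x, ⟪G x - K x, G x - K x⟫ = ⟪G x, G x - K x⟫ - ⟪K x, G x - K x⟫ := fun x =>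
      inner_sub_left _ _ _
    simp only [e1, e2]
    have j : ∀ a : Lp ℝ 2 (gibbs V),
        Integrable (fun x => (f x - a x) * (u x - w x)) (gibbs V) := fun a =>
      ((Lp.memLp f).sub (Lp.memLp a)).integrable_mul ((Lp.memLp u).sub (Lp.memLp w))
    have i3 : MemLp (fun x => G x - K x) 2 (gibbs V) := hu.2.sub h1.2
    rw [integral_sub (j w) (j u), integral_sub (integrable_inner hu.2 i3)
      (integrable_inner h1.2 i3), h4, h5]
    ring
  have h7 : ⟪u - w, u - w⟫ = ∫ x, ⟪u x - w x, u x - w x⟫ ∂gibbs V :=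
    integral_inner_eq (Lp.coeFn_sub _ _) (Lp.coeFn_sub _ _)
  have e5 : ∀ a b : ℝ, ⟪a, b⟫ = a * b := fun a b => by simp [mul_comm]
  simp only [e5] at h7
  rw [h6] at h7
  have h8 : 0 ≤ ∫ x, ⟪G x - K x, G x - K x⟫ ∂gibbs V :=
    integral_nonneg fun x => real_inner_self_nonneg
  have h9 : ⟪u - w, u - w⟫ ≤ 0 := by rw [h7]; nlinarith
  have h10 := inner_self_eq_zero.1 (le_antisymm h9 real_inner_self_nonneg)
  exact (sub_eq_zero.1 h10).symm

/-- The resolvent is a coordinate of an orthogonal projection of (f, 0). -/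
theorem norm_formResolvent_le (l : ℝ) : ‖formResolvent V l‖ ≤ 1 := by
  refine ContinuousLinearMap.opNorm_le_bound _ zero_le_one fun f => ?_
  rw [one_mul]
  set y : WithLp 2 (Lp ℝ 2 (gibbs V) × Lp (EuclideanSpace ℝ (Fin n)) 2 (gibbs V)) :=
    WithLp.toLp 2 (f, 0) with hy
  have h1 : formResolvent V l f = ((gradientGraph V (Real.sqrt l)).starProjection y).fst := rfl
  rw [h1]
  refine (WithLp.norm_fst_le _ _).trans ((Submodule.norm_starProjection_apply_le _ _).trans ?_)
  have h2 := WithLp.prod_norm_sq_eq_of_L2 y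
  have h3 : ‖y‖ ^ 2 = ‖f‖ ^ 2 := by
    rw [h2]; simp [hy]
  exact ((sq_eq_sq₀ (norm_nonneg _) (norm_nonneg _)).1 h3).le

end Resolvent

end OrliczDecay

/-! ### Energy estimates, symmetry and the Markov property of the resolvent -/

namespace OrliczDecay

variable {n : ℕ} {V : EuclideanSpace ℝ (Fin n) → ℝ}

theorem norm_sq_eq_integral {X : Type*} [MeasurableSpace X] {μ : Measure X} (f : Lp ℝ 2 μ) :
    ‖f‖ ^ 2 = ∫ x, f x * f x ∂μ := by
  rw [← real_inner_self_eq_norm_sq, L2.inner_def]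
  simp [sq]

theorem integrable_sq_norm {X F : Type*} [MeasurableSpace X] [NormedAddCommGroup F]
    [InnerProductSpace ℝ F] {μ : Measure X} {a : X → F} (ha : MemLp a 2 μ) :
    Integrable (fun x => ‖a x‖ ^ 2) μ := by
  simpa only [real_inner_self_eq_norm_sq] using integrable_inner ha ha

theorem eLpNorm_two_sq {X F : Type*} [MeasurableSpace X] [NormedAddCommGroup F]
    [InnerProductSpace ℝ F] {μ : Measure X} {a : X → F} (ha : MemLp a 2 μ) :
    eLpNorm a 2 μ ^ 2 = ENNReal.ofReal (∫ x, ‖a x‖ ^ 2 ∂μ) := by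
  have h := eLpNorm_nnreal_pow_eq_lintegral (f := a) (μ := μ) (p := 2) two_ne_zero
  rw [ofReal_integral_eq_lintegral_ofReal (integrable_sq_norm ha)
    (Eventually.of_forall fun x => sq_nonneg _)]
  have e : ∀ x, ENNReal.ofReal (‖a x‖ ^ 2) = ‖a x‖ₑ ^ ((2 : NNReal) : ℝ) := fun x => by
    rw [ENNReal.ofReal_pow (norm_nonneg _), ofReal_norm]
    simp
  simp only [e, ← h]
  simp

section Resolvent

variable [IsProbabilityMeasure (gibbs V)]

theorem memLp_sub_resolvent (f : Lp ℝ 2 (gibbs V)) (l : ℝ) :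
    MemLp (fun x => f x - formResolvent V l f x) 2 (gibbs V) :=
  (Lp.memLp f).sub (Lp.memLp _)

/-- Test the equation with v - R_l v itself. -/
theorem resolvent_energy {l : ℝ} {v : Lp ℝ 2 (gibbs V)}
    {G H : EuclideanSpace ℝ (Fin n) → EuclideanSpace ℝ (Fin n)} (hv : IsFormPair V v H)
    (hG : IsFormPair V (formResolvent V l v) G)
    (hw : ∀ w K, IsFormPair V w K →
      ∫ x, (v x - formResolvent V l v x) * w x ∂gibbs V = l * ∫ x, ⟪G x, K x⟫ ∂gibbs V) :
    ‖v - formResolvent V l v‖ ^ 2 = l * ((∫ x, ⟪G x, H x⟫ ∂gibbs V) - ∫ x, ‖G x‖ ^ 2 ∂gibbs V) := by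
  have h1 := hw _ _ (hv.sub hG)
  have h2 : ∫ x, ⟪G x, H x - G x⟫ ∂gibbs V =
      (∫ x, ⟪G x, H x⟫ ∂gibbs V) - ∫ x, ‖G x‖ ^ 2 ∂gibbs V := by
    rw [← integral_sub (integrable_inner hG.2 hv.2) (integrable_sq_norm hG.2)]
    simp only [inner_sub_right, real_inner_self_eq_norm_sq]
  rw [norm_sq_eq_integral, ← h2, ← h1]
  refine integral_congr_ae ?_
  filter_upwards [Lp.coeFn_sub v (formResolvent V l v)] with x hx
  rw [hx, Pi.sub_apply]

/-- The right-hand side of `resolvent_energy` is nonnegative. With Cauchy–Schwarz, the resolvent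
does not increase the energy. -/
theorem resolvent_grad_le {l : ℝ} (hl : 0 < l) {v : Lp ℝ 2 (gibbs V)}
    {G H : EuclideanSpace ℝ (Fin n) → EuclideanSpace ℝ (Fin n)} (hv : IsFormPair V v H)
    (hG : IsFormPair V (formResolvent V l v) G)
    (hw : ∀ w K, IsFormPair V w K →
      ∫ x, (v x - formResolvent V l v x) * w x ∂gibbs V = l * ∫ x, ⟪G x, K x⟫ ∂gibbs V) :
    ∫ x, ‖G x‖ ^ 2 ∂gibbs V ≤ ∫ x, ⟪G x, H x⟫ ∂gibbs V := by
  have h1 := resolvent_energy hv hG hw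
  have h2 : 0 ≤ l * ((∫ x, ⟪G x, H x⟫ ∂gibbs V) - ∫ x, ‖G x‖ ^ 2 ∂gibbs V) := by
    rw [← h1]; positivity
  have := nonneg_of_mul_nonneg_right h2 hl
  linarith

theorem norm_sub_resolvent_sq_le {l : ℝ} (hl : 0 < l) {v : Lp ℝ 2 (gibbs V)}
    {H : EuclideanSpace ℝ (Fin n) → EuclideanSpace ℝ (Fin n)} (hv : IsFormPair V v H) :
    ‖v - formResolvent V l v‖ ^ 2 ≤ l * ∫ x, ‖H x‖ ^ 2 ∂gibbs V := by
  obtain ⟨G, hG, hw⟩ := exists_formResolvent hl v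
  rw [resolvent_energy hv hG hw]
  refine mul_le_mul_of_nonneg_left ?_ hl.le
  rw [← integral_sub (integrable_inner hG.2 hv.2) (integrable_sq_norm hG.2)]
  refine integral_mono ((integrable_inner hG.2 hv.2).sub (integrable_sq_norm hG.2))
    (integrable_sq_norm hv.2) fun x => ?_
  have := real_inner_le_norm (G x) (H x)
  simp only
  nlinarith [sq_nonneg (‖G x‖ - ‖H x‖), sq_nonneg (‖G x‖), sq_nonneg (‖H x‖)]

/-- For test functions the error is O(√l) by `norm_sub_resolvent_sq_le`; contractivity and density
give the general case. -/
theorem tendsto_formResolvent (f : Lp ℝ 2 (gibbs V)) :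
    Tendsto (fun l => formResolvent V l f) (𝓝[>] 0) (𝓝 f) := by
  rw [Metric.tendsto_nhds]
  intro ε hε
  obtain ⟨v, ⟨φ, hφv, hφ2, hφ1⟩, hv⟩ := Metric.mem_closure_iff.1
    (Lp.dense_hasCompactSupport_contDiff (F := ℝ) (μ := gibbs V) (p := 2) (by simp) f) (ε / 4)
    (by positivity)
  have hφ : IsTest φ := ⟨hφ1, hφ2⟩
  have hp : IsFormPair V v (∇ φ) := (IsFormPair.of_isTest hφ).congr_ae hφv EventuallyEq.rfl
  have h1 : Tendsto (fun l : ℝ => l * ∫ x, ‖∇ φ x‖ ^ 2 ∂gibbs V) (𝓝[>] 0) (𝓝 0) := by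
    have : Tendsto (fun l : ℝ => l * ∫ x, ‖∇ φ x‖ ^ 2 ∂gibbs V) (𝓝 0)
        (𝓝 (0 * ∫ x, ‖∇ φ x‖ ^ 2 ∂gibbs V)) := tendsto_id.mul_const _
    rw [zero_mul] at this
    exact this.mono_left nhdsWithin_le_nhds
  have h2 : (0 : ℝ) < (ε / 4) ^ 2 := by positivity
  filter_upwards [h1.eventually (gt_mem_nhds h2), self_mem_nhdsWithin] with l hl hl0
  have h3 := (norm_sub_resolvent_sq_le hl0 hp).trans_lt hl
  have h4 : ‖v - formResolvent V l v‖ < ε / 4 := lt_of_pow_lt_pow_left₀ 2 (by positivity) h3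
  rw [dist_eq_norm] at hv ⊢
  have h5 : ‖formResolvent V l (f - v)‖ ≤ ‖f - v‖ :=
    ((formResolvent V l).le_of_opNorm_le (norm_formResolvent_le l) _).trans_eq (one_mul _)
  have e : formResolvent V l f - f = formResolvent V l (f - v) - (v - formResolvent V l v) -
      (f - v) := by rw [map_sub]; abel
  rw [e]
  have h6 := norm_sub_le (formResolvent V l (f - v) - (v - formResolvent V l v)) (f - v)
  have h7 := norm_sub_le (formResolvent V l (f - v)) (v - formResolvent V l v)
  linarith

/-- R_l f solves the equation of parameter m with datum (m/l) f + (1 - m/l) R_l f, and solutions are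
unique. -/
theorem formResolvent_eq {l m : ℝ} (hl : 0 < l) (hm : 0 < m) :
    formResolvent V l = formResolvent V m * ((m / l) • 1 + (1 - m / l) • formResolvent V l) := by
  ext1 f
  obtain ⟨G, hG, hw⟩ := exists_formResolvent hl f
  symm
  refine formResolvent_unique hm hG fun v H h => ?_
  have h1 : ∫ x, (((m / l) • 1 + (1 - m / l) • formResolvent V l) f x -
      formResolvent V l f x) * v x ∂gibbs V =
      (m / l) * ∫ x, (f x - formResolvent V l f x) * v x ∂gibbs V := by
    rw [← integral_const_mul]
    refine integral_congr_ae ?_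
    have e : ((m / l) • 1 + (1 - m / l) • formResolvent V l) f =
      (m / l) • f + (1 - m / l) • formResolvent V l f := rfl
    rw [e]
    filter_upwards [Lp.coeFn_add ((m / l) • f) ((1 - m / l) • formResolvent V l f),
      Lp.coeFn_smul (m / l) f, Lp.coeFn_smul (1 - m / l) (formResolvent V l f)] with x h1 h2 h3
    rw [h1, Pi.add_apply, h2, h3, Pi.smul_apply, Pi.smul_apply, smul_eq_mul, smul_eq_mul]
    ring
  refine h1.trans ?_
  rw [hw v H h]
  field_simp

theorem isContractionResolvent (V : EuclideanSpace ℝ (Fin n) → ℝ)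
    [IsProbabilityMeasure (gibbs V)] : IsContractionResolvent (formResolvent V) :=
  ⟨fun l _ => norm_formResolvent_le l, fun _ _ hl hm => formResolvent_eq hl hm,
    tendsto_formResolvent⟩

/-- Test the weak equation with the constant 1, whose gradient is 0. -/
theorem integral_formResolvent {l : ℝ} (hl : 0 < l) (f : Lp ℝ 2 (gibbs V)) :
    ∫ x, formResolvent V l f x ∂gibbs V = ∫ x, f x ∂gibbs V := by
  obtain ⟨G, hG, hw⟩ := exists_formResolvent hl f
  have h1 := hw _ _ (IsFormPair.const 1)
  simp only [mul_one, inner_zero_right, integral_zero, mul_zero] at h1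
  rw [integral_sub ((Lp.memLp f).integrable one_le_two) ((Lp.memLp _).integrable one_le_two)] at h1
  linarith

/-- Each weak equation, tested with the solution of the other, has the same right-hand side. -/
theorem formResolvent_symm {l : ℝ} (hl : 0 < l) (f g : Lp ℝ 2 (gibbs V)) :
    ∫ x, formResolvent V l f x * g x ∂gibbs V = ∫ x, f x * formResolvent V l g x ∂gibbs V := by
  obtain ⟨G, hG, hw⟩ := exists_formResolvent hl f
  obtain ⟨K, hK, hw'⟩ := exists_formResolvent hl g
  have h1 := hw _ _ hK
  have h2 := hw' _ _ hG
  have i : ∀ a b : Lp ℝ 2 (gibbs V), Integrable (fun x => a x * b x) (gibbs V) := fun a b =>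
    (Lp.memLp a).integrable_mul (Lp.memLp b)
  simp only [sub_mul] at h1 h2
  rw [integral_sub (i _ _) (i _ _)] at h1 h2
  have e1 : ∫ x, ⟪K x, G x⟫ ∂gibbs V = ∫ x, ⟪G x, K x⟫ ∂gibbs V := by simp only [real_inner_comm]
  have e2 : ∫ x, g x * formResolvent V l f x ∂gibbs V =
    ∫ x, formResolvent V l f x * g x ∂gibbs V := by simp only [mul_comm]
  have e3 : ∫ x, formResolvent V l g x * formResolvent V l f x ∂gibbs V =
    ∫ x, formResolvent V l f x * formResolvent V l g x ∂gibbs V := by simp only [mul_comm]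
  rw [e1, e2, e3] at h2
  linarith

/-- Maximum principle: test with (u - C)⁺ = u - min(u, C). The energy term is nonnegative because
the gradient J of min(u, C) satisfies |J| ≤ |∇u|, so the squared norm of (u - C)⁺ is at most 0. -/
theorem formResolvent_le {l : ℝ} (hl : 0 < l) {f : Lp ℝ 2 (gibbs V)} {C : ℝ}
    (hf : ∀ᵐ x ∂gibbs V, f x ≤ C) : ∀ᵐ x ∂gibbs V, formResolvent V l f x ≤ C := by
  obtain ⟨G, hG, hw⟩ := exists_formResolvent hl f
  set u := formResolvent V l f
  obtain ⟨J, hJ, hJn⟩ := hG.inf (IsFormPair.const C)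
  have hp := hG.sub hJ
  have h1 := hw _ _ hp
  have h2 : 0 ≤ ∫ x, ⟪G x, G x - J x⟫ ∂gibbs V := by
    refine integral_nonneg fun x => ?_
    have h3 := hJn x
    rw [norm_zero, max_eq_left (norm_nonneg _)] at h3
    have h4 := real_inner_le_norm (G x) (J x)
    change (0 : ℝ) ≤ _
    rw [inner_sub_right, real_inner_self_eq_norm_sq]
    nlinarith [norm_nonneg (G x)]
  have i1 : Integrable (fun x => (u x - min (u x) C) * (u x - min (u x) C)) (gibbs V) :=
    hp.1.integrable_mul hp.1
  have h5 : ∫ x, (u x - min (u x) C) * (u x - min (u x) C) ∂gibbs V ≤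
      -∫ x, (f x - u x) * (u x - min (u x) C) ∂gibbs V := by
    rw [← integral_neg]
    refine integral_mono_ae i1 ((memLp_sub_resolvent f l).integrable_mul hp.1).neg ?_
    filter_upwards [hf] with x hx
    change _ ≤ -((f x - u x) * (u x - min (u x) C))
    rcases le_total (u x) C with h | h
    · simp [min_eq_left h]
    · rw [min_eq_right h]
      nlinarith
  have h6 : ∫ x, (u x - min (u x) C) * (u x - min (u x) C) ∂gibbs V = 0 :=
    le_antisymm (by rw [h1] at h5; nlinarith) (integral_nonneg fun x => mul_self_nonneg _)
  rw [integral_eq_zero_iff_of_nonneg (fun x => mul_self_nonneg _) i1] at h6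
  filter_upwards [h6] with x hx
  have := mul_self_eq_zero.1 hx
  have h7 := min_le_right (u x) C
  linarith

theorem abs_formResolvent_le {l : ℝ} (hl : 0 < l) {f : Lp ℝ 2 (gibbs V)} {C : ℝ}
    (hf : ∀ᵐ x ∂gibbs V, |f x| ≤ C) : ∀ᵐ x ∂gibbs V, |formResolvent V l f x| ≤ C := by
  have h1 := formResolvent_le hl (f := f) (C := C) (hf.mono fun x hx => (abs_le.1 hx).2)
  have h2 := formResolvent_le hl (f := -f) (C := C) (by
    filter_upwards [hf, Lp.coeFn_neg f] with x hx hx'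
    rw [hx', Pi.neg_apply]; linarith [(abs_le.1 hx).1])
  rw [map_neg] at h2
  filter_upwards [h1, h2, Lp.coeFn_neg (formResolvent V l f)] with x a1 a2 a3
  rw [a3, Pi.neg_apply] at a2
  exact abs_le.2 ⟨by linarith, a1⟩

/-- Duality: pair R_l f with its sign, move the resolvent onto the sign by symmetry, and use its L^∞
contractivity. -/
theorem integral_abs_formResolvent_le {l : ℝ} (hl : 0 < l) (f : Lp ℝ 2 (gibbs V)) :
    ∫ x, |formResolvent V l f x| ∂gibbs V ≤ ∫ x, |f x| ∂gibbs V := by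
  set u := formResolvent V l f
  have hum : Measurable u := (Lp.stronglyMeasurable u).measurable
  set s : EuclideanSpace ℝ (Fin n) → ℝ := fun x => if 0 ≤ u x then 1 else -1
  have hs : Measurable s := Measurable.ite (measurableSet_le measurable_const hum)
    measurable_const measurable_const
  have hsb : ∀ x, |s x| ≤ 1 := fun x => by simp only [s]; split_ifs <;> simp
  have hs2 : MemLp s 2 (gibbs V) := MemLp.of_bound hs.aestronglyMeasurable 1
    (Eventually.of_forall hsb)
  have hsL := hs2.coeFn_toLp
  have h1 := formResolvent_symm hl f (hs2.toLp s)
  have h2 : ∫ x, |u x| ∂gibbs V = ∫ x, u x * hs2.toLp s x ∂gibbs V := by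
    refine integral_congr_ae ?_
    filter_upwards [hsL] with x hx
    rw [hx]; simp only [s]
    split_ifs with h
    · rw [abs_of_nonneg h, mul_one]
    · rw [abs_of_neg (not_le.1 h), mul_neg_one]
  rw [h2, h1]
  have h3 := abs_formResolvent_le hl (f := hs2.toLp s) (C := 1) (by
    filter_upwards [hsL] with x hx
    rw [hx]; exact hsb x)
  refine integral_mono_ae ((Lp.memLp f).integrable_mul (Lp.memLp _))
    ((Lp.memLp f).integrable one_le_two).abs ?_
  filter_upwards [h3] with x hx
  simp only
  refine (le_abs_self _).trans ?_
  rw [abs_mul]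
  exact mul_le_of_le_one_right (abs_nonneg _) hx

/-- The gradient of an element of the form domain is unique. -/
theorem IsFormPair.grad_unique (hV : Continuous V) {v : EuclideanSpace ℝ (Fin n) → ℝ}
    {G H : EuclideanSpace ℝ (Fin n) → EuclideanSpace ℝ (Fin n)} (h : IsFormPair V v G)
    (h' : IsFormPair V v H) : G =ᵐ[gibbs V] H := by
  have h1 := h.sub h'
  simp only [sub_self] at h1
  filter_upwards [h1.grad_eq_zero hV] with x hx
  exact sub_eq_zero.1 hx

/-- Range of the resolvent is dense in the form domain. -/
theorem le_closure_range_resolvent (hV : Continuous V) {s : ℝ} (hs : 0 < s)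
    {p : WithLp 2 (Lp ℝ 2 (gibbs V) × Lp (EuclideanSpace ℝ (Fin n)) 2 (gibbs V))}
    (hp : p ∈ gradientGraph V s) {ε : ℝ} (hε : 0 < ε) :
    ∃ h : Lp ℝ 2 (gibbs V), ‖p - (gradientGraph V s).starProjection
      (WithLp.toLp 2 (h, 0))‖ < ε := by
  set K := gradientGraph V s with hK
  set T : Lp ℝ 2 (gibbs V) →L[ℝ]
      WithLp 2 (Lp ℝ 2 (gibbs V) × Lp (EuclideanSpace ℝ (Fin n)) 2 (gibbs V)) :=
    K.starProjection ∘L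
    (WithLp.prodContinuousLinearEquiv 2 ℝ (Lp ℝ 2 (gibbs V))
      (Lp (EuclideanSpace ℝ (Fin n)) 2 (gibbs V))).symm.toContinuousLinearMap ∘L
    ContinuousLinearMap.inl ℝ (Lp ℝ 2 (gibbs V)) (Lp (EuclideanSpace ℝ (Fin n)) 2 (gibbs V))
    with hT
  have hTapp : ∀ h, T h = K.starProjection (WithLp.toLp 2 (h, 0)) := fun h => rfl
  set W : Submodule ℝ _ := LinearMap.range T.toLinearMap with hW
  -- A vector orthogonal to the range of T projects onto a graph element with zero first coordinate;
  -- by closability its second coordinate vanishes too.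
  have h1 : Wᗮ ≤ Kᗮ := by
    intro y hy
    rw [← Submodule.starProjection_apply_eq_zero_iff]
    set q := K.starProjection y with hq
    have hqK : q ∈ K := Submodule.starProjection_apply_mem _ _
    have h2 : ∀ h : Lp ℝ 2 (gibbs V), ⟪h, q.fst⟫ = 0 := by
      intro h
      have h3 : ⟪T h, y⟫ = 0 := (Submodule.mem_orthogonal _ _).1 hy _ ⟨h, rfl⟩
      rw [hTapp, Submodule.inner_starProjection_left_eq_right, ← hq, WithLp.prod_inner_apply] at h3
      change ⟪h, q.fst⟫ + ⟪(0 : Lp (EuclideanSpace ℝ (Fin n)) 2 (gibbs V)), q.snd⟫ = 0 at h3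
      rwa [inner_zero_left, add_zero] at h3
    have h4 : q.fst = 0 := inner_self_eq_zero.1 (h2 q.fst)
    have h5 := isFormPair_of_mem hs hqK
    have h6 : IsFormPair V (fun _ => 0) (fun x => s⁻¹ • q.snd x) := by
      refine h5.congr_ae ?_ EventuallyEq.rfl
      rw [h4]; exact (Lp.coeFn_zero _ _ _).symm
    have h7 : q.snd = 0 := by
      refine Lp.ext ?_
      filter_upwards [h6.grad_eq_zero hV, Lp.coeFn_zero (EuclideanSpace ℝ (Fin n)) 2 (gibbs V)]
        with x hx hx'
      rw [hx', Pi.zero_apply]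
      exact (smul_eq_zero.1 hx).resolve_left (inv_ne_zero hs.ne')
    have h8 := WithLp.prod_norm_sq_eq_of_L2 q
    rw [h4, h7] at h8
    simpa using h8
  have h2 : K ≤ W.topologicalClosure := by
    rw [← Submodule.orthogonal_orthogonal_eq_closure]
    exact (Submodule.le_orthogonal_orthogonal K).trans (Submodule.orthogonal_le h1)
  obtain ⟨_, ⟨h, rfl⟩, hh⟩ := Metric.mem_closure_iff.1 (h2 hp) ε hε
  exact ⟨h, by rwa [dist_eq_norm] at hh⟩

end Resolvent

end OrliczDecay

/-! ### Convergence of resolvents in the form norm -/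

namespace OrliczDecay

variable {n : ℕ} {V : EuclideanSpace ℝ (Fin n) → ℝ}

theorem eLpNorm_two_le_of_integral {X F : Type*} [MeasurableSpace X] [NormedAddCommGroup F]
    [InnerProductSpace ℝ F] {μ : Measure X} {a : X → F} (ha : MemLp a 2 μ) {ε : ℝ} (hε : 0 ≤ ε)
    (h : ∫ x, ‖a x‖ ^ 2 ∂μ ≤ ε ^ 2) : eLpNorm a 2 μ ≤ ENNReal.ofReal ε := by
  rw [← ENNReal.pow_le_pow_left_iff two_ne_zero, eLpNorm_two_sq ha, ← ENNReal.ofReal_pow hε]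
  exact ENNReal.ofReal_le_ofReal h

theorem integral_norm_sub_sq {X F : Type*} [MeasurableSpace X] [NormedAddCommGroup F]
    [InnerProductSpace ℝ F] {μ : Measure X} {a b : X → F} (ha : MemLp a 2 μ) (hb : MemLp b 2 μ) :
    ∫ x, ‖a x - b x‖ ^ 2 ∂μ =
      (∫ x, ‖a x‖ ^ 2 ∂μ) - 2 * (∫ x, ⟪a x, b x⟫ ∂μ) + ∫ x, ‖b x‖ ^ 2 ∂μ := by
  simp only [norm_sub_sq_real]
  have i : Integrable (fun x => ‖a x‖ ^ 2 - 2 * ⟪a x, b x⟫) μ :=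
    (integrable_sq_norm ha).sub ((integrable_inner ha hb).const_mul 2)
  rw [integral_add i (integrable_sq_norm hb), integral_sub (integrable_sq_norm ha)
    ((integrable_inner ha hb).const_mul 2), integral_const_mul]

theorem integral_inner_le {X F : Type*} [MeasurableSpace X] [NormedAddCommGroup F]
    [InnerProductSpace ℝ F] {μ : Measure X} {a b : X → F} (ha : MemLp a 2 μ) (hb : MemLp b 2 μ) :
    2 * ∫ x, ⟪a x, b x⟫ ∂μ ≤ (∫ x, ‖a x‖ ^ 2 ∂μ) + ∫ x, ‖b x‖ ^ 2 ∂μ := by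
  have h := integral_norm_sub_sq ha hb
  have : 0 ≤ ∫ x, ‖a x - b x‖ ^ 2 ∂μ := integral_nonneg fun x => sq_nonneg _
  linarith

section Resolvent

variable [IsProbabilityMeasure (gibbs V)]

theorem norm_Lp_sq {X F : Type*} [MeasurableSpace X] [NormedAddCommGroup F]
    [InnerProductSpace ℝ F] {μ : Measure X} (f : Lp F 2 μ) : ‖f‖ ^ 2 = ∫ x, ‖f x‖ ^ 2 ∂μ := by
  rw [← real_inner_self_eq_norm_sq, L2.inner_def]
  simp only [real_inner_self_eq_norm_sq]

theorem exists_resolvent_grad_near (hV : Continuous V) {v : Lp ℝ 2 (gibbs V)}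
    {H : EuclideanSpace ℝ (Fin n) → EuclideanSpace ℝ (Fin n)} (hv : IsFormPair V v H) {ε : ℝ}
    (hε : 0 < ε) : ∃ (h : Lp ℝ 2 (gibbs V))
      (G : EuclideanSpace ℝ (Fin n) → EuclideanSpace ℝ (Fin n)),
      IsFormPair V (formResolvent V 1 h) G ∧
      (∀ w K, IsFormPair V w K →
        ∫ x, (h x - formResolvent V 1 h x) * w x ∂gibbs V = ∫ x, ⟪G x, K x⟫ ∂gibbs V) ∧
      ∫ x, ‖H x - G x‖ ^ 2 ∂gibbs V ≤ ε ^ 2 := by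
  obtain ⟨h, hh⟩ := le_closure_range_resolvent hV one_pos (hv.mem_gradientGraph (s := 1)) hε
  obtain ⟨G, hG, hw⟩ := exists_formResolvent one_pos h
  simp only [one_mul] at hw
  refine ⟨h, G, hG, hw, ?_⟩
  set q := (gradientGraph V 1).starProjection (WithLp.toLp 2 (h, 0)) with hq
  have h1 : formResolvent V 1 h = q.fst := by
    have e : ∀ s : ℝ, s = 1 → ((gradientGraph V s).starProjection (WithLp.toLp 2 (h, 0))).fst =
        q.fst := by
      rintro s rfl
      rfl
    exact e _ Real.sqrt_one
  have h2 := isFormPair_of_mem one_pos (Submodule.starProjection_apply_mem (gradientGraph V 1)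
    (WithLp.toLp 2 (h, 0)))
  rw [← hq, ← h1] at h2
  have h3 := (WithLp.norm_snd_le _ _).trans hh.le
  change ‖(1 : ℝ) • hv.2.toLp H - q.snd‖ ≤ ε at h3
  rw [one_smul] at h3
  have h4 : ∫ x, ‖H x - G x‖ ^ 2 ∂gibbs V = ‖hv.2.toLp H - q.snd‖ ^ 2 := by
    rw [norm_Lp_sq]
    refine integral_congr_ae ?_
    filter_upwards [Lp.coeFn_sub (hv.2.toLp H) q.snd, hv.2.coeFn_toLp, hG.grad_unique hV h2]
      with x a1 a2 a3
    rw [a1, Pi.sub_apply, a2, a3, inv_one, one_smul]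
  rw [h4]
  exact pow_le_pow_left₀ (norm_nonneg _) h3 2

/-- By `resolvent_grad_le`, |G - H|² ≤ ⟨H, H - G⟩ in L². Replace the left factor H by the gradient
G' of some R_1 h close to it: the equation of h turns ⟨G', H - G⟩ into ⟨h - R_1 h, v - R_l v⟩, which
tends to 0, and the remaining product is partly absorbed on the left. -/
theorem tendsto_resolvent_grad (hV : Continuous V) {v : Lp ℝ 2 (gibbs V)}
    {H : EuclideanSpace ℝ (Fin n) → EuclideanSpace ℝ (Fin n)} (hv : IsFormPair V v H) {ε : ℝ}
    (hε : 0 < ε) : ∀ᶠ l in 𝓝[>] (0 : ℝ), ∀ G, IsFormPair V (formResolvent V l v) G →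
      ∫ x, ‖G x - H x‖ ^ 2 ∂gibbs V ≤ ε ^ 2 := by
  obtain ⟨h, G', hG', hw', hHG⟩ := exists_resolvent_grad_near hV hv (half_pos hε)
  have h1 : Tendsto (fun l => ⟪h - formResolvent V 1 h, v - formResolvent V l v⟫) (𝓝[>] 0)
      (𝓝 0) := by
    have h2 := ((tendsto_formResolvent v).const_sub v)
    rw [sub_self] at h2
    have h3 := (tendsto_const_nhds (x := h - formResolvent V 1 h)).inner (𝕜 := ℝ) h2
    rwa [inner_zero_right] at h3
  have h4 : (0 : ℝ) < ε ^ 2 / 4 := by positivity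
  filter_upwards [h1.eventually (gt_mem_nhds h4), self_mem_nhdsWithin] with l hl hl0 G hG
  obtain ⟨G₀, hG₀, hw⟩ := exists_formResolvent hl0 v
  have hGG := hG.grad_unique hV hG₀
  have e0 : ∫ x, ‖G x - H x‖ ^ 2 ∂gibbs V = ∫ x, ‖G₀ x - H x‖ ^ 2 ∂gibbs V := by
    refine integral_congr_ae ?_
    filter_upwards [hGG] with x hx
    rw [hx]
  rw [e0]
  have h5 := resolvent_grad_le hl0 hv hG₀ hw
  have h6 := integral_norm_sub_sq hG₀.2 hv.2
  have h7 := hw' _ _ (hv.sub hG₀)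
  have h8 : ⟪h - formResolvent V 1 h, v - formResolvent V l v⟫ =
      ∫ x, ⟪G' x, H x - G₀ x⟫ ∂gibbs V := by
    rw [← h7, integral_inner_eq (Lp.coeFn_sub _ _) (Lp.coeFn_sub _ _)]
    refine integral_congr_ae (Eventually.of_forall fun x => ?_)
    simp [mul_comm]
  rw [h8] at hl
  have hd : MemLp (fun x => H x - G₀ x) 2 (gibbs V) := hv.2.sub hG₀.2
  have hd' : MemLp (fun x => H x - G' x) 2 (gibbs V) := hv.2.sub hG'.2
  have h9 := integral_inner_le hd' hd
  have h10 : ∫ x, ⟪H x - G' x, H x - G₀ x⟫ ∂gibbs V =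
      (∫ x, ‖H x‖ ^ 2 ∂gibbs V) - (∫ x, ⟪G₀ x, H x⟫ ∂gibbs V) -
        ∫ x, ⟪G' x, H x - G₀ x⟫ ∂gibbs V := by
    have e : ∀ x, ⟪H x - G' x, H x - G₀ x⟫ = ‖H x‖ ^ 2 - ⟪G₀ x, H x⟫ - ⟪G' x, H x - G₀ x⟫ := by
      intro x
      rw [inner_sub_left, inner_sub_right (H x), real_inner_self_eq_norm_sq,
        real_inner_comm (G₀ x) (H x)]
    simp only [e]
    have i : Integrable (fun x => ‖H x‖ ^ 2 - ⟪G₀ x, H x⟫) (gibbs V) :=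
      (integrable_sq_norm hv.2).sub (integrable_inner hG₀.2 hv.2)
    rw [integral_sub i (integrable_inner hG'.2 hd), integral_sub (integrable_sq_norm hv.2)
      (integrable_inner hG₀.2 hv.2)]
  have h11 : ∫ x, ‖H x - G₀ x‖ ^ 2 ∂gibbs V = ∫ x, ‖G₀ x - H x‖ ^ 2 ∂gibbs V := by
    simp only [norm_sub_rev]
  have h12 : (ε / 2) ^ 2 = ε ^ 2 / 4 := by ring
  rw [h12] at hHG
  linarith [sq_nonneg ε]

/-- Two resolvents are applied because the semigroup has a second-order expansion on the range of
R_l². In R²v - v = R(Rv - v) + (Rv - v), the first term is no larger than the second in either L²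
norm or energy. -/
theorem exists_resolvent_sq_near (hV : Continuous V) {v : Lp ℝ 2 (gibbs V)}
    {H : EuclideanSpace ℝ (Fin n) → EuclideanSpace ℝ (Fin n)} (hv : IsFormPair V v H) {ε : ℝ}
    (hε : 0 < ε) : ∃ l : ℝ, 0 < l ∧ ∃ G,
      IsFormPair V (formResolvent V l (formResolvent V l v)) G ∧
      eLpNorm (fun x => formResolvent V l (formResolvent V l v) x - v x) 2 (gibbs V) ≤
        ENNReal.ofReal ε ∧
      eLpNorm (fun x => G x - H x) 2 (gibbs V) ≤ ENNReal.ofReal ε := by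
  have hε' : 0 < ε / 4 := by positivity
  have h1 : ∀ᶠ l in 𝓝[>] (0 : ℝ), dist (formResolvent V l v) v < ε / 4 :=
    (tendsto_formResolvent v).eventually (Metric.ball_mem_nhds _ hε')
  obtain ⟨l, ⟨h2, h3⟩, hl⟩ := ((h1.and (tendsto_resolvent_grad hV hv hε')).and
    self_mem_nhdsWithin).exists
  have hl : 0 < l := hl
  rw [dist_eq_norm] at h2
  set R := formResolvent V l
  obtain ⟨G₁, hG₁, hw₁⟩ := exists_formResolvent hl v
  obtain ⟨K, hK, hwK⟩ := exists_formResolvent hl (R v - v)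
  have h4 := h3 G₁ hG₁
  have hd : IsFormPair V (R v - v : Lp ℝ 2 (gibbs V)) (fun x => G₁ x - H x) :=
    (hG₁.sub hv).congr_ae (Lp.coeFn_sub _ _) EventuallyEq.rfl
  have h5 := resolvent_grad_le hl hd hK hwK
  have h6 := integral_inner_le hK.2 hd.2
  have h7 : IsFormPair V (R (R v)) (fun x => K x + G₁ x) := by
    refine (hK.add hG₁).congr_ae ?_ EventuallyEq.rfl
    have e : R (R v) = R (R v - v) + R v := by rw [map_sub]; abel
    rw [e]
    exact Lp.coeFn_add _ _
  refine ⟨l, hl, _, h7, ?_, ?_⟩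
  · have h8 : ‖R (R v) - v‖ ≤ ε := by
      have e : R (R v) - v = R (R v - v) + (R v - v) := by rw [map_sub]; abel
      have h9 : ‖R (R v - v)‖ ≤ ‖R v - v‖ :=
        (R.le_of_opNorm_le (norm_formResolvent_le l) _).trans_eq (one_mul _)
      rw [e]
      refine (norm_add_le _ _).trans (by linarith)
    rw [Lp.norm_def] at h8
    refine (eLpNorm_congr_ae (Lp.coeFn_sub _ _).symm).trans_le ?_
    exact (ENNReal.le_ofReal_iff_toReal_le (Lp.memLp _).eLpNorm_ne_top hε.le).2 h8
  · have e : (fun x => K x + G₁ x - H x) = K + fun x => G₁ x - H x := by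
      funext x; simp [add_sub_assoc]
    rw [e]
    refine (eLpNorm_add_le hK.2.1 hd.2.1 one_le_two).trans ?_
    have a1 := eLpNorm_two_le_of_integral hd.2 hε'.le h4
    have a2 := eLpNorm_two_le_of_integral hK.2 hε'.le (by linarith)
    refine (add_le_add a2 a1).trans ?_
    rw [← ENNReal.ofReal_add hε'.le hε'.le]
    exact ENNReal.ofReal_le_ofReal (by linarith)

end Resolvent

/-! ### Invariance of closed convex sets -/

section Convex

variable {H : Type*} [NormedAddCommGroup H] [NormedSpace ℝ H]

theorem sum_mem_of_convex {S : Set H} (hS : Convex ℝ S) (h0 : (0 : H) ∈ S) {ι : Type*}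
    (s : Finset ι) {w : ι → ℝ} {x : ι → H} (hw : ∀ i, 0 ≤ w i) (hw1 : ∑ i ∈ s, w i ≤ 1)
    (hx : ∀ i, x i ∈ S) : ∑ i ∈ s, w i • x i ∈ S := by
  rcases eq_or_lt_of_le (Finset.sum_nonneg fun i (_ : i ∈ s) => hw i) with h | h
  · rw [Finset.sum_eq_zero fun i hi => ?_]
    · exact h0
    · rw [(Finset.sum_eq_zero_iff_of_nonneg fun i _ => hw i).1 h.symm i hi, zero_smul]
  · have h2 := hS.centerMass_mem (fun i (_ : i ∈ s) => hw i) h (fun i _ => hx i)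
    have h3 := hS.smul_mem_of_zero_mem h0 h2 ⟨h.le, hw1⟩
    rwa [Finset.centerMass, smul_smul, mul_inv_cancel₀ h.ne', one_smul] at h3

/-- Partial sums of the weights may stay below 1; the point 0 of S takes the missing mass. -/
theorem hasSum_mem_of_convex {S : Set H} (hS : Convex ℝ S) (hc : IsClosed S) (h0 : (0 : H) ∈ S)
    {ι : Type*} {w : ι → ℝ} {x : ι → H} {c : ℝ} {y : H} (hw : ∀ i, 0 ≤ w i) (hw1 : HasSum w c)
    (hc1 : c ≤ 1) (hx : ∀ i, x i ∈ S) (hy : HasSum (fun i => w i • x i) y) : y ∈ S :=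
  hc.mem_of_tendsto hy (Eventually.of_forall fun s => sum_mem_of_convex hS h0 s hw
    ((sum_le_hasSum s (fun i _ => hw i) hw1).trans hc1) hx)

end Convex

/-! ### The semigroup -/

section Semigroup

variable [IsProbabilityMeasure (gibbs V)]

theorem tendsto_semigroupL2 {t : ℝ} (ht : 0 ≤ t) (f : Lp ℝ 2 (gibbs V)) :
    Tendsto (fun l => NormedSpace.exp ((t / l) • (formResolvent V l - 1)) f) (𝓝[>] 0)
      (𝓝 (semigroupL2 V t f)) :=
  tendsto_nhds_limUnder ((isContractionResolvent V).exists_tendsto_exp ht f)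

theorem semigroupL2_sub {t : ℝ} (ht : 0 ≤ t) (f g : Lp ℝ 2 (gibbs V)) :
    semigroupL2 V t (f - g) = semigroupL2 V t f - semigroupL2 V t g := by
  refine tendsto_nhds_unique (tendsto_semigroupL2 ht (f - g)) ?_
  simp only [map_sub]
  exact (tendsto_semigroupL2 ht f).sub (tendsto_semigroupL2 ht g)

/-- The Yosida exponential is a convex series in the powers of the resolvent, so closed convex sets
containing 0 and invariant under all resolvents are invariant under the semigroup. All contraction
properties of the semigroup follow this pattern. -/
theorem semigroupL2_mem {S : Set (Lp ℝ 2 (gibbs V))} (hS : Convex ℝ S) (hc : IsClosed S)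
    (h0 : 0 ∈ S) (hR : ∀ l, 0 < l → ∀ f ∈ S, formResolvent V l f ∈ S) {t : ℝ} (ht : 0 ≤ t)
    {f : Lp ℝ 2 (gibbs V)} (hf : f ∈ S) : semigroupL2 V t f ∈ S := by
  refine hc.mem_of_tendsto (tendsto_semigroupL2 ht f) ?_
  filter_upwards [self_mem_nhdsWithin] with l hl
  have hl : 0 < l := hl
  have htl : 0 ≤ t / l := by positivity
  refine hasSum_mem_of_convex hS hc h0 (fun k => by positivity) (hasSum_exp_weights (t / l)) le_rfl
    (fun k => ?_) (hasSum_exp_sub_one_apply (formResolvent V l) (t / l) f)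
  induction k with
  | zero => exact hf
  | succ k ih => rw [pow_succ']; exact hR l hl _ ih

theorem norm_semigroupL2_le {t : ℝ} (ht : 0 ≤ t) (f : Lp ℝ 2 (gibbs V)) :
    ‖semigroupL2 V t f‖ ≤ ‖f‖ := by
  have := semigroupL2_mem (V := V) (S := Metric.closedBall 0 ‖f‖) (convex_closedBall _ _)
    Metric.isClosed_closedBall (by simp) (fun l _ g hg => ?_) ht (f := f) (by simp)
  · simpa using this
  · rw [mem_closedBall_zero_iff] at hg ⊢
    exact (((formResolvent V l).le_of_opNorm_le (norm_formResolvent_le l) _).trans_eq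
      (one_mul _)).trans hg

/-- The set of g in L² with ‖g‖₁ ≤ ‖f‖₁ is convex, closed since μ is a probability, and
resolvent-invariant. The extension of the semigroup to L¹ depends on this bound. -/
theorem eLpNorm_one_semigroupL2_le {t : ℝ} (ht : 0 ≤ t) (f : Lp ℝ 2 (gibbs V)) :
    eLpNorm (semigroupL2 V t f) 1 (gibbs V) ≤ eLpNorm f 1 (gibbs V) := by
  have hm : ∀ g : Lp ℝ 2 (gibbs V), AEStronglyMeasurable g (gibbs V) := fun g =>
    Lp.aestronglyMeasurable g
  have h21 : ∀ g : Lp ℝ 2 (gibbs V), eLpNorm g 1 (gibbs V) ≤ eLpNorm g 2 (gibbs V) := fun g =>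
    eLpNorm_le_eLpNorm_of_exponent_le one_le_two (hm g)
  refine semigroupL2_mem (S := {g | eLpNorm g 1 (gibbs V) ≤ eLpNorm f 1 (gibbs V)})
    ?_ ?_ ?_ ?_ ht (Set.mem_ofPred.2 le_rfl)
  · intro g hg h hh a b ha hb hab
    replace hg : eLpNorm g 1 (gibbs V) ≤ eLpNorm f 1 (gibbs V) := hg
    replace hh : eLpNorm h 1 (gibbs V) ≤ eLpNorm f 1 (gibbs V) := hh
    change eLpNorm (a • g + b • h : Lp ℝ 2 (gibbs V)) 1 (gibbs V) ≤ eLpNorm f 1 (gibbs V)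
    have h3 : ((a • g + b • h : Lp ℝ 2 (gibbs V)) : EuclideanSpace ℝ (Fin n) → ℝ) =ᵐ[gibbs V]
        a • (g : EuclideanSpace ℝ (Fin n) → ℝ) + b • (h : EuclideanSpace ℝ (Fin n) → ℝ) := by
      filter_upwards [Lp.coeFn_add (a • g) (b • h), Lp.coeFn_smul a g, Lp.coeFn_smul b h]
        with x h1 h2 h3
      rw [h1, Pi.add_apply, h2, h3, Pi.add_apply]
    rw [eLpNorm_congr_ae h3]
    refine (eLpNorm_add_le ((hm g).const_smul a) ((hm h).const_smul b) le_rfl).trans ?_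
    rw [eLpNorm_const_smul, eLpNorm_const_smul, Real.enorm_of_nonneg ha, Real.enorm_of_nonneg hb]
    generalize eLpNorm g 1 (gibbs V) = p at *
    generalize eLpNorm h 1 (gibbs V) = q at *
    generalize eLpNorm f 1 (gibbs V) = r at *
    calc ENNReal.ofReal a * p + ENNReal.ofReal b * q
        ≤ ENNReal.ofReal a * r + ENNReal.ofReal b * r := by gcongr
      _ = r := by rw [← add_mul, ← ENNReal.ofReal_add ha hb, hab, ENNReal.ofReal_one, one_mul]
  · refine isClosed_of_closure_subset fun g hg => ?_
    obtain ⟨u, hu, hug⟩ := mem_closure_iff_seq_limit.1 hg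
    have h1 := (Lp.tendsto_Lp_iff_tendsto_eLpNorm' _ _).1 hug
    change eLpNorm g 1 (gibbs V) ≤ eLpNorm f 1 (gibbs V)
    have h2 : Tendsto (fun k => eLpNorm (u k - g : EuclideanSpace ℝ (Fin n) → ℝ) 2 (gibbs V) +
        eLpNorm f 1 (gibbs V)) atTop (𝓝 (0 + eLpNorm f 1 (gibbs V))) := h1.add tendsto_const_nhds
    rw [zero_add] at h2
    refine ge_of_tendsto h2 (Eventually.of_forall fun k => ?_)
    have e : (g : EuclideanSpace ℝ (Fin n) → ℝ) =
        u k - (u k - g : EuclideanSpace ℝ (Fin n) → ℝ) := by funext x; simp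
    conv_lhs => rw [e]
    refine (eLpNorm_sub_le (hm _) ((hm _).sub (hm _)) le_rfl).trans ?_
    rw [add_comm]
    exact add_le_add (eLpNorm_le_eLpNorm_of_exponent_le one_le_two ((hm _).sub (hm _))) (hu k)
  · change eLpNorm ((0 : Lp ℝ 2 (gibbs V)) : EuclideanSpace ℝ (Fin n) → ℝ) 1 (gibbs V) ≤ _
    rw [eLpNorm_congr_ae (Lp.coeFn_zero _ _ _), eLpNorm_zero]
    exact zero_le
  · intro l hl g hg
    replace hg : eLpNorm g 1 (gibbs V) ≤ eLpNorm f 1 (gibbs V) := hg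
    change eLpNorm (formResolvent V l g) 1 (gibbs V) ≤ eLpNorm f 1 (gibbs V)
    refine le_trans ?_ hg
    have hi : ∀ g : Lp ℝ 2 (gibbs V), Integrable g (gibbs V) := fun g =>
      (Lp.memLp g).integrable one_le_two
    rw [eLpNorm_one_eq_lintegral_enorm, eLpNorm_one_eq_lintegral_enorm,
      ← ofReal_integral_norm_eq_lintegral_enorm (hi _),
      ← ofReal_integral_norm_eq_lintegral_enorm (hi _)]
    exact ENNReal.ofReal_le_ofReal (integral_abs_formResolvent_le hl g)

theorem formResolvent_const {l : ℝ} (hl : 0 < l) (c : ℝ) :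
    formResolvent V l (Lp.const 2 (gibbs V) c) = Lp.const 2 (gibbs V) c := by
  refine formResolvent_unique hl (G := fun _ => 0)
    ((IsFormPair.const c).congr_ae (Lp.coeFn_const _ _ _) EventuallyEq.rfl) fun v H _ => ?_
  simp

theorem semigroupL2_const {t : ℝ} (ht : 0 ≤ t) (c : ℝ) :
    semigroupL2 V t (Lp.const 2 (gibbs V) c) = Lp.const 2 (gibbs V) c := by
  refine tendsto_nhds_unique (tendsto_semigroupL2 ht _) (tendsto_const_nhds.congr' ?_)
  filter_upwards [self_mem_nhdsWithin] with l hl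
  have h1 := hasSum_exp_sub_one_apply (formResolvent V l) (t / l) (Lp.const 2 (gibbs V) c)
  have h2 : ∀ k : ℕ, (formResolvent V l ^ k) (Lp.const 2 (gibbs V) c) =
      Lp.const 2 (gibbs V) c := fun k => by
    induction k with
    | zero => rfl
    | succ k ih => rw [pow_succ', mul_apply_eq_comp, ih, formResolvent_const hl]
  simp only [h2] at h1
  have h3 := (hasSum_exp_weights (t / l)).smul_const (Lp.const 2 (gibbs V) c)
  rw [one_smul] at h3
  exact h3.unique h1

theorem neBot_comap {f : EuclideanSpace ℝ (Fin n) → ℝ} (hf : MemLp f 1 (gibbs V)) :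
    (comap (fun g : Lp ℝ 2 (gibbs V) => eLpNorm (fun x => g x - f x) 1 (gibbs V)) (𝓝 0)).NeBot := by
  rw [comap_neBot_iff]
  intro t ht
  obtain ⟨ε, hε, hεt⟩ := ENNReal.nhds_zero_basis.mem_iff.1 ht
  obtain ⟨δ, hδ, hδε⟩ := ENNReal.lt_iff_exists_real_btwn.1 hε
  obtain ⟨hδε, hδ2⟩ := hδε
  have hδ0 : 0 < δ := ENNReal.ofReal_pos.1 hδε
  obtain ⟨φ, h1, h2, h3⟩ := hf.exist_eLpNorm_sub_le (by simp) le_rfl hδ0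
  have hφ : IsTest φ := ⟨h2, h1⟩
  refine ⟨(hφ.memLp 2).toLp φ, hεt ?_⟩
  refine lt_of_le_of_lt ?_ hδ2
  rw [eLpNorm_sub_comm] at h3
  refine le_trans (eLpNorm_congr_ae ?_).le h3
  filter_upwards [(hφ.memLp (μ := gibbs V) 2).coeFn_toLp] with x hx
  rw [hx, Pi.sub_apply]

/-- L¹ contractivity makes the image filter Cauchy and density makes it nontrivial, so the
`limUnder` in the definition is a genuine limit and not a default value. -/
theorem tendsto_semigroup {t : ℝ} (ht : 0 ≤ t) {f : EuclideanSpace ℝ (Fin n) → ℝ}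
    (hf : MemLp f 1 (gibbs V)) :
    Tendsto (fun g => AddSubgroup.inclusion (Lp.antitone one_le_two) (semigroupL2 V t g))
      (comap (fun g : Lp ℝ 2 (gibbs V) => eLpNorm (fun x => g x - f x) 1 (gibbs V)) (𝓝 0))
      (𝓝 (semigroup V t f)) := by
  have := neBot_comap hf
  refine tendsto_nhds_limUnder (cauchy_map_iff_exists_tendsto.1
    (Metric.cauchy_iff.2 ⟨inferInstance, fun ε hε => ?_⟩))
  have h1 : {y : ℝ≥0∞ | y < ENNReal.ofReal (ε / 2)} ∈ 𝓝 (0 : ℝ≥0∞) :=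
    gt_mem_nhds (ENNReal.ofReal_pos.2 (half_pos hε))
  refine ⟨_, image_mem_map (preimage_mem_comap h1), ?_⟩
  rintro _ ⟨g, hg, rfl⟩ _ ⟨h, hh, rfl⟩
  have hg : eLpNorm (fun x => g x - f x) 1 (gibbs V) < ENNReal.ofReal (ε / 2) := hg
  have hh : eLpNorm (fun x => h x - f x) 1 (gibbs V) < ENNReal.ofReal (ε / 2) := hh
  have h2 : eLpNorm (g - h : Lp ℝ 2 (gibbs V)) 1 (gibbs V) < ENNReal.ofReal ε := by
    rw [eLpNorm_congr_ae (Lp.coeFn_sub g h)]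
    have e : (g - h : EuclideanSpace ℝ (Fin n) → ℝ) =
        (fun x => g x - f x) - fun x => h x - f x := by
      funext x; simp
    rw [e]
    refine (eLpNorm_sub_le ((Lp.aestronglyMeasurable g).sub hf.1)
      ((Lp.aestronglyMeasurable h).sub hf.1) le_rfl).trans_lt ?_
    refine (ENNReal.add_lt_add hg hh).trans_eq ?_
    rw [← ENNReal.ofReal_add (half_pos hε).le (half_pos hε).le, add_halves]
  have h3 := (eLpNorm_one_semigroupL2_le ht (g - h)).trans_lt h2
  rw [semigroupL2_sub ht] at h3
  rw [dist_eq_norm, ← map_sub, Lp.norm_def]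
  rw [← ENNReal.ofReal_toReal (ne_top_of_lt h3), ENNReal.ofReal_lt_ofReal_iff hε] at h3
  exact h3

theorem tendsto_semigroup_seq {t : ℝ} (ht : 0 ≤ t) {f : EuclideanSpace ℝ (Fin n) → ℝ}
    (hf : MemLp f 1 (gibbs V)) {g : ℕ → Lp ℝ 2 (gibbs V)}
    (hg : Tendsto (fun k => eLpNorm (fun x => g k x - f x) 1 (gibbs V)) atTop (𝓝 0)) :
    Tendsto (fun k => eLpNorm (fun x => semigroupL2 V t (g k) x - semigroup V t f x) 1 (gibbs V))
      atTop (𝓝 0) := by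
  have h1 := (tendsto_semigroup ht hf).comp (tendsto_comap_iff.2 hg)
  rw [Lp.tendsto_Lp_iff_tendsto_eLpNorm'] at h1
  refine h1.congr fun k => ?_
  rfl

theorem semigroup_ae_eq {t : ℝ} (ht : 0 ≤ t) (f : Lp ℝ 2 (gibbs V))
    {f' : EuclideanSpace ℝ (Fin n) → ℝ}
    (hf : f =ᵐ[gibbs V] f') : semigroup V t f' =ᵐ[gibbs V] semigroupL2 V t f := by
  have hf' : MemLp f' 1 (gibbs V) := ((Lp.memLp f).mono_exponent one_le_two).ae_eq hf
  have h1 := tendsto_semigroup_seq ht hf' (g := fun _ => f) (by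
    refine tendsto_const_nhds.congr fun k => ?_
    rw [eLpNorm_congr_ae (g := fun _ => (0 : ℝ))]
    · simp
    · filter_upwards [hf] with x hx
      rw [hx, sub_self])
  have h2 := tendsto_nhds_unique h1 tendsto_const_nhds
  filter_upwards [(eLpNorm_eq_zero_iff ((Lp.aestronglyMeasurable _).sub
    (Lp.aestronglyMeasurable _)) one_ne_zero).1 h2.symm] with x hx
  exact (sub_eq_zero.1 hx).symm

end Semigroup

end OrliczDecay

namespace OrliczDecay

/-! ### Smooth Young functions of moderate growth -/

/-- `C²` Young functions with `x Φ'(x) ≤ B Φ(x)`. -/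
structure IsModerateYoung (Φ : ℝ → ℝ) (B : ℝ) : Prop extends IsYoung Φ where
  contDiff : ContDiff ℝ 2 Φ
  mul_deriv_le : ∀ x, x * deriv Φ x ≤ B * Φ x

namespace IsModerateYoung

variable {Φ : ℝ → ℝ} {B : ℝ} (h : IsModerateYoung Φ B)
include h

theorem differentiable : Differentiable ℝ Φ := h.contDiff.differentiable two_ne_zero

theorem continuous : Continuous Φ := h.contDiff.continuous

theorem measurable : Measurable Φ := h.continuous.measurable

theorem contDiff_deriv : ContDiff ℝ 1 (deriv Φ) :=
  (contDiff_succ_iff_deriv.1 (show ContDiff ℝ (1 + 1) Φ from h.contDiff)).2.2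

theorem continuous_deriv : Continuous (deriv Φ) := h.contDiff_deriv.continuous

theorem continuous_deriv_deriv : Continuous (deriv (deriv Φ)) :=
  h.contDiff_deriv.continuous_deriv le_rfl

theorem monotone_deriv : Monotone (deriv Φ) :=
  fun _ _ hxy => h.convex.monotoneOn_deriv (fun x _ => h.differentiable x) (Set.mem_univ _)
    (Set.mem_univ _) hxy

theorem deriv_deriv_nonneg (x : ℝ) : 0 ≤ deriv (deriv Φ) x := h.monotone_deriv.deriv_nonneg

theorem tangent_le (x y : ℝ) : Φ x + deriv Φ x * (y - x) ≤ Φ y := by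
  have hd := h.differentiable x
  rcases lt_trichotomy x y with hxy | rfl | hxy
  · have h1 := h.convex.deriv_le_slope (Set.mem_univ _) (Set.mem_univ _) hxy hd
    rw [slope_def_field, le_div_iff₀ (sub_pos.2 hxy)] at h1
    linarith
  · simp
  · have h1 := h.convex.slope_le_deriv (Set.mem_univ _) (Set.mem_univ _) hxy hd
    rw [slope_def_field, div_le_iff₀ (sub_pos.2 hxy)] at h1
    linarith

theorem exists_pos : ∃ x, 0 < x ∧ 0 < Φ x :=
  ((eventually_gt_atTop 0).and (h.tendsto.eventually_gt_atTop 0)).exists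

/-- Convexity gives Φ(x) ≤ xΦ'(x), and the hypothesis xΦ'(x) ≤ BΦ(x); compare at a point where Φ is
positive. -/
theorem one_le : 1 ≤ B := by
  obtain ⟨x, hx, hΦ⟩ := h.exists_pos
  have h1 := h.tangent_le x 0
  have h2 := h.mul_deriv_le x
  rw [h.zero] at h1
  by_contra! hB
  nlinarith

/-- The growth condition says exactly that s ↦ s^(-B) Φ(sx) has nonpositive derivative for s > 0;
compare its values at 1 and c. -/
theorem apply_mul_le {c : ℝ} (hc : 1 ≤ c) (x : ℝ) : Φ (c * x) ≤ c ^ B * Φ x := by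
  have hc0 : 0 < c := by linarith
  have hd : ∀ s : ℝ, 0 < s → HasDerivAt (fun s : ℝ => s ^ (-B) * Φ (s * x))
      ((-B * s ^ (-B - 1)) * Φ (s * x) + s ^ (-B) * (deriv Φ (s * x) * x)) s := by
    intro s hs
    refine (Real.hasDerivAt_rpow_const (Or.inl hs.ne')).mul ?_
    exact (h.differentiable (s * x)).hasDerivAt.comp s
      (by simpa using (hasDerivAt_id s).mul_const x)
  have hanti : AntitoneOn (fun s : ℝ => s ^ (-B) * Φ (s * x)) (Set.Ici 1) := by
    refine antitoneOn_of_deriv_nonpos (convex_Ici 1) ?_ ?_ ?_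
    · intro s hs
      exact (hd s (lt_of_lt_of_le one_pos hs)).continuousAt.continuousWithinAt
    · intro s hs
      rw [interior_Ici] at hs
      exact (hd s (one_pos.trans hs)).differentiableAt.differentiableWithinAt
    · intro s hs
      rw [interior_Ici] at hs
      have hs0 : 0 < s := one_pos.trans hs
      rw [(hd s hs0).deriv]
      have e : s ^ (-B) = s ^ (-B - 1) * s := by
        rw [← Real.rpow_add_one hs0.ne', sub_add_cancel]
      have e2 : -B * s ^ (-B - 1) * Φ (s * x) + s ^ (-B) * (deriv Φ (s * x) * x) =
          s ^ (-B - 1) * (s * x * deriv Φ (s * x) - B * Φ (s * x)) := by rw [e]; ring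
      rw [e2]
      exact mul_nonpos_of_nonneg_of_nonpos (Real.rpow_nonneg hs0.le _)
        (sub_nonpos.2 (h.mul_deriv_le _))
  have h1 := hanti (Set.mem_Ici.2 le_rfl) (Set.mem_Ici.2 hc) hc
  simp only [Real.one_rpow, one_mul] at h1
  rw [Real.rpow_neg hc0.le, inv_mul_le_iff₀ (Real.rpow_pos_of_pos hc0 _)] at h1
  exact h1

theorem apply_abs (x : ℝ) : Φ |x| = Φ x := by
  rcases abs_cases x with ⟨e, _⟩ | ⟨e, _⟩ <;> rw [e]
  exact h.even x

theorem apply_mul_le_of_le_one {c : ℝ} (hc : 0 ≤ c) (hc1 : c ≤ 1) (x : ℝ) :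
    Φ (c * x) ≤ c * Φ x := by
  have := h.convex.2 (Set.mem_univ x) (Set.mem_univ 0) hc (sub_nonneg.2 hc1) (by ring)
  simpa [h.zero] using this

theorem mono_abs {x y : ℝ} (hxy : |x| ≤ |y|) : Φ x ≤ Φ y := by
  rw [← h.apply_abs x, ← h.apply_abs y]
  rcases (abs_nonneg y).eq_or_lt with hy | hy
  · rw [show |x| = |y| from le_antisymm hxy (hy ▸ abs_nonneg x)]
  · have h1 := h.apply_mul_le_of_le_one (div_nonneg (abs_nonneg x) hy.le)
      ((div_le_one hy).2 hxy) |y|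
    rw [div_mul_cancel₀ _ hy.ne'] at h1
    exact h1.trans (mul_le_of_le_one_left (h.nonneg _) ((div_le_one hy).2 hxy))

/-- A zero of Φ away from the origin would propagate by `apply_mul_le` to all its multiples, hence
everywhere. -/
theorem pos {x : ℝ} (hx : x ≠ 0) : 0 < Φ x := by
  obtain ⟨y, hy, hΦ⟩ := h.exists_pos
  refine lt_of_le_of_ne (h.nonneg x) fun h0 => ?_
  have h1 := h.apply_mul_le (le_max_left 1 (y / |x|)) x
  rw [← h0, mul_zero] at h1
  refine absurd (hΦ.trans_le ((h.mono_abs ?_).trans h1)) (lt_irrefl _)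
  have hx' := abs_pos.2 hx
  rw [abs_mul, abs_of_pos hy, ← div_le_iff₀ hx']
  exact (le_max_right _ _).trans (le_abs_self _)

/-- At least linear growth of Φ, from convexity: this embeds L_Φ in L¹. -/
theorem abs_mul_le (x : ℝ) : Φ 1 * |x| ≤ Φ x + Φ 1 := by
  rcases le_total |x| 1 with hx | hx
  · have := mul_le_of_le_one_right (h.nonneg 1) hx
    linarith [h.nonneg x]
  · have hx0 : 0 < |x| := by linarith
    have h1 := h.apply_mul_le_of_le_one (inv_nonneg.2 hx0.le) (inv_le_one_of_one_le₀ hx) |x|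
    rw [inv_mul_cancel₀ hx0.ne', inv_mul_eq_div, le_div_iff₀ hx0, h.apply_abs] at h1
    linarith [h.nonneg 1]

end IsModerateYoung

theorem exists_forall_abs_le {θ : ℝ → ℝ} (hθ : Continuous θ) (K : ℝ) :
    ∃ M, ∀ x, |x| ≤ K → |θ x| ≤ M := by
  obtain ⟨M, hM⟩ := (isCompact_Icc (a := -K) (b := K)).exists_bound_of_continuousOn hθ.continuousOn
  exact ⟨M, fun x hx => hM x (abs_le.1 hx)⟩

/-! ### The Luxemburg norm -/

section Luxemburg

variable {X : Type*} [MeasurableSpace X] {μ : Measure X} {Φ : ℝ → ℝ} {B : ℝ} {f : X → ℝ}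

theorem lintegral_young_mul_le (h : IsModerateYoung Φ B) {c : ℝ} (hc : 1 ≤ c) (f : X → ℝ) :
    ∫⁻ x, ENNReal.ofReal (Φ (c * f x)) ∂μ ≤
      ENNReal.ofReal (c ^ B) * ∫⁻ x, ENNReal.ofReal (Φ (f x)) ∂μ := by
  rw [← lintegral_const_mul' _ _ ENNReal.ofReal_ne_top]
  refine lintegral_mono fun x => ?_
  rw [← ENNReal.ofReal_mul (Real.rpow_nonneg (by linarith) _)]
  exact ENNReal.ofReal_le_ofReal (h.apply_mul_le hc _)

theorem lintegral_young_mul_le_of_le_one (h : IsModerateYoung Φ B) {c : ℝ} (hc : 0 ≤ c)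
    (hc1 : c ≤ 1) (f : X → ℝ) : ∫⁻ x, ENNReal.ofReal (Φ (c * f x)) ∂μ ≤
      ENNReal.ofReal c * ∫⁻ x, ENNReal.ofReal (Φ (f x)) ∂μ := by
  rw [← lintegral_const_mul' _ _ ENNReal.ofReal_ne_top]
  refine lintegral_mono fun x => ?_
  rw [← ENNReal.ofReal_mul hc]
  exact ENNReal.ofReal_le_ofReal (h.apply_mul_le_of_le_one hc hc1 _)

theorem lintegral_young_div_mono (h : IsModerateYoung Φ B) {s t : ℝ} (hs : 0 < s) (hst : s ≤ t)
    (f : X → ℝ) : ∫⁻ x, ENNReal.ofReal (Φ (f x / t)) ∂μ ≤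
      ENNReal.ofReal (s / t) * ∫⁻ x, ENNReal.ofReal (Φ (f x / s)) ∂μ := by
  have ht : 0 < t := hs.trans_le hst
  refine le_of_eq_of_le ?_ (lintegral_young_mul_le_of_le_one h (div_nonneg hs.le ht.le)
    ((div_le_one ht).2 hst) _)
  refine lintegral_congr fun x => ?_
  congr 2
  field_simp

theorem lintegral_young_div_le (h : IsModerateYoung Φ B) {s t : ℝ} (hs : 0 < s) (hst : s ≤ t)
    (f : X → ℝ) : ∫⁻ x, ENNReal.ofReal (Φ (f x / s)) ∂μ ≤
      ENNReal.ofReal ((t / s) ^ B) * ∫⁻ x, ENNReal.ofReal (Φ (f x / t)) ∂μ := by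
  have ht : 0 < t := hs.trans_le hst
  refine le_of_eq_of_le ?_ (lintegral_young_mul_le h ((one_le_div hs).2 hst) _)
  refine lintegral_congr fun x => ?_
  congr 2
  field_simp

theorem luxemburgNorm_le {s : ℝ} (hs : 0 < s) (hf : ∫⁻ x, ENNReal.ofReal (Φ (f x / s)) ∂μ ≤ 1) :
    luxemburgNorm Φ μ f ≤ ENNReal.ofReal s :=
  iInf₂_le s ⟨hs, hf⟩

theorem lintegral_le_one_of_luxemburgNorm_lt (h : IsModerateYoung Φ B) {s : ℝ}
    (hf : luxemburgNorm Φ μ f < ENNReal.ofReal s) :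
    ∫⁻ x, ENNReal.ofReal (Φ (f x / s)) ∂μ ≤ 1 := by
  simp only [luxemburgNorm, iInf_lt_iff] at hf
  obtain ⟨l, ⟨hl, hl1⟩, hls⟩ := hf
  have hls := (ENNReal.ofReal_lt_ofReal_iff_of_nonneg hl.le).1 hls
  refine (lintegral_young_div_mono h hl hls.le f).trans ?_
  refine mul_le_one' ?_ hl1
  rw [ENNReal.ofReal_le_one]
  exact (div_le_one (hl.trans hls)).2 hls.le

/-- The infimum is attained: for t > s the modular at s is at most (t/s)^B times the modular at t,
and this factor tends to 1. -/
theorem luxemburgNorm_le_iff (h : IsModerateYoung Φ B) {s : ℝ} (hs : 0 < s) :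
    luxemburgNorm Φ μ f ≤ ENNReal.ofReal s ↔ ∫⁻ x, ENNReal.ofReal (Φ (f x / s)) ∂μ ≤ 1 := by
  refine ⟨fun hf => ?_, luxemburgNorm_le hs⟩
  have h1 : Tendsto (fun t : ℝ => ENNReal.ofReal ((t / s) ^ B)) (𝓝[>] s) (𝓝 1) := by
    have : ContinuousAt (fun t : ℝ => ENNReal.ofReal ((t / s) ^ B)) s := by
      refine ENNReal.continuous_ofReal.continuousAt.comp ?_
      exact (continuousAt_id.div_const s).rpow_const (Or.inl (by simp [hs.ne']))
    have h2 := this.tendsto.mono_left (nhdsWithin_le_nhds (s := Set.Ioi s))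
    simpa [hs.ne'] using h2
  refine ge_of_tendsto h1 ?_
  filter_upwards [self_mem_nhdsWithin] with t ht
  have ht : s < t := ht
  refine (lintegral_young_div_le h hs ht.le f).trans ?_
  refine mul_le_of_le_one_right' (lintegral_le_one_of_luxemburgNorm_lt h (hf.trans_lt ?_))
  exact (ENNReal.ofReal_lt_ofReal_iff (hs.trans ht)).2 ht

theorem luxemburgNorm_congr_ae {g : X → ℝ} (hfg : f =ᵐ[μ] g) :
    luxemburgNorm Φ μ f = luxemburgNorm Φ μ g := by
  have : ∀ l : ℝ, ∫⁻ x, ENNReal.ofReal (Φ (f x / l)) ∂μ = ∫⁻ x, ENNReal.ofReal (Φ (g x / l)) ∂μ :=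
    fun l => lintegral_congr_ae (hfg.mono fun x hx => by simp only [hx])
  simp only [luxemburgNorm, this]

theorem luxemburgNorm_lt_top (h : IsModerateYoung Φ B)
    (hf : ∫⁻ x, ENNReal.ofReal (Φ (f x)) ∂μ < ⊤) : luxemburgNorm Φ μ f < ⊤ := by
  set a := (∫⁻ x, ENNReal.ofReal (Φ (f x)) ∂μ).toReal
  have hs : (0 : ℝ) < max 1 a := one_pos.trans_le (le_max_left _ _)
  refine (luxemburgNorm_le hs ?_).trans_lt ENNReal.ofReal_lt_top
  have h1 := lintegral_young_div_mono (μ := μ) h one_pos (le_max_left 1 a) f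
  simp only [div_one] at h1
  refine h1.trans ?_
  rw [← ENNReal.ofReal_toReal hf.ne, ← ENNReal.ofReal_mul (by positivity), ENNReal.ofReal_le_one,
    one_div, inv_mul_le_iff₀ hs, mul_one]
  exact le_max_right _ _

theorem eLpNorm_one_le_luxemburgNorm [IsProbabilityMeasure μ] (h : IsModerateYoung Φ B)
    (f : X → ℝ) : eLpNorm f 1 μ ≤ ENNReal.ofReal ((1 + Φ 1) / Φ 1) * luxemburgNorm Φ μ f := by
  have hΦ := h.pos one_ne_zero
  have key : ∀ s : ℝ, 0 < s → luxemburgNorm Φ μ f ≤ ENNReal.ofReal s →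
      eLpNorm f 1 μ ≤ ENNReal.ofReal ((1 + Φ 1) / Φ 1) * ENNReal.ofReal s := by
    intro s hs hf
    rw [luxemburgNorm_le_iff h hs] at hf
    have hk : 0 < s / Φ 1 := by positivity
    calc eLpNorm f 1 μ = ∫⁻ x, ‖f x‖ₑ ∂μ := eLpNorm_one_eq_lintegral_enorm
      _ ≤ ∫⁻ x, ENNReal.ofReal (s / Φ 1) *
            (ENNReal.ofReal (Φ (f x / s)) + ENNReal.ofReal (Φ 1)) ∂μ := by
          refine lintegral_mono fun x => ?_
          rw [← ofReal_norm, ← ENNReal.ofReal_add (h.nonneg _) hΦ.le,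
            ← ENNReal.ofReal_mul hk.le]
          refine ENNReal.ofReal_le_ofReal ?_
          have := h.abs_mul_le (f x / s)
          rw [abs_div, abs_of_pos hs] at this
          rw [div_mul_eq_mul_div, le_div_iff₀ hΦ, Real.norm_eq_abs]
          calc |f x| * Φ 1 = s * (Φ 1 * (|f x| / s)) := by field_simp
            _ ≤ _ := mul_le_mul_of_nonneg_left this hs.le
      _ = ENNReal.ofReal (s / Φ 1) *
            ((∫⁻ x, ENNReal.ofReal (Φ (f x / s)) ∂μ) + ENNReal.ofReal (Φ 1)) := by
          rw [lintegral_const_mul' _ _ ENNReal.ofReal_ne_top,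
            lintegral_add_right _ measurable_const]
          simp
      _ ≤ ENNReal.ofReal (s / Φ 1) * (1 + ENNReal.ofReal (Φ 1)) := by gcongr
      _ = ENNReal.ofReal ((1 + Φ 1) / Φ 1) * ENNReal.ofReal s := by
          rw [← ENNReal.ofReal_one, ← ENNReal.ofReal_add zero_le_one hΦ.le,
            ← ENNReal.ofReal_mul hk.le, ← ENNReal.ofReal_mul (by positivity)]
          congr 1
          ring
  rcases eq_or_ne (luxemburgNorm Φ μ f) ⊤ with hN | hN
  · rw [hN, ENNReal.mul_top (ENNReal.ofReal_pos.2 (by positivity)).ne']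
    exact le_top
  have h1 : Tendsto (fun s : ℝ => ENNReal.ofReal ((1 + Φ 1) / Φ 1) * ENNReal.ofReal s)
      (𝓝[>] (luxemburgNorm Φ μ f).toReal)
      (𝓝 (ENNReal.ofReal ((1 + Φ 1) / Φ 1) * luxemburgNorm Φ μ f)) := by
    refine ENNReal.Tendsto.const_mul ?_ (Or.inr ENNReal.ofReal_ne_top)
    have := (ENNReal.continuous_ofReal.tendsto (luxemburgNorm Φ μ f).toReal).mono_left
      (nhdsWithin_le_nhds (s := Set.Ioi (luxemburgNorm Φ μ f).toReal))
    rwa [ENNReal.ofReal_toReal hN] at this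
  refine ge_of_tendsto h1 ?_
  filter_upwards [self_mem_nhdsWithin] with s hs
  have hs : (luxemburgNorm Φ μ f).toReal < s := hs
  refine key s (ENNReal.toReal_nonneg.trans_lt hs) ?_
  rw [← ENNReal.ofReal_toReal hN]
  exact ENNReal.ofReal_le_ofReal hs.le

theorem luxemburgNorm_zero (h : IsModerateYoung Φ B) (hf : f =ᵐ[μ] 0) :
    luxemburgNorm Φ μ f = 0 := by
  rw [luxemburgNorm_congr_ae hf]
  refine le_antisymm (ENNReal.le_of_forall_pos_le_add fun ε hε _ => ?_) zero_le
  rw [zero_add]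
  refine (luxemburgNorm_le (NNReal.coe_pos.2 hε) ?_).trans_eq (ENNReal.ofReal_coe_nnreal)
  simp [h.zero]

/-- Below the norm the modular exceeds 1, and the growth bound prevents a jump at the norm. This
allows normalisation by ∫ Φ = 1 throughout. -/
theorem lintegral_young_eq_one (h : IsModerateYoung Φ B) (hf : luxemburgNorm Φ μ f < ⊤)
    (h0 : luxemburgNorm Φ μ f ≠ 0) :
    ∫⁻ x, ENNReal.ofReal (Φ (f x / (luxemburgNorm Φ μ f).toReal)) ∂μ = 1 := by
  set s := (luxemburgNorm Φ μ f).toReal with hs_def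
  have hs : 0 < s := ENNReal.toReal_pos h0 hf.ne
  have hN : luxemburgNorm Φ μ f = ENNReal.ofReal s := (ENNReal.ofReal_toReal hf.ne).symm
  refine le_antisymm ((luxemburgNorm_le_iff h hs).1 hN.le) ?_
  have h1 : Tendsto (fun t : ℝ => ENNReal.ofReal ((s / t) ^ B) *
      ∫⁻ x, ENNReal.ofReal (Φ (f x / s)) ∂μ) (𝓝[<] s)
      (𝓝 (1 * ∫⁻ x, ENNReal.ofReal (Φ (f x / s)) ∂μ)) := by
    refine ENNReal.Tendsto.mul_const ?_ (Or.inl one_ne_zero)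
    have : ContinuousAt (fun t : ℝ => ENNReal.ofReal ((s / t) ^ B)) s := by
      refine ENNReal.continuous_ofReal.continuousAt.comp ?_
      exact (continuousAt_const.div continuousAt_id hs.ne').rpow_const
        (Or.inl (div_ne_zero hs.ne' hs.ne'))
    have h2 := this.tendsto.mono_left (nhdsWithin_le_nhds (s := Set.Iio s))
    simpa [hs.ne'] using h2
  rw [one_mul] at h1
  refine ge_of_tendsto h1 ?_
  filter_upwards [Ioo_mem_nhdsLT hs] with t ht
  refine le_trans ?_ (lintegral_young_div_le h ht.1 ht.2.le f)
  by_contra! hlt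
  have := luxemburgNorm_le ht.1 hlt.le
  rw [hN, ENNReal.ofReal_le_ofReal_iff ht.1.le] at this
  exact absurd ht.2 (not_lt.2 this)

theorem luxemburgNorm_eq_one (h : IsModerateYoung Φ B)
    (hf : ∫⁻ x, ENNReal.ofReal (Φ (f x)) ∂μ = 1) : luxemburgNorm Φ μ f = 1 := by
  refine le_antisymm ?_ ?_
  · rw [← ENNReal.ofReal_one]
    exact luxemburgNorm_le one_pos (by simp [hf])
  · refine le_iInf₂ fun l hl => ?_
    rw [ENNReal.one_le_ofReal]
    by_contra! hl1
    have h1 := lintegral_young_div_mono (μ := μ) h hl.1 hl1.le f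
    simp only [div_one, hf] at h1
    have h2 := h1.trans (mul_le_of_le_one_right' hl.2)
    rw [ENNReal.one_le_ofReal] at h2
    linarith

theorem lintegral_young_le_of_tendsto_ae (h : IsModerateYoung Φ B) {g : ℕ → X → ℝ}
    (hg : ∀ k, AEMeasurable (g k) μ)
    (hlim : ∀ᵐ x ∂μ, Tendsto (fun k => g k x) atTop (𝓝 (f x))) {c : ℝ≥0∞}
    (hc : ∀ᶠ k in atTop, ∫⁻ x, ENNReal.ofReal (Φ (g k x)) ∂μ ≤ c) :
    ∫⁻ x, ENNReal.ofReal (Φ (f x)) ∂μ ≤ c := by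
  calc ∫⁻ x, ENNReal.ofReal (Φ (f x)) ∂μ
      = ∫⁻ x, liminf (fun k => ENNReal.ofReal (Φ (g k x))) atTop ∂μ := by
        refine lintegral_congr_ae ?_
        filter_upwards [hlim] with x hx
        exact (((ENNReal.continuous_ofReal.comp h.continuous).tendsto _).comp hx).liminf_eq.symm
    _ ≤ liminf (fun k => ∫⁻ x, ENNReal.ofReal (Φ (g k x)) ∂μ) atTop :=
        lintegral_liminf_le' fun k => (h.measurable.comp_aemeasurable (hg k)).ennreal_ofReal
    _ ≤ c := liminf_le_of_le (by isBoundedDefault) fun b hb => by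
        obtain ⟨k, hk⟩ := (hb.and hc).exists
        exact hk.1.trans hk.2

/-- By the growth bound, finiteness for one multiple of f implies it for all. -/
theorem MemOrlicz.lintegral_lt_top (h : IsModerateYoung Φ B) (hf : MemOrlicz Φ μ f) (α : ℝ) :
    ∫⁻ x, ENNReal.ofReal (Φ (α * f x)) ∂μ < ⊤ := by
  obtain ⟨-, β, hβ, hfin⟩ := hf
  have h1 := lintegral_young_mul_le (μ := μ) h (le_max_left 1 (|α| / β)) fun x => β * f x
  refine lt_of_le_of_lt (lintegral_mono fun x => ENNReal.ofReal_le_ofReal (h.mono_abs ?_))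
    (h1.trans_lt (ENNReal.mul_lt_top ENNReal.ofReal_lt_top hfin))
  rw [abs_mul, abs_mul, abs_mul, abs_of_pos hβ, ← mul_assoc]
  refine mul_le_mul_of_nonneg_right ?_ (abs_nonneg _)
  rw [← div_le_iff₀ hβ]
  exact (le_max_right _ _).trans (le_abs_self _)

theorem MemOrlicz.integrable [IsProbabilityMeasure μ] (h : IsModerateYoung Φ B)
    (hf : MemOrlicz Φ μ f) : Integrable f μ := by
  refine memLp_one_iff_integrable.1 ⟨hf.1.aestronglyMeasurable, ?_⟩
  have h1 := hf.lintegral_lt_top h 1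
  simp only [one_mul] at h1
  exact (eLpNorm_one_le_luxemburgNorm h f).trans_lt
    (ENNReal.mul_lt_top ENNReal.ofReal_lt_top (luxemburgNorm_lt_top h h1))

theorem MemOrlicz.lintegral_sub_const_lt_top [IsProbabilityMeasure μ] (h : IsModerateYoung Φ B)
    (hf : MemOrlicz Φ μ f) (α c : ℝ) : ∫⁻ x, ENNReal.ofReal (Φ (α * (f x - c))) ∂μ < ⊤ := by
  have h1 : ∀ x, ENNReal.ofReal (Φ (α * (f x - c))) ≤
      ENNReal.ofReal (Φ (2 * α * f x)) + ENNReal.ofReal (Φ (2 * α * c)) := by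
    intro x
    rw [← ENNReal.ofReal_add (h.nonneg _) (h.nonneg _)]
    refine ENNReal.ofReal_le_ofReal ?_
    have h2 := h.convex.2 (Set.mem_univ (2 * α * f x)) (Set.mem_univ (-(2 * α * c)))
      (by norm_num : (0 : ℝ) ≤ 1 / 2) (by norm_num : (0 : ℝ) ≤ 1 / 2) (by norm_num)
    simp only [smul_eq_mul, h.even] at h2
    rw [show 1 / 2 * (2 * α * f x) + 1 / 2 * -(2 * α * c) = α * (f x - c) by ring] at h2
    linarith [h.nonneg (2 * α * f x), h.nonneg (2 * α * c)]
  refine (lintegral_mono h1).trans_lt ?_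
  rw [lintegral_add_right _ measurable_const]
  refine ENNReal.add_lt_top.2 ⟨hf.lintegral_lt_top h _, ?_⟩
  simp

theorem MemOrlicz.luxemburgNorm_sub_const_lt_top [IsProbabilityMeasure μ]
    (h : IsModerateYoung Φ B) (hf : MemOrlicz Φ μ f) (c : ℝ) :
    luxemburgNorm Φ μ (fun x => f x - c) < ⊤ := by
  refine luxemburgNorm_lt_top h ?_
  simpa using hf.lintegral_sub_const_lt_top h 1 c

theorem memOrlicz_of_bounded [IsProbabilityMeasure μ] (h : IsModerateYoung Φ B) (hm : Measurable f)
    {K : ℝ} (hK : ∀ᵐ x ∂μ, |f x| ≤ K) : MemOrlicz Φ μ f := by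
  refine ⟨hm, 1, one_pos, ?_⟩
  refine lt_of_le_of_lt (lintegral_mono_ae (g := fun _ => ENNReal.ofReal (Φ K)) ?_) (by simp)
  filter_upwards [hK] with x hx
  rw [one_mul]
  exact ENNReal.ofReal_le_ofReal (h.mono_abs (hx.trans (le_abs_self K)))

theorem integrable_young [IsProbabilityMeasure μ] {θ : ℝ → ℝ} (hθ : Continuous θ)
    (hm : AEStronglyMeasurable f μ) {K : ℝ} (hK : ∀ᵐ x ∂μ, |f x| ≤ K) :
    Integrable (fun x => θ (f x)) μ := by
  obtain ⟨M, hM⟩ := exists_forall_abs_le hθ K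
  refine Integrable.of_bound (hθ.comp_aestronglyMeasurable hm) M ?_
  filter_upwards [hK] with x hx
  exact hM _ hx

theorem lintegral_young_eq [IsProbabilityMeasure μ] (h : IsModerateYoung Φ B)
    (hm : AEStronglyMeasurable f μ) {K : ℝ} (hK : ∀ᵐ x ∂μ, |f x| ≤ K) :
    ∫⁻ x, ENNReal.ofReal (Φ (f x)) ∂μ = ENNReal.ofReal (∫ x, Φ (f x) ∂μ) :=
  (ofReal_integral_eq_lintegral_ofReal (integrable_young h.continuous hm hK)
    (Eventually.of_forall fun _ => h.nonneg _)).symm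

end Luxemburg

end OrliczDecay

namespace OrliczDecay

/-! ### Convergence of modulars and energies of bounded sequences -/

theorem aestronglyMeasurable_div_const {X : Type*} [MeasurableSpace X] {μ : Measure X}
    {f : X → ℝ} (hf : AEStronglyMeasurable f μ) (s : ℝ) :
    AEStronglyMeasurable (fun x => f x / s) μ :=
  (continuous_id.div_const s).comp_aestronglyMeasurable hf

section Convergence

variable {X : Type*} [MeasurableSpace X] {μ : Measure X} [IsProbabilityMeasure μ]
  {u : ℕ → X → ℝ} {v : X → ℝ} {K : ℝ}

theorem ae_abs_le_of_tendsto (hb : ∀ k, ∀ᵐ x ∂μ, |u k x| ≤ K)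
    (hlim : ∀ᵐ x ∂μ, Tendsto (fun k => u k x) atTop (𝓝 (v x))) : ∀ᵐ x ∂μ, |v x| ≤ K := by
  filter_upwards [ae_all_iff.2 hb, hlim] with x h1 h2
  exact le_of_tendsto h2.abs (Eventually.of_forall h1)

theorem tendsto_integral_comp {θ : ℝ → ℝ} (hθ : Continuous θ)
    (hu : ∀ k, AEStronglyMeasurable (u k) μ) (hb : ∀ k, ∀ᵐ x ∂μ, |u k x| ≤ K)
    (hlim : ∀ᵐ x ∂μ, Tendsto (fun k => u k x) atTop (𝓝 (v x))) :
    Tendsto (fun k => ∫ x, θ (u k x) ∂μ) atTop (𝓝 (∫ x, θ (v x) ∂μ)) := by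
  obtain ⟨M, hM⟩ := exists_forall_abs_le hθ K
  refine tendsto_integral_of_dominated_convergence (fun _ => M)
    (fun k => hθ.comp_aestronglyMeasurable (hu k)) (integrable_const M) (fun k => ?_) ?_
  · filter_upwards [hb k] with x hx
    exact hM _ hx
  · filter_upwards [hlim] with x hx
    exact (hθ.tendsto _).comp hx

theorem memLp_smul_of_bounded {F : Type*} [NormedAddCommGroup F] [NormedSpace ℝ F]
    {θ : ℝ → ℝ} (hθ : Continuous θ) (hv : AEStronglyMeasurable v μ)
    (hK : ∀ᵐ x ∂μ, |v x| ≤ K) {G : X → F} (hG : MemLp G 2 μ) :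
    MemLp (fun x => θ (v x) • G x) 2 μ := by
  obtain ⟨M, hM⟩ := exists_forall_abs_le hθ K
  refine MemLp.of_le_mul (c := M) hG ((hθ.comp_aestronglyMeasurable hv).smul hG.1) ?_
  filter_upwards [hK] with x hx
  rw [norm_smul]
  exact mul_le_mul_of_nonneg_right (hM _ hx) (norm_nonneg _)

theorem tendsto_integral_sq_norm {F : Type*} [NormedAddCommGroup F] [InnerProductSpace ℝ F]
    {a : ℕ → X → F} {b : X → F} (ha : ∀ k, MemLp (a k) 2 μ) (hb : MemLp b 2 μ)
    (h : Tendsto (fun k => eLpNorm (fun x => a k x - b x) 2 μ) atTop (𝓝 0)) :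
    Tendsto (fun k => ∫ x, ‖a k x‖ ^ 2 ∂μ) atTop (𝓝 (∫ x, ‖b x‖ ^ 2 ∂μ)) := by
  have h1 : Tendsto (fun k => (ha k).toLp) atTop (𝓝 hb.toLp) :=
    (Lp.tendsto_Lp_iff_tendsto_eLpNorm'' a ha b hb).2 h
  have h2 := h1.norm.pow 2
  have e : ∀ {c : X → F} (hc : MemLp c 2 μ), ‖hc.toLp‖ ^ 2 = ∫ x, ‖c x‖ ^ 2 ∂μ := fun hc => by
    rw [norm_Lp_sq]
    exact integral_congr_ae (hc.coeFn_toLp.mono fun x hx => by simp only [hx])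
  simpa only [e] using h2

/-- Write the density as |√θ(u) G|² and use L² convergence of √θ(u_k) G_k, which needs no domination
of the gradients. -/
theorem tendsto_integral_energy {F : Type*} [NormedAddCommGroup F] [InnerProductSpace ℝ F]
    {θ : ℝ → ℝ} (hθ : Continuous θ) (h0 : ∀ x, 0 ≤ θ x) {G : ℕ → X → F} {H : X → F}
    (hu : ∀ k, AEStronglyMeasurable (u k) μ) (hv : AEStronglyMeasurable v μ)
    (hb : ∀ k, ∀ᵐ x ∂μ, |u k x| ≤ K)
    (hlim : ∀ᵐ x ∂μ, Tendsto (fun k => u k x) atTop (𝓝 (v x)))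
    (hG : ∀ k, MemLp (G k) 2 μ) (hH : MemLp H 2 μ)
    (hGH : Tendsto (fun k => eLpNorm (fun x => G k x - H x) 2 μ) atTop (𝓝 0)) :
    Tendsto (fun k => ∫ x, ‖G k x‖ ^ 2 * θ (u k x) ∂μ) atTop
      (𝓝 (∫ x, ‖H x‖ ^ 2 * θ (v x) ∂μ)) := by
  have hc : Continuous fun x => Real.sqrt (θ x) := hθ.sqrt
  obtain ⟨M, hM⟩ := exists_forall_abs_le hc K
  have h1 := tendsto_eLpNorm_smul_sub (p := 2) (by simp) (θ := fun k x => Real.sqrt (θ (u k x)))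
    (η := fun x => Real.sqrt (θ (v x))) (M := M)
    (fun k => hc.comp_aestronglyMeasurable (hu k)) (hc.comp_aestronglyMeasurable hv)
    (fun k => (hG k).1) hH (fun k => (hb k).mono fun x hx => hM _ hx)
    (hlim.mono fun x hx => (hc.tendsto _).comp hx) hGH
  have h2 := tendsto_integral_sq_norm (fun k => memLp_smul_of_bounded hc (hu k) (hb k) (hG k))
    (memLp_smul_of_bounded hc hv (ae_abs_le_of_tendsto hb hlim) hH) h1
  have e : ∀ (y : ℝ) (z : F), ‖Real.sqrt (θ y) • z‖ ^ 2 = ‖z‖ ^ 2 * θ y := by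
    intro y z
    rw [norm_smul, mul_pow, Real.norm_eq_abs, sq_abs, Real.sq_sqrt (h0 y), mul_comm]
  simpa only [e] using h2

variable {Φ : ℝ → ℝ} {B : ℝ}

theorem tendsto_lintegral_young (h : IsModerateYoung Φ B)
    (hu : ∀ k, AEStronglyMeasurable (u k) μ) (hv : AEStronglyMeasurable v μ)
    (hb : ∀ k, ∀ᵐ x ∂μ, |u k x| ≤ K)
    (hlim : ∀ᵐ x ∂μ, Tendsto (fun k => u k x) atTop (𝓝 (v x))) {s : ℝ} (hs : 0 < s) :
    Tendsto (fun k => ∫⁻ x, ENNReal.ofReal (Φ (u k x / s)) ∂μ) atTop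
      (𝓝 (∫⁻ x, ENNReal.ofReal (Φ (v x / s)) ∂μ)) := by
  have hb' := ae_abs_le_of_tendsto hb hlim
  have hd : ∀ y : ℝ, |y| ≤ K → |y / s| ≤ K / s := fun y hy => by
    rw [abs_div, abs_of_pos hs]
    gcongr
  have h1 := tendsto_integral_comp (h.continuous.comp (continuous_id.div_const s)) hu hb hlim
  rw [lintegral_young_eq h (aestronglyMeasurable_div_const hv s) (hb'.mono fun x hx => hd _ hx)]
  refine ((ENNReal.continuous_ofReal.tendsto _).comp h1).congr fun k => ?_
  exact (lintegral_young_eq h (aestronglyMeasurable_div_const (hu k) s)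
    ((hb k).mono fun x hx => hd _ hx)).symm

/-- For each s the modular at scale s converges; for the limit it is above 1 when 0 < s < 1 and
below 1 when s > 1. -/
theorem tendsto_luxemburgNorm (h : IsModerateYoung Φ B)
    (hu : ∀ k, AEStronglyMeasurable (u k) μ) (hv : AEStronglyMeasurable v μ)
    (hb : ∀ k, ∀ᵐ x ∂μ, |u k x| ≤ K)
    (hlim : ∀ᵐ x ∂μ, Tendsto (fun k => u k x) atTop (𝓝 (v x)))
    (h1 : ∫⁻ x, ENNReal.ofReal (Φ (v x)) ∂μ = 1) :
    Tendsto (fun k => luxemburgNorm Φ μ (u k)) atTop (𝓝 1) := by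
  have hN := luxemburgNorm_eq_one h h1
  refine tendsto_order.2 ⟨fun a ha => ?_, fun b hb1 => ?_⟩
  · obtain ⟨s, hs0, has, hs1⟩ := ENNReal.lt_iff_exists_real_btwn.1 ha
    have hs : 0 < s := ENNReal.ofReal_pos.1 (bot_le.trans_lt has)
    have h2 : 1 < ∫⁻ x, ENNReal.ofReal (Φ (v x / s)) ∂μ := by
      by_contra! hc
      exact absurd ((luxemburgNorm_le hs hc).trans_lt hs1) (by rw [hN]; exact lt_irrefl _)
    filter_upwards [(tendsto_lintegral_young h hu hv hb hlim hs).eventually (lt_mem_nhds h2)]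
      with k hk
    refine has.trans (not_le.1 fun hle => ?_)
    exact absurd ((luxemburgNorm_le_iff h hs).1 hle) (not_le.2 hk)
  · obtain ⟨s, hs0, hs1, hsb⟩ := ENNReal.lt_iff_exists_real_btwn.1 hb1
    have hs1 : 1 < s := ENNReal.one_lt_ofReal.1 hs1
    have hs : 0 < s := by linarith
    have h2 : ∫⁻ x, ENNReal.ofReal (Φ (v x / s)) ∂μ < 1 := by
      have h3 := lintegral_young_div_mono (μ := μ) h one_pos hs1.le v
      simp only [div_one, h1, mul_one] at h3
      refine h3.trans_lt (ENNReal.ofReal_lt_one.2 ((div_lt_one hs).2 hs1))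
    filter_upwards [(tendsto_lintegral_young h hu hv hb hlim hs).eventually (gt_mem_nhds h2)]
      with k hk
    exact (luxemburgNorm_le hs hk.le).trans_lt hsb

end Convergence

/-! ### The inequality on bounded elements of the form domain -/

variable {n : ℕ} {V : EuclideanSpace ℝ (Fin n) → ℝ} {Φ : ℝ → ℝ} {B : ℝ}

/-- The modified Orlicz-Sobolev inequality for bounded elements of the domain of the Dirichlet
form with mean `0` and `∫ Φ(v) dμ = 1`. -/
def FormInequality (V : EuclideanSpace ℝ (Fin n) → ℝ) (Φ : ℝ → ℝ) (C : ℝ) : Prop :=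
  ∀ v G, IsFormPair V v G → ∀ K, (∀ᵐ x ∂gibbs V, |v x| ≤ K) → ∫ x, v x ∂gibbs V = 0 →
    ∫ x, Φ (v x) ∂gibbs V = 1 → 1 ≤ C * ∫ x, ‖G x‖ ^ 2 * deriv (deriv Φ) (v x) ∂gibbs V

variable [IsProbabilityMeasure (gibbs V)]

theorem integrable_energy (h : IsModerateYoung Φ B) {v : EuclideanSpace ℝ (Fin n) → ℝ}
    {G : EuclideanSpace ℝ (Fin n) → EuclideanSpace ℝ (Fin n)}
    (hv : AEStronglyMeasurable v (gibbs V))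
    {K : ℝ} (hK : ∀ᵐ x ∂gibbs V, |v x| ≤ K) (hG : MemLp G 2 (gibbs V)) :
    Integrable (fun x => ‖G x‖ ^ 2 * deriv (deriv Φ) (v x)) (gibbs V) := by
  have hc : Continuous fun x => Real.sqrt (deriv (deriv Φ) x) := h.continuous_deriv_deriv.sqrt
  refine (integrable_sq_norm (memLp_smul_of_bounded hc hv hK hG)).congr
    (Eventually.of_forall fun x => ?_)
  simp only [norm_smul, mul_pow, Real.norm_eq_abs, sq_abs]
  rw [Real.sq_sqrt (h.deriv_deriv_nonneg _), mul_comm]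

/-- Approximation of a bounded normalised element of the form domain by bounded test functions. -/
theorem IsFormPair.exists_normalized_seq (h : IsModerateYoung Φ B)
    {v : EuclideanSpace ℝ (Fin n) → ℝ} {G : EuclideanSpace ℝ (Fin n) → EuclideanSpace ℝ (Fin n)}
    (hvG : IsFormPair V v G) {K : ℝ} (hK : ∀ᵐ x ∂gibbs V, |v x| ≤ K)
    (hv0 : ∫ x, v x ∂gibbs V = 0) (hv1 : ∫ x, Φ (v x) ∂gibbs V = 1) :
    ∃ φ : ℕ → EuclideanSpace ℝ (Fin n) → ℝ, ∃ M : ℝ, (∀ k, IsTest (φ k)) ∧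
      (∀ k x, |φ k x| ≤ M) ∧ (∀ k x, |φ k x - ∫ y, φ k y ∂gibbs V| ≤ 2 * M) ∧
      Tendsto (fun k => ∫ x, φ k x ∂gibbs V) atTop (𝓝 0) ∧
      (∀ᵐ x ∂gibbs V, Tendsto (fun k => φ k x - ∫ y, φ k y ∂gibbs V) atTop (𝓝 (v x))) ∧
      Tendsto (fun k => luxemburgNorm Φ (gibbs V) fun x => φ k x - ∫ y, φ k y ∂gibbs V) atTop
        (𝓝 1) ∧
      Tendsto (fun k => eLpNorm (fun x => φ k x - v x) 2 (gibbs V)) atTop (𝓝 0) ∧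
      Tendsto (fun k => eLpNorm (fun x => ∇ (φ k) x - G x) 2 (gibbs V)) atTop (𝓝 0) := by
  obtain ⟨φ, M, hφ, hM, hae, hval, hG⟩ := hvG.exists_bounded_seq hK
  have hvm := hvG.1.1
  have hφm : ∀ k, AEStronglyMeasurable (φ k) (gibbs V) := fun k =>
    (hφ k).contDiff.continuous.aestronglyMeasurable
  have hm : Tendsto (fun k => ∫ x, φ k x ∂gibbs V) atTop (𝓝 0) := by
    rw [← hv0]
    exact tendsto_integral_comp continuous_id hφm (fun k => Eventually.of_forall (hM k)) hae
  have hub : ∀ k x, |φ k x - ∫ y, φ k y ∂gibbs V| ≤ 2 * M := by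
    intro k x
    have h1 : |∫ y, φ k y ∂gibbs V| ≤ M := by
      have := norm_integral_le_of_norm_le_const (μ := gibbs V)
        (Eventually.of_forall fun y => show ‖φ k y‖ ≤ M from hM k y)
      simpa using this
    calc _ ≤ |φ k x| + |∫ y, φ k y ∂gibbs V| := abs_sub _ _
      _ ≤ 2 * M := by linarith [hM k x]
  have hulim : ∀ᵐ x ∂gibbs V,
      Tendsto (fun k => φ k x - ∫ y, φ k y ∂gibbs V) atTop (𝓝 (v x)) := by
    filter_upwards [hae] with x hx
    simpa using hx.sub hm
  have hv1' : ∫⁻ x, ENNReal.ofReal (Φ (v x)) ∂gibbs V = 1 := by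
    rw [lintegral_young_eq h hvm hK, hv1, ENNReal.ofReal_one]
  exact ⟨φ, M, hφ, hM, hub, hm, hulim, tendsto_luxemburgNorm h
    (fun k => (hφm k).sub aestronglyMeasurable_const) hvm
    (fun k => Eventually.of_forall (hub k)) hulim hv1', hval, hG⟩

/-- Apply the inequality to bounded test functions approximating v. Norms, values and gradients all
converge, so both sides pass to the limit. -/
theorem ModifiedOrliczSobolev.formInequality (h : IsModerateYoung Φ B) {C : ℝ} (hC : 0 < C)
    (hS : ModifiedOrliczSobolev V Φ C) : FormInequality V Φ C := by
  intro v G hvG K hK hv0 hv1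
  obtain ⟨φ, M, hφ, hM, hub, -, hulim, hN, -, hG⟩ := hvG.exists_normalized_seq h hK hv0 hv1
  have hvm := hvG.1.1
  have hM0 : 0 ≤ M := (abs_nonneg _).trans (hM 0 0)
  set u : ℕ → EuclideanSpace ℝ (Fin n) → ℝ := fun k x => φ k x - ∫ y, φ k y ∂gibbs V with hu_def
  have hum : ∀ k, AEStronglyMeasurable (u k) (gibbs V) := fun k =>
    (hφ k).contDiff.continuous.aestronglyMeasurable.sub aestronglyMeasurable_const
  set N : ℕ → ℝ := fun k => (luxemburgNorm Φ (gibbs V) (u k)).toReal with hN_def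
  have hN' : Tendsto N atTop (𝓝 1) := by
    have := (ENNReal.tendsto_toReal ENNReal.one_ne_top).comp hN
    rwa [ENNReal.toReal_one] at this
  -- The maximum keeps the quotients bounded for every k; eventually it equals the norm, which tends
  -- to 1.
  set s : ℕ → ℝ := fun k => max (N k) (1 / 2) with hs_def
  have hs : Tendsto s atTop (𝓝 1) := by
    have := hN'.max (tendsto_const_nhds (x := (1 / 2 : ℝ)))
    rwa [max_eq_left (by norm_num : (1 / 2 : ℝ) ≤ 1)] at this
  have hs0 : ∀ k, 1 / 2 ≤ s k := fun k => le_max_right _ _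
  have hwb : ∀ k x, |u k x / s k| ≤ 4 * M := by
    intro k x
    have := hs0 k
    rw [abs_div, abs_of_pos (show 0 < s k by linarith), div_le_iff₀ (by linarith)]
    nlinarith [hub k x]
  have hwlim : ∀ᵐ x ∂gibbs V, Tendsto (fun k => u k x / s k) atTop (𝓝 (v x)) := by
    filter_upwards [hulim] with x hx
    have := hx.div hs one_ne_zero
    rwa [div_one] at this
  have hE := tendsto_integral_energy h.continuous_deriv_deriv h.deriv_deriv_nonneg
    (fun k => aestronglyMeasurable_div_const (hum k) (s k)) hvm
    (fun k => Eventually.of_forall (hwb k)) hwlim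
    (fun k => (hφ k).memLp_gradient 2) hvG.2 hG
  have hE' := (ENNReal.continuous_ofReal.tendsto _).comp (hE.const_mul C)
  have hN2 := ENNReal.Tendsto.pow (n := 2) hN
  rw [one_pow] at hN2
  rw [← ENNReal.one_le_ofReal]
  refine le_of_tendsto_of_tendsto hN2 hE' ?_
  filter_upwards [hN'.eventually (lt_mem_nhds (show (1 / 2 : ℝ) < 1 by norm_num))] with k hk
  have hsk : s k = N k := max_eq_left hk.le
  have h2 := hS (φ k) (hφ k).contDiff (memOrlicz_of_bounded h
    (hφ k).contDiff.continuous.measurable (Eventually.of_forall (hM k)))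
  refine h2.trans_eq ?_
  rw [Function.comp_apply, ENNReal.ofReal_mul hC.le, ofReal_integral_eq_lintegral_ofReal
    (integrable_energy h (aestronglyMeasurable_div_const (hum k) (s k))
      (Eventually.of_forall (hwb k))
      ((hφ k).memLp_gradient 2))
    (Eventually.of_forall fun x => mul_nonneg (sq_nonneg _) (h.deriv_deriv_nonneg _)), hsk]

end OrliczDecay

namespace OrliczDecay

/-! ### The Luxemburg balls in `L²` -/

section Ball

variable {X : Type*} [MeasurableSpace X] {μ : Measure X} {Φ : ℝ → ℝ} {B : ℝ}

/-- Lower semicontinuity: almost everywhere convergence along a subsequence, then Fatou. -/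
theorem luxemburgNorm_le_of_tendsto_eLpNorm (h : IsModerateYoung Φ B) {p : ℝ≥0∞} (hp : p ≠ 0)
    {f : X → ℝ} {g : ℕ → X → ℝ} (hg : ∀ k, AEStronglyMeasurable (g k) μ)
    (hf : AEStronglyMeasurable f μ)
    (hlim : Tendsto (fun k => eLpNorm (fun x => g k x - f x) p μ) atTop (𝓝 0)) {s : ℝ} (hs : 0 < s)
    (hc : ∀ᶠ k in atTop, luxemburgNorm Φ μ (g k) ≤ ENNReal.ofReal s) :
    luxemburgNorm Φ μ f ≤ ENNReal.ofReal s := by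
  obtain ⟨ns, hns, h1⟩ := exists_seq_tendsto_ae_of_eLpNorm hp hg hf hlim
  rw [luxemburgNorm_le_iff h hs]
  refine lintegral_young_le_of_tendsto_ae h (g := fun k x => g (ns k) x / s)
    (fun k => (hg (ns k)).aemeasurable.div_const s) (h1.mono fun x hx => hx.div_const s) ?_
  filter_upwards [hns.tendsto_atTop.eventually hc] with k hk
  exact (luxemburgNorm_le_iff h hs).1 hk

/-- The closed ball of radius `r` for the Luxemburg norm, as a subset of `L²`. -/
def luxemburgBall (Φ : ℝ → ℝ) (μ : Measure X) (r : ℝ) : Set (Lp ℝ 2 μ) :=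
  {g | luxemburgNorm Φ μ g ≤ ENNReal.ofReal r}

theorem isClosed_luxemburgBall (h : IsModerateYoung Φ B) {r : ℝ} (hr : 0 < r) :
    IsClosed (luxemburgBall Φ μ r) := by
  refine isClosed_of_closure_subset fun g hg => ?_
  obtain ⟨u, hu, hug⟩ := mem_closure_iff_seq_limit.1 hg
  refine luxemburgNorm_le_of_tendsto_eLpNorm h two_ne_zero (fun k => Lp.aestronglyMeasurable (u k))
    (Lp.aestronglyMeasurable g) ((Lp.tendsto_Lp_iff_tendsto_eLpNorm' _ _).1 hug) hr
    (Eventually.of_forall hu)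

theorem convex_luxemburgBall (h : IsModerateYoung Φ B) {r : ℝ} (hr : 0 < r) :
    Convex ℝ (luxemburgBall Φ μ r) := by
  intro f hf g hg a b ha hb hab
  replace hf := (luxemburgNorm_le_iff h hr).1 hf
  replace hg := (luxemburgNorm_le_iff h hr).1 hg
  refine (luxemburgNorm_le_iff h hr).2 ?_
  calc ∫⁻ x, ENNReal.ofReal (Φ ((a • f + b • g : Lp ℝ 2 μ) x / r)) ∂μ
      ≤ ∫⁻ x, ENNReal.ofReal a * ENNReal.ofReal (Φ (f x / r)) +
          ENNReal.ofReal b * ENNReal.ofReal (Φ (g x / r)) ∂μ := by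
        refine lintegral_mono_ae ?_
        filter_upwards [Lp.coeFn_add (a • f) (b • g), Lp.coeFn_smul a f, Lp.coeFn_smul b g]
          with x h1 h2 h3
        rw [h1, Pi.add_apply, h2, h3, ← ENNReal.ofReal_mul ha, ← ENNReal.ofReal_mul hb,
          ← ENNReal.ofReal_add (mul_nonneg ha (h.nonneg _)) (mul_nonneg hb (h.nonneg _))]
        refine ENNReal.ofReal_le_ofReal ?_
        have h4 := h.convex.2 (Set.mem_univ (f x / r)) (Set.mem_univ (g x / r)) ha hb hab
        simp only [smul_eq_mul, Pi.smul_apply] at h4 ⊢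
        rwa [add_div, mul_div_assoc, mul_div_assoc]
    _ = ENNReal.ofReal a * (∫⁻ x, ENNReal.ofReal (Φ (f x / r)) ∂μ) +
          ENNReal.ofReal b * ∫⁻ x, ENNReal.ofReal (Φ (g x / r)) ∂μ := by
        have hm : AEMeasurable (fun x => ENNReal.ofReal (Φ (g x / r))) μ :=
          (h.measurable.comp_aemeasurable
            ((Lp.aestronglyMeasurable g).aemeasurable.div_const r)).ennreal_ofReal
        rw [lintegral_add_right' _ (hm.const_mul _), lintegral_const_mul' _ _ ENNReal.ofReal_ne_top,
          lintegral_const_mul' _ _ ENNReal.ofReal_ne_top]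
    _ ≤ ENNReal.ofReal a * 1 + ENNReal.ofReal b * 1 := by gcongr
    _ = 1 := by rw [mul_one, mul_one, ← ENNReal.ofReal_add ha hb, hab, ENNReal.ofReal_one]

theorem zero_mem_luxemburgBall (h : IsModerateYoung Φ B) (r : ℝ) :
    (0 : Lp ℝ 2 μ) ∈ luxemburgBall Φ μ r :=
  (luxemburgNorm_zero h (Lp.coeFn_zero _ _ _)).trans_le zero_le

theorem smul_mem_luxemburgBall (h : IsModerateYoung Φ B) {c r : ℝ} (hc : 0 < c) (hr : 0 < r)
    {g : Lp ℝ 2 μ} : c • g ∈ luxemburgBall Φ μ r ↔ g ∈ luxemburgBall Φ μ (r / c) := by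
  refine (luxemburgNorm_le_iff h hr).trans (Iff.trans ?_
    (luxemburgNorm_le_iff h (by positivity)).symm)
  have e : ∫⁻ x, ENNReal.ofReal (Φ ((c • g : Lp ℝ 2 μ) x / r)) ∂μ =
      ∫⁻ x, ENNReal.ofReal (Φ (g x / (r / c))) ∂μ := by
    refine lintegral_congr_ae ?_
    filter_upwards [Lp.coeFn_smul c g] with x hx
    rw [hx, Pi.smul_apply, smul_eq_mul]
    congr 2
    field_simp
  rw [e]

end Ball

/-! ### Decay of the resolvent and of the semigroup -/

variable {n : ℕ} {V : EuclideanSpace ℝ (Fin n) → ℝ} {Φ : ℝ → ℝ} {B : ℝ}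
  [IsProbabilityMeasure (gibbs V)]

/-- Test with Φ'(u), admissible by the C¹ chain rule since u is bounded. -/
theorem integral_deriv_young_resolvent (h : IsModerateYoung Φ B) {l : ℝ} {f u : Lp ℝ 2 (gibbs V)}
    {G : EuclideanSpace ℝ (Fin n) → EuclideanSpace ℝ (Fin n)} (hG : IsFormPair V u G)
    (hw : ∀ v H, IsFormPair V v H →
      ∫ x, (f x - u x) * v x ∂gibbs V = l * ∫ x, ⟪G x, H x⟫ ∂gibbs V)
    {K : ℝ} (hK : ∀ᵐ x ∂gibbs V, |u x| ≤ K) :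
    ∫ x, (f x - u x) * deriv Φ (u x) ∂gibbs V =
      l * ∫ x, ‖G x‖ ^ 2 * deriv (deriv Φ) (u x) ∂gibbs V := by
  rw [hw _ _ (hG.comp_of_bounded hK h.contDiff_deriv)]
  congr 1
  refine integral_congr_ae (Eventually.of_forall fun x => ?_)
  simp only [inner_smul_right, real_inner_self_eq_norm_sq]
  ring

/-- One step of the implicit Euler scheme: tangent inequality at u = R_l f, then the energy of u is
at least 1/C. -/
theorem one_add_le_integral_young (h : IsModerateYoung Φ B) {C : ℝ} (hC : 0 < C)
    (hI : FormInequality V Φ C) {l : ℝ} (hl : 0 < l) {f : Lp ℝ 2 (gibbs V)} {K : ℝ}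
    (hK : ∀ᵐ x ∂gibbs V, |f x| ≤ K) (h0 : ∫ x, f x ∂gibbs V = 0)
    (h1 : ∫ x, Φ (formResolvent V l f x) ∂gibbs V = 1) :
    1 + l / C ≤ ∫ x, Φ (f x) ∂gibbs V := by
  obtain ⟨G, hG, hw⟩ := exists_formResolvent hl f
  set u := formResolvent V l f
  have hu := abs_formResolvent_le hl hK
  have h2 := hI u G hG K hu ((integral_formResolvent hl f).trans h0) h1
  have h3 := integral_deriv_young_resolvent h hG hw hu
  have hfm := Lp.aestronglyMeasurable f
  have hum := Lp.aestronglyMeasurable u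
  have hd : MemLp (fun x => deriv Φ (u x)) 2 (gibbs V) :=
    (hG.comp_of_bounded hu h.contDiff_deriv).1
  have i1 : Integrable (fun x => Φ (u x)) (gibbs V) := integrable_young h.continuous hum hu
  have i2 : Integrable (fun x => (f x - u x) * deriv Φ (u x)) (gibbs V) :=
    (memLp_sub_resolvent f l).integrable_mul hd
  have h4 : ∫ x, Φ (u x) + (f x - u x) * deriv Φ (u x) ∂gibbs V ≤ ∫ x, Φ (f x) ∂gibbs V := by
    refine integral_mono (i1.add i2) (integrable_young h.continuous hfm hK) fun x => ?_
    have := h.tangent_le (u x) (f x)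
    rwa [mul_comm (deriv Φ (u x))] at this
  rw [integral_add i1 i2, h1, h3] at h4
  refine le_trans ?_ h4
  rw [div_eq_mul_inv]
  have : C⁻¹ ≤ ∫ x, ‖G x‖ ^ 2 * deriv (deriv Φ) (u x) ∂gibbs V := by
    rwa [inv_le_iff_one_le_mul₀' hC]
  have := mul_le_mul_of_nonneg_left this hl.le
  linarith

/-- The contraction factor of `(1 - l L)⁻¹` in the Luxemburg norm. -/
def contractionFactor (B C l : ℝ) : ℝ := (1 + l / C) ^ (-B⁻¹)

theorem contractionFactor_pos {C l : ℝ} (B : ℝ) (hC : 0 < C) (hl : 0 < l) :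
    0 < contractionFactor B C l :=
  Real.rpow_pos_of_pos (by positivity) _

/-- With s the norm of u, normalising gives ∫ Φ(f/s) ≥ 1 + l/C, while ∫ Φ(f/s) ≤ (r/s)^B by the
growth bound; so s ≤ (1 + l/C)^(-1/B) r. -/
theorem formResolvent_mem_luxemburgBall (h : IsModerateYoung Φ B) {C : ℝ} (hC : 0 < C)
    (hI : FormInequality V Φ C) {l : ℝ} (hl : 0 < l) {f : Lp ℝ 2 (gibbs V)} {K : ℝ}
    (hK : ∀ᵐ x ∂gibbs V, |f x| ≤ K) (h0 : ∫ x, f x ∂gibbs V = 0) {r : ℝ} (hr : 0 < r)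
    (hf : f ∈ luxemburgBall Φ (gibbs V) r) :
    formResolvent V l f ∈ luxemburgBall Φ (gibbs V) (contractionFactor B C l * r) := by
  change luxemburgNorm Φ (gibbs V) f ≤ ENNReal.ofReal r at hf
  change luxemburgNorm Φ (gibbs V) (formResolvent V l f) ≤ _
  rw [luxemburgNorm_le_iff h hr] at hf
  set u := formResolvent V l f with hu_def
  have hu : ∀ᵐ x ∂gibbs V, |u x| ≤ K := abs_formResolvent_le hl hK
  have hum := Lp.aestronglyMeasurable u
  rcases eq_or_ne (luxemburgNorm Φ (gibbs V) u) 0 with hN0 | hN0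
  · rw [hN0]; exact zero_le
  have hNt : luxemburgNorm Φ (gibbs V) u < ⊤ := by
    refine luxemburgNorm_lt_top h ?_
    rw [lintegral_young_eq h hum hu]
    exact ENNReal.ofReal_lt_top
  have h1 := lintegral_young_eq_one h hNt hN0
  set s := (luxemburgNorm Φ (gibbs V) u).toReal with hs_def
  have hs : 0 < s := ENNReal.toReal_pos hN0 hNt.ne
  have hκ : 0 < 1 + l / C := by positivity
  have hd : ∀ y : ℝ, |y| ≤ K → |s⁻¹ * y| ≤ s⁻¹ * K := fun y hy => by
    rw [abs_mul, abs_of_pos (inv_pos.2 hs)]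
    gcongr
  have hgf : ∀ᵐ x ∂gibbs V, (s⁻¹ • f : Lp ℝ 2 (gibbs V)) x = f x / s := by
    filter_upwards [Lp.coeFn_smul s⁻¹ f] with x hx
    rw [hx, Pi.smul_apply, smul_eq_mul, inv_mul_eq_div]
  have hgu : ∀ᵐ x ∂gibbs V, (formResolvent V l (s⁻¹ • f)) x = u x / s := by
    rw [map_smul]
    filter_upwards [Lp.coeFn_smul s⁻¹ u] with x hx
    rw [hx, Pi.smul_apply, smul_eq_mul, inv_mul_eq_div]
  have hud : ∀ᵐ x ∂gibbs V, |u x / s| ≤ s⁻¹ * K := hu.mono fun x hx => by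
    rw [← inv_mul_eq_div]; exact hd _ hx
  have hfd : ∀ᵐ x ∂gibbs V, |f x / s| ≤ s⁻¹ * K := hK.mono fun x hx => by
    rw [← inv_mul_eq_div]; exact hd _ hx
  have h2 := one_add_le_integral_young h hC hI hl (f := s⁻¹ • f) (K := s⁻¹ * K)
    (by filter_upwards [hgf, hfd] with x e hx; rwa [e])
    (by rw [integral_congr_ae hgf, integral_div, h0, zero_div])
    (by
      rw [integral_congr_ae (hgu.mono fun x hx => by rw [hx] : _ =ᵐ[gibbs V] fun x => Φ (u x / s))]
      rw [lintegral_young_eq h (aestronglyMeasurable_div_const hum s) hud,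
        ENNReal.ofReal_eq_one] at h1
      exact h1)
  rw [integral_congr_ae (hgf.mono fun x hx => by rw [hx] : _ =ᵐ[gibbs V] fun x => Φ (f x / s)),
    ← ENNReal.ofReal_le_ofReal_iff (integral_nonneg fun x => h.nonneg _),
    ← lintegral_young_eq h (aestronglyMeasurable_div_const (Lp.aestronglyMeasurable f) s) hfd] at h2
  -- The growth bound only enlarges arguments, so s ≤ r is settled first: otherwise convexity would
  -- give ∫ Φ(f/s) ≤ r/s < 1.
  have hsr : s ≤ r := by
    by_contra! hlt
    have h3 := h2.trans ((lintegral_young_div_mono h hr hlt.le f).trans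
      (mul_le_mul_right hf _))
    rw [mul_one, ENNReal.ofReal_le_ofReal_iff (by positivity)] at h3
    have h4 := (div_lt_one hs).2 hlt
    have : 0 < l / C := by positivity
    linarith
  have h3 := h2.trans ((lintegral_young_div_le h hs hsr f).trans (mul_le_mul_right hf _))
  have hrs : 0 < r / s := by positivity
  rw [mul_one, ENNReal.ofReal_le_ofReal_iff (Real.rpow_nonneg hrs.le _)] at h3
  have hB : 0 < B := one_pos.trans_le h.one_le
  have h4 : (1 + l / C) ^ B⁻¹ ≤ r / s := by
    have := Real.rpow_le_rpow hκ.le h3 (inv_nonneg.2 hB.le)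
    rwa [← Real.rpow_mul hrs.le, mul_inv_cancel₀ hB.ne', Real.rpow_one] at this
  rw [← ENNReal.ofReal_toReal hNt.ne, ← hs_def]
  refine ENNReal.ofReal_le_ofReal ?_
  rw [contractionFactor, Real.rpow_neg hκ.le, inv_mul_eq_div,
    le_div_iff₀ (Real.rpow_pos_of_pos hκ _)]
  rwa [le_div_iff₀ hs, mul_comm] at h4

theorem pow_formResolvent_mem_luxemburgBall (h : IsModerateYoung Φ B) {C : ℝ} (hC : 0 < C)
    (hI : FormInequality V Φ C) {l : ℝ} (hl : 0 < l) {f : Lp ℝ 2 (gibbs V)} {K : ℝ}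
    (hK : ∀ᵐ x ∂gibbs V, |f x| ≤ K) (h0 : ∫ x, f x ∂gibbs V = 0) {r : ℝ} (hr : 0 < r)
    (hf : f ∈ luxemburgBall Φ (gibbs V) r) (k : ℕ) :
    (∀ᵐ x ∂gibbs V, |(formResolvent V l ^ k) f x| ≤ K) ∧
      ∫ x, (formResolvent V l ^ k) f x ∂gibbs V = 0 ∧
      (formResolvent V l ^ k) f ∈ luxemburgBall Φ (gibbs V) (contractionFactor B C l ^ k * r) := by
  have hρ := contractionFactor_pos B hC hl
  induction k with
  | zero => simpa using ⟨hK, h0, hf⟩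
  | succ k ih =>
    have e : (formResolvent V l ^ (k + 1)) f = formResolvent V l ((formResolvent V l ^ k) f) := by
      rw [pow_succ']; rfl
    rw [e, pow_succ', mul_assoc]
    exact ⟨abs_formResolvent_le hl ih.1, (integral_formResolvent hl _).trans ih.2.1,
      formResolvent_mem_luxemburgBall h hC hI hl ih.1 ih.2.1 (by positivity) ih.2.2⟩

/-- The factor equals 1 at l = 0 and has derivative -1/(BC) there. This is where B enters the decay
rate. -/
theorem tendsto_contractionFactor (B C t : ℝ) :
    Tendsto (fun l => Real.exp (t / l * (1 - contractionFactor B C l))) (𝓝[>] 0)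
      (𝓝 (Real.exp (t / (B * C)))) := by
  have h1 : HasDerivAt (fun l => contractionFactor B C l) (1 / C * -B⁻¹) 0 := by
    have h2 : HasDerivAt (fun l : ℝ => 1 + l / C) (1 / C) 0 :=
      ((hasDerivAt_id (0 : ℝ)).div_const C).const_add 1
    have h3 := h2.rpow_const (p := -B⁻¹) (Or.inl (by simp))
    simpa [contractionFactor] using h3
  have h2 := (hasDerivAt_iff_tendsto_slope.1 h1).mono_left
    (nhdsWithin_mono 0 (fun x (hx : 0 < x) => hx.ne'))
  have h3 := (Real.continuous_exp.tendsto _).comp (h2.const_mul (-t))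
  have e : -t * (1 / C * -B⁻¹) = t / (B * C) := by
    rw [div_eq_mul_inv t, mul_inv]; ring
  rw [e] at h3
  refine h3.congr fun l => ?_
  have h4 : contractionFactor B C 0 = 1 := by simp [contractionFactor]
  simp only [Function.comp_apply, slope_def_field, h4, sub_zero]
  congr 1
  ring

/-- With c = t/l, multiplying the Poisson series by exp(c(1 - ρ)) turns it into the Poisson series
of parameter cρ in the vectors ρ^(-k) R_l^k f, all of which lie in the ball of radius r; then l → 0.
-/
theorem semigroupL2_mem_luxemburgBall (h : IsModerateYoung Φ B) {C : ℝ} (hC : 0 < C)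
    (hI : FormInequality V Φ C) {f : Lp ℝ 2 (gibbs V)} {K : ℝ}
    (hK : ∀ᵐ x ∂gibbs V, |f x| ≤ K) (h0 : ∫ x, f x ∂gibbs V = 0) {r : ℝ} (hr : 0 < r)
    (hf : f ∈ luxemburgBall Φ (gibbs V) r) {t : ℝ} (ht : 0 ≤ t) :
    semigroupL2 V t f ∈ luxemburgBall Φ (gibbs V) (r / Real.exp (t / (B * C))) := by
  rw [← smul_mem_luxemburgBall h (Real.exp_pos _) hr]
  refine (isClosed_luxemburgBall h hr).mem_of_tendsto
    ((tendsto_contractionFactor B C t).smul (tendsto_semigroupL2 ht f)) ?_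
  filter_upwards [self_mem_nhdsWithin] with l hl
  have hl : 0 < l := hl
  set ρ := contractionFactor B C l with hρ_def
  have hρ : 0 < ρ := contractionFactor_pos B hC hl
  set c := t / l
  have hc : 0 ≤ c := by positivity
  have h1 := (hasSum_exp_sub_one_apply (formResolvent V l) c f).const_smul
    (Real.exp (c * (1 - ρ)))
  refine hasSum_mem_of_convex (convex_luxemburgBall h hr) (isClosed_luxemburgBall h hr)
    (zero_mem_luxemburgBall h r)
    (w := fun k : ℕ => Real.exp (-(c * ρ)) * ((c * ρ) ^ k / k.factorial))
    (x := fun k => (ρ ^ k)⁻¹ • (formResolvent V l ^ k) f)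
    (fun k => by positivity) (hasSum_exp_weights (c * ρ)) le_rfl (fun k => ?_) ?_
  · rw [smul_mem_luxemburgBall h (by positivity) hr, div_inv_eq_mul, mul_comm]
    exact (pow_formResolvent_mem_luxemburgBall h hC hI hl hK h0 hr hf k).2.2
  · convert h1 using 2 with k
    rw [smul_smul, smul_smul]
    congr 1
    rw [show -(c * ρ) = c * (1 - ρ) + -c by ring, Real.exp_add, mul_pow]
    field_simp

end OrliczDecay

namespace OrliczDecay

/-! ### Truncation of Orlicz functions -/

/-- Truncation of a real number to `[-K, K]`. -/
def clip (K y : ℝ) : ℝ := max (-K) (min K y)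

theorem abs_clip_le {K : ℝ} (hK : 0 ≤ K) (y : ℝ) : |clip K y| ≤ K := by
  rw [clip, abs_le]
  exact ⟨le_max_left _ _, max_le (by linarith) (min_le_left _ _)⟩

theorem clip_of_abs_le {K y : ℝ} (h : |y| ≤ K) : clip K y = y := by
  rw [abs_le] at h
  rw [clip, min_eq_right h.2, max_eq_right h.1]

theorem abs_clip_le_abs {K : ℝ} (hK : 0 ≤ K) (y : ℝ) : |clip K y| ≤ |y| := by
  rcases le_total |y| K with h | h
  · rw [clip_of_abs_le h]
  · exact (abs_clip_le hK y).trans h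

theorem continuous_clip (K : ℝ) : Continuous (clip K) :=
  continuous_const.max (continuous_const.min continuous_id)

theorem tendsto_clip (y : ℝ) : Tendsto (fun k : ℕ => clip k y) atTop (𝓝 y) := by
  refine tendsto_const_nhds.congr' ?_
  filter_upwards [tendsto_natCast_atTop_atTop.eventually_ge_atTop |y|] with k hk
  exact (clip_of_abs_le hk).symm

section Clip

variable {X : Type*} [MeasurableSpace X] {μ : Measure X} [IsProbabilityMeasure μ]
  {Φ : ℝ → ℝ} {B : ℝ} {f : X → ℝ}

theorem tendsto_integral_clip (hf : Integrable f μ) :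
    Tendsto (fun k : ℕ => ∫ x, clip k (f x) ∂μ) atTop (𝓝 (∫ x, f x ∂μ)) :=
  tendsto_integral_of_dominated_convergence (fun x => |f x|)
    (fun k => (continuous_clip k).comp_aestronglyMeasurable hf.1) hf.abs
    (fun k => Eventually.of_forall fun x => abs_clip_le_abs k.cast_nonneg (f x))
    (Eventually.of_forall fun x => tendsto_clip (f x))

theorem tendsto_eLpNorm_clip_sub (hf : Integrable f μ) :
    Tendsto (fun k : ℕ => eLpNorm (fun x => clip k (f x) - (∫ y, clip k (f y) ∂μ) +
      (∫ y, f y ∂μ) - f x) 1 μ) atTop (𝓝 0) := by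
  have h1 : Tendsto (fun k : ℕ => eLpNorm (fun x => clip k (f x) - f x) 1 μ) atTop (𝓝 0) := by
    refine tendsto_eLpNorm_zero_of_dominated one_ne_zero ENNReal.one_ne_top (g := fun x => 2 * f x)
      (fun k => ((continuous_clip k).comp_aestronglyMeasurable hf.1).sub hf.1)
      (memLp_one_iff_integrable.2 (hf.const_mul 2)) (fun k => Eventually.of_forall fun x => ?_)
      (Eventually.of_forall fun x => ?_)
    · refine (abs_sub _ _).trans ?_
      rw [norm_mul, Real.norm_eq_abs, Real.norm_eq_abs, abs_two]
      linarith [abs_clip_le_abs k.cast_nonneg (f x)]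
    · simpa using (tendsto_clip (f x)).sub_const (f x)
  have h2 : Tendsto (fun k : ℕ => eLpNorm (fun _ : X => (∫ y, f y ∂μ) - ∫ y, clip k (f y) ∂μ) 1 μ)
      atTop (𝓝 0) := by
    refine tendsto_eLpNorm_zero_of_bound
      (c := fun k : ℕ => |(∫ y, f y ∂μ) - ∫ y, clip k (f y) ∂μ|) ?_
      (fun k => Eventually.of_forall fun x => le_rfl)
    simpa using ((tendsto_integral_clip hf).const_sub (∫ y, f y ∂μ)).abs
  have h3 := h1.add h2
  rw [add_zero] at h3
  refine tendsto_of_tendsto_of_tendsto_of_le_of_le tendsto_const_nhds h3 (fun _ => zero_le)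
    fun k => ?_
  have e : (fun x => clip k (f x) - (∫ y, clip k (f y) ∂μ) + (∫ y, f y ∂μ) - f x) =
      (fun x => clip k (f x) - f x) + fun _ => (∫ y, f y ∂μ) - ∫ y, clip k (f y) ∂μ := by
    funext x
    rw [Pi.add_apply]
    ring
  rw [e]
  exact eLpNorm_add_le (((continuous_clip k).comp_aestronglyMeasurable hf.1).sub hf.1)
    aestronglyMeasurable_const le_rfl

/-- Dominated convergence of the modular at scale r. The strict bound on the norm of f makes the
limit modular strictly less than 1, which leaves room for finite k. -/
theorem eventually_luxemburgNorm_clip_le (h : IsModerateYoung Φ B) (hf : MemOrlicz Φ μ f) {r : ℝ}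
    (hr : luxemburgNorm Φ μ (fun x => f x - ∫ y, f y ∂μ) < ENNReal.ofReal r) :
    ∀ᶠ k : ℕ in atTop, luxemburgNorm Φ μ (fun x => clip k (f x) - ∫ y, clip k (f y) ∂μ) ≤
      ENNReal.ofReal r := by
  have hi := hf.integrable h
  have hr0 : 0 < r := ENNReal.ofReal_pos.1 (bot_le.trans_lt hr)
  set D := ∫ y, |f y| ∂μ
  have hfa : MemOrlicz Φ μ fun x => |f x| := by
    obtain ⟨hm, α, hα, hfin⟩ := hf
    refine ⟨hm.norm, α, hα, lt_of_eq_of_lt (lintegral_congr fun x => ?_) hfin⟩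
    rw [← abs_of_pos hα, ← abs_mul, h.apply_abs, abs_of_pos hα]
  have hlim : Tendsto (fun k : ℕ => ∫⁻ x, ENNReal.ofReal
        (Φ ((clip k (f x) - ∫ y, clip k (f y) ∂μ) / r)) ∂μ) atTop
      (𝓝 (∫⁻ x, ENNReal.ofReal (Φ ((f x - ∫ y, f y ∂μ) / r)) ∂μ)) := by
    refine tendsto_lintegral_of_dominated_convergence
      -- The clipped means are bounded by D; the dominating argument |f| + D is written as a
      -- difference to match `MemOrlicz.lintegral_sub_const_lt_top`.
      (fun x => ENNReal.ofReal (Φ (r⁻¹ * (|f x| - -D)))) (fun k => ?_) (fun k => ?_)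
      (hfa.lintegral_sub_const_lt_top h _ _).ne (Eventually.of_forall fun x => ?_)
    · exact (h.measurable.comp ((((continuous_clip k).measurable.comp hf.1).sub_const _).div_const
        _)).ennreal_ofReal
    · refine Eventually.of_forall fun x => ENNReal.ofReal_le_ofReal (h.mono_abs ?_)
      rw [← inv_mul_eq_div, abs_mul, abs_mul]
      refine mul_le_mul_of_nonneg_left ?_ (abs_nonneg _)
      have h1 : |∫ y, clip k (f y) ∂μ| ≤ D := by
        refine (abs_integral_le_integral_abs).trans (integral_mono_of_nonneg
          (Eventually.of_forall fun x => abs_nonneg _) hi.abs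
          (Eventually.of_forall fun x => abs_clip_le_abs k.cast_nonneg (f x)))
      have hD : 0 ≤ D := (abs_nonneg _).trans h1
      rw [sub_neg_eq_add, abs_of_nonneg (add_nonneg (abs_nonneg _) hD)]
      exact (abs_sub _ _).trans (add_le_add (abs_clip_le_abs k.cast_nonneg (f x)) h1)
    · exact ((ENNReal.continuous_ofReal.comp h.continuous).tendsto _).comp
        (((tendsto_clip (f x)).sub (tendsto_integral_clip hi)).div_const r)
  have hlt : ∫⁻ x, ENNReal.ofReal (Φ ((f x - ∫ y, f y ∂μ) / r)) ∂μ < 1 := by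
    obtain ⟨s, -, hs1, hs2⟩ := ENNReal.lt_iff_exists_real_btwn.1 hr
    have hs : 0 < s := ENNReal.ofReal_pos.1 (bot_le.trans_lt hs1)
    have hsr := (ENNReal.ofReal_lt_ofReal_iff hr0).1 hs2
    refine (lintegral_young_div_mono h hs hsr.le _).trans_lt ?_
    refine (mul_le_of_le_one_right' ((luxemburgNorm_le_iff h hs).1 hs1.le)).trans_lt ?_
    exact ENNReal.ofReal_lt_one.2 ((div_lt_one hr0).2 hsr)
  filter_upwards [hlim.eventually (gt_mem_nhds hlt)] with k hk
  exact luxemburgNorm_le hr0 hk.le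

end Clip

variable {n : ℕ} {V : EuclideanSpace ℝ (Fin n) → ℝ} {Φ : ℝ → ℝ} {B : ℝ}
  [IsProbabilityMeasure (gibbs V)]

/-- Apply the bounded case to centred clippings of f. Their images under P_t converge in L¹, and the
Luxemburg norm is lower semicontinuous for that convergence. -/
theorem FormInequality.exponentialDecay (h : IsModerateYoung Φ B) {C : ℝ} (hC : 0 < C)
    (hI : FormInequality V Φ C) : ExponentialDecay V Φ (2 / (B * C)) := by
  intro f _ hfO t ht
  have hi := hfO.integrable h
  set m := ∫ y, f y ∂gibbs V with hm_def
  set N := luxemburgNorm Φ (gibbs V) fun x => f x - m with hN_def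
  have hNt : N < ⊤ := hfO.luxemburgNorm_sub_const_lt_top h m
  set mk : ℕ → ℝ := fun k => ∫ y, clip k (f y) ∂gibbs V with hmk_def
  set g : ℕ → EuclideanSpace ℝ (Fin n) → ℝ := fun k x => clip k (f x) - mk k with hg_def
  have hcm : ∀ k : ℕ, AEStronglyMeasurable (fun x => clip k (f x)) (gibbs V) := fun k =>
    (continuous_clip k).comp_aestronglyMeasurable hi.1
  have hgm : ∀ k, AEStronglyMeasurable (g k) (gibbs V) := fun k =>
    (hcm k).sub aestronglyMeasurable_const
  have hgb : ∀ k x, |g k x| ≤ k + |mk k| := fun k x =>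
    (abs_sub _ _).trans (add_le_add (abs_clip_le k.cast_nonneg _) le_rfl)
  have hgL : ∀ k, MemLp (g k) 2 (gibbs V) := fun k =>
    MemLp.of_bound (hgm k) _ (Eventually.of_forall (hgb k))
  have hg0 : ∀ k, ∫ x, g k x ∂gibbs V = 0 := by
    intro k
    have : Integrable (fun x => clip k (f x)) (gibbs V) :=
      Integrable.of_bound (hcm k) k (Eventually.of_forall fun x => abs_clip_le k.cast_nonneg _)
    rw [integral_sub this (integrable_const _)]
    simp [hmk_def]
  -- Adding back the mean m of f makes these elements converge to f in L¹; the semigroup fixes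
  -- constants, so m is subtracted again afterwards.
  set a : ℕ → Lp ℝ 2 (gibbs V) := fun k => (hgL k).toLp + Lp.const 2 (gibbs V) m with ha_def
  have hconst : (Lp.const 2 (gibbs V) m : EuclideanSpace ℝ (Fin n) → ℝ) =ᵐ[gibbs V] fun _ => m :=
    Lp.coeFn_const _ _ _
  have ha : Tendsto (fun k => eLpNorm (fun x => a k x - f x) 1 (gibbs V)) atTop (𝓝 0) := by
    refine (tendsto_eLpNorm_clip_sub hi).congr fun k => eLpNorm_congr_ae ?_
    filter_upwards [Lp.coeFn_add (hgL k).toLp (Lp.const 2 (gibbs V) m), (hgL k).coeFn_toLp, hconst]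
      with x h1 h2 h3
    rw [h1, Pi.add_apply, h2, h3]
  have hP := tendsto_semigroup_seq ht (memLp_one_iff_integrable.2 hi) ha
  have hPg : ∀ k, semigroupL2 V t (hgL k).toLp =ᵐ[gibbs V]
      fun x => semigroupL2 V t (a k) x - m := by
    intro k
    have e : (hgL k).toLp = a k - Lp.const 2 (gibbs V) m := by simp [ha_def]
    rw [e, semigroupL2_sub ht, semigroupL2_const ht]
    filter_upwards [Lp.coeFn_sub (semigroupL2 V t (a k)) (Lp.const 2 (gibbs V) m), hconst]
      with x h1 h2
    rw [h1, Pi.sub_apply, h2]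
  have hP' : Tendsto (fun k => eLpNorm (fun x => semigroupL2 V t (hgL k).toLp x -
      (semigroup V t f x - m)) 1 (gibbs V)) atTop (𝓝 0) := by
    refine hP.congr fun k => eLpNorm_congr_ae ?_
    filter_upwards [hPg k] with x hx
    rw [hx]
    ring
  set ρ := Real.exp (t / (B * C)) with hρ_def
  have key : ∀ r : ℝ, N < ENNReal.ofReal r →
      luxemburgNorm Φ (gibbs V) (fun x => semigroup V t f x - m) ≤ ENNReal.ofReal (r / ρ) := by
    intro r hr
    have hr0 : 0 < r := ENNReal.ofReal_pos.1 (bot_le.trans_lt hr)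
    refine luxemburgNorm_le_of_tendsto_eLpNorm h one_ne_zero
      (fun k => Lp.aestronglyMeasurable _)
      ((Lp.aestronglyMeasurable _).sub aestronglyMeasurable_const) hP'
      (div_pos hr0 (Real.exp_pos _)) ?_
    filter_upwards [eventually_luxemburgNorm_clip_le h hfO hr] with k hk
    have hgk := (hgL k).coeFn_toLp
    refine semigroupL2_mem_luxemburgBall h hC hI (K := k + |mk k|) ?_ ?_ hr0 ?_ ht
    · filter_upwards [hgk] with x hx
      rw [hx]
      exact hgb k x
    · rw [integral_congr_ae hgk, hg0]
    · exact (luxemburgNorm_congr_ae hgk).trans_le hk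
  have h1 : luxemburgNorm Φ (gibbs V) (fun x => semigroup V t f x - m) ≤
      ENNReal.ofReal ρ⁻¹ * N := by
    have h2 : Tendsto (fun r : ℝ => ENNReal.ofReal (r / ρ)) (𝓝[>] N.toReal)
        (𝓝 (ENNReal.ofReal (N.toReal / ρ))) :=
      ((ENNReal.continuous_ofReal.comp (continuous_id.div_const ρ)).tendsto _).mono_left
        nhdsWithin_le_nhds
    have e : ENNReal.ofReal (N.toReal / ρ) = ENNReal.ofReal ρ⁻¹ * N := by
      rw [← inv_mul_eq_div, ENNReal.ofReal_mul (inv_pos.2 (Real.exp_pos _)).le,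
        ENNReal.ofReal_toReal hNt.ne]
    rw [← e]
    refine ge_of_tendsto h2 ?_
    filter_upwards [self_mem_nhdsWithin] with r hr
    refine key r ?_
    rw [← ENNReal.ofReal_toReal hNt.ne]
    exact (ENNReal.ofReal_lt_ofReal_iff (ENNReal.toReal_nonneg.trans_lt hr)).2 hr
  refine (pow_le_pow_left₀ zero_le h1 2).trans_eq ?_
  rw [mul_pow, ← ENNReal.ofReal_pow (inv_pos.2 (Real.exp_pos _)).le]
  congr 2
  rw [← Real.exp_neg, ← Real.exp_nat_mul]
  congr 1
  push_cast
  ring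

end OrliczDecay

namespace OrliczDecay

/-! ### From decay of the semigroup to the inequality -/

variable {n : ℕ} {V : EuclideanSpace ℝ (Fin n) → ℝ} {Φ : ℝ → ℝ} {B : ℝ}
  [IsProbabilityMeasure (gibbs V)]

/-- Decay is assumed for smooth functions only. It is transferred to w through test functions whose
centred norms tend to 1, by L² continuity of the semigroup and closedness of Luxemburg balls. -/
theorem ExponentialDecay.semigroupL2_mem_luxemburgBall (h : IsModerateYoung Φ B) {M : ℝ}
    (hD : ExponentialDecay V Φ M) {w : Lp ℝ 2 (gibbs V)}
    {G : EuclideanSpace ℝ (Fin n) → EuclideanSpace ℝ (Fin n)} (hw : IsFormPair V w G) {K : ℝ}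
    (hK : ∀ᵐ x ∂gibbs V, |w x| ≤ K) (h0 : ∫ x, w x ∂gibbs V = 0)
    (h1 : ∫ x, Φ (w x) ∂gibbs V = 1) {t : ℝ} (ht : 0 ≤ t) :
    semigroupL2 V t w ∈ luxemburgBall Φ (gibbs V) (Real.exp (-(M * t / 2))) := by
  obtain ⟨φ, K', hφ, hK', -, hm, -, hN, hval, -⟩ := hw.exists_normalized_seq h hK h0 h1
  set m : ℕ → ℝ := fun k => ∫ y, φ k y ∂gibbs V with hm_def
  set f : ℕ → Lp ℝ 2 (gibbs V) := fun k => ((hφ k).memLp 2).toLp (φ k) with hf_def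
  have hff : ∀ k, f k =ᵐ[gibbs V] φ k := fun k => MemLp.coeFn_toLp _
  have hf : Tendsto f atTop (𝓝 w) := by
    rw [Lp.tendsto_Lp_iff_tendsto_eLpNorm']
    refine hval.congr fun k => eLpNorm_congr_ae ?_
    filter_upwards [hff k] with x hx
    rw [Pi.sub_apply, hx]
  have hPf : Tendsto (fun k => semigroupL2 V t (f k) - Lp.const 2 (gibbs V) (m k)) atTop
      (𝓝 (semigroupL2 V t w)) := by
    have e1 : Tendsto (fun k => semigroupL2 V t (f k)) atTop (𝓝 (semigroupL2 V t w)) := by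
      rw [tendsto_iff_norm_sub_tendsto_zero] at hf ⊢
      refine squeeze_zero (fun _ => norm_nonneg _) (fun k => ?_) hf
      rw [← semigroupL2_sub ht]
      exact norm_semigroupL2_le ht _
    have e2 : Tendsto (fun k => Lp.const 2 (gibbs V) (m k)) atTop (𝓝 0) := by
      have := ((Lp.constL 2 (gibbs V) ℝ (E := ℝ)).continuous.tendsto 0).comp hm
      rw [map_zero] at this
      exact this
    simpa using e1.sub e2
  have hρ : ∀ r : ℝ, 1 < r →
      semigroupL2 V t w ∈ luxemburgBall Φ (gibbs V) (Real.exp (-(M * t / 2)) * r) := by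
    intro r hr
    refine (isClosed_luxemburgBall h (by positivity)).mem_of_tendsto hPf ?_
    filter_upwards [hN.eventually (gt_mem_nhds (ENNReal.one_lt_ofReal.2 hr))] with k hk
    have h2 := hD (φ k) (hφ k).contDiff (memOrlicz_of_bounded h
      (hφ k).contDiff.continuous.measurable (Eventually.of_forall (hK' k))) t ht
    have e : (semigroupL2 V t (f k) - Lp.const 2 (gibbs V) (m k) : Lp ℝ 2 (gibbs V)) =ᵐ[gibbs V]
        fun x => semigroup V t (φ k) x - ∫ y, φ k y ∂gibbs V := by
      filter_upwards [Lp.coeFn_sub (semigroupL2 V t (f k)) (Lp.const 2 (gibbs V) (m k)),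
        (Lp.coeFn_const 2 (gibbs V) (m k) :), semigroup_ae_eq ht (f k) (hff k)] with x a1 a2 a3
      rw [a1, Pi.sub_apply, a2, a3]
      rfl
    change luxemburgNorm Φ (gibbs V) _ ≤ _
    rw [luxemburgNorm_congr_ae e, ← ENNReal.pow_le_pow_left_iff two_ne_zero]
    refine h2.trans ((mul_le_mul_right (pow_le_pow_left₀ zero_le hk.le 2) _).trans_eq ?_)
    rw [← ENNReal.ofReal_pow (by positivity), ← ENNReal.ofReal_pow (by positivity),
      ← ENNReal.ofReal_mul (by positivity), mul_pow, ← Real.exp_nat_mul]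
    congr 3
    push_cast
    ring
  change luxemburgNorm Φ (gibbs V) _ ≤ _
  have hlim : Tendsto (fun r : ℝ => ENNReal.ofReal (Real.exp (-(M * t / 2)) * r)) (𝓝[>] 1)
      (𝓝 (ENNReal.ofReal (Real.exp (-(M * t / 2)) * 1))) :=
    ((ENNReal.continuous_ofReal.comp (continuous_const.mul continuous_id)).tendsto _).mono_left
      nhdsWithin_le_nhds
  rw [mul_one] at hlim
  refine ge_of_tendsto hlim ?_
  filter_upwards [self_mem_nhdsWithin] with r hr
  exact hρ r hr

/-- The tangent inequality at w bounds ∫ Φ(P_t w) below by 1 - ⟨d, w - P_t w⟩; decay bounds it above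
by the exponential. -/
theorem one_sub_exp_le (h : IsModerateYoung Φ B) {M : ℝ} (hM : 0 < M)
    (hD : ExponentialDecay V Φ M) {w d : Lp ℝ 2 (gibbs V)}
    {G : EuclideanSpace ℝ (Fin n) → EuclideanSpace ℝ (Fin n)} (hw : IsFormPair V w G) {K : ℝ}
    (hK : ∀ᵐ x ∂gibbs V, |w x| ≤ K) (h0 : ∫ x, w x ∂gibbs V = 0)
    (h1 : ∫ x, Φ (w x) ∂gibbs V = 1) (hd : d =ᵐ[gibbs V] fun x => deriv Φ (w x)) {t : ℝ}
    (ht : 0 ≤ t) : 1 - Real.exp (-(M * t / 2)) ≤ ⟪d, w - semigroupL2 V t w⟫ := by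
  set p := semigroupL2 V t w
  set ρ := Real.exp (-(M * t / 2)) with hρ_def
  have hρ : 0 < ρ := Real.exp_pos _
  have hρ1 : ρ ≤ 1 := Real.exp_le_one_iff.2 (by have : 0 ≤ M * t / 2 := by positivity
                                                linarith)
  have h2 := (luxemburgNorm_le_iff h hρ).1 (hD.semigroupL2_mem_luxemburgBall h hw hK h0 h1 ht)
  -- Here only convexity is used: Φ(ρy) ≤ ρΦ(y) for ρ ≤ 1. Hence no factor B appears in this
  -- direction.
  have h3 : ∫⁻ x, ENNReal.ofReal (Φ (p x)) ∂gibbs V ≤ ENNReal.ofReal ρ := by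
    have := (lintegral_young_div_mono h hρ hρ1 p).trans (mul_le_of_le_one_right' h2)
    simpa using this
  have hwm := Lp.aestronglyMeasurable w
  have hpm := Lp.aestronglyMeasurable p
  have hΦp : Integrable (fun x => Φ (p x)) (gibbs V) := by
    refine ⟨h.continuous.comp_aestronglyMeasurable hpm, ?_⟩
    rw [hasFiniteIntegral_iff_ofReal (Eventually.of_forall fun x => h.nonneg _)]
    exact h3.trans_lt ENNReal.ofReal_lt_top
  have h4 : ∫ x, Φ (p x) ∂gibbs V ≤ ρ := by
    rw [← ofReal_integral_eq_lintegral_ofReal hΦp (Eventually.of_forall fun x => h.nonneg _),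
      ENNReal.ofReal_le_ofReal_iff hρ.le] at h3
    exact h3
  have i1 : Integrable (fun x => Φ (w x)) (gibbs V) := integrable_young h.continuous hwm hK
  have i2 : Integrable (fun x => ⟪d x, (w - p : Lp ℝ 2 (gibbs V)) x⟫) (gibbs V) :=
    integrable_inner (Lp.memLp d) (Lp.memLp _)
  have h5 : ∫ x, Φ (w x) - ⟪d x, (w - p : Lp ℝ 2 (gibbs V)) x⟫ ∂gibbs V ≤
      ∫ x, Φ (p x) ∂gibbs V := by
    refine integral_mono_ae (i1.sub i2) hΦp ?_
    filter_upwards [hd, Lp.coeFn_sub w p] with x a1 a2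
    have := h.tangent_le (w x) (p x)
    rw [a1, a2, Pi.sub_apply]
    simp only [RCLike.inner_apply, conj_trivial]
    linarith
  rw [integral_sub i1 i2, h1] at h5
  rw [L2.inner_def]
  linarith

/-- Differentiate at t = 0: the second-order expansion on the range of R_l² gives ⟨d, w - P_t w⟩ ≤
tE + O(t²), because ⟨d, Lw⟩ = -E by the weak equation tested with Φ'(w). Divide by t and let t → 0.
-/
theorem decay_le_energy_of_normalized (hV : Continuous V) (h : IsModerateYoung Φ B) {M : ℝ}
    (hM : 0 < M) (hD : ExponentialDecay V Φ M) {v : Lp ℝ 2 (gibbs V)} {l : ℝ} (hl : 0 < l)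
    {G : EuclideanSpace ℝ (Fin n) → EuclideanSpace ℝ (Fin n)}
    (hw : IsFormPair V (formResolvent V l (formResolvent V l v)) G) {K : ℝ}
    (hK : ∀ᵐ x ∂gibbs V, |v x| ≤ K) (h0 : ∫ x, v x ∂gibbs V = 0)
    (h1 : ∫ x, Φ (formResolvent V l (formResolvent V l v) x) ∂gibbs V = 1) :
    M / 2 ≤ ∫ x, ‖G x‖ ^ 2 *
      deriv (deriv Φ) (formResolvent V l (formResolvent V l v) x) ∂gibbs V := by
  set f := formResolvent V l v with hf_def
  set w := formResolvent V l f with hw_def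
  have hf : ∀ᵐ x ∂gibbs V, |f x| ≤ K := abs_formResolvent_le hl hK
  have hwK : ∀ᵐ x ∂gibbs V, |w x| ≤ K := abs_formResolvent_le hl hf
  have hw0 : ∫ x, w x ∂gibbs V = 0 := by
    rw [integral_formResolvent hl, integral_formResolvent hl, h0]
  obtain ⟨G₀, hG₀, hG₀w⟩ := exists_formResolvent hl f
  have hE := integral_deriv_young_resolvent h hG₀ hG₀w hwK
  have hEG : ∫ x, ‖G₀ x‖ ^ 2 * deriv (deriv Φ) (w x) ∂gibbs V =
      ∫ x, ‖G x‖ ^ 2 * deriv (deriv Φ) (w x) ∂gibbs V :=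
    integral_congr_ae ((hG₀.grad_unique hV hw).mono fun x hx => by simp only [hx])
  rw [hEG] at hE
  set E := ∫ x, ‖G x‖ ^ 2 * deriv (deriv Φ) (w x) ∂gibbs V
  have hdL : MemLp (fun x => deriv Φ (w x)) 2 (gibbs V) :=
    (hG₀.comp_of_bounded hwK h.contDiff_deriv).1
  set d : Lp ℝ 2 (gibbs V) := hdL.toLp with hd_def
  have hd : d =ᵐ[gibbs V] fun x => deriv Φ (w x) := hdL.coeFn_toLp
  have hyos : ⟪d, yosida (formResolvent V) l f⟫ = -E := by
    have e : yosida (formResolvent V) l f = (-(1 / l)) • (f - w) := by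
      rw [yosida, hw_def]
      simp only [smul_apply, sub_apply, one_apply_eq_self]
      rw [neg_smul, ← smul_neg, neg_sub]
    have e2 : ⟪d, f - w⟫ = l * E := by
      rw [← hE, integral_inner_eq hd (Lp.coeFn_sub f w)]
      refine integral_congr_ae (Eventually.of_forall fun x => ?_)
      simp only [RCLike.inner_apply, conj_trivial]
      rfl
    rw [e, real_inner_smul_right, e2]
    field_simp
  set c := ‖yosida (formResolvent V) l (yosida (formResolvent V) l v)‖
  have key : ∀ t : ℝ, 0 < t → M / 2 / (1 + M * t / 2) ≤ E + ‖d‖ * c * t := by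
    intro t ht
    have h2 := one_sub_exp_le h hM hD hw hwK hw0 h1 hd ht.le
    have h3 := (isContractionResolvent V).norm_limit_sub_le hl ht.le v
      (tendsto_semigroupL2 ht.le w)
    set p := semigroupL2 V t w
    have h4 : ⟪d, w - p⟫ ≤ t * E + ‖d‖ * (c * t ^ 2) := by
      have e : w - p = -(t • yosida (formResolvent V) l f) -
          (p - w - t • yosida (formResolvent V) l f) := by abel
      rw [e, inner_sub_right, inner_neg_right, real_inner_smul_right, hyos]
      have := (abs_real_inner_le_norm d (p - w - t • yosida (formResolvent V) l f)).trans
        (mul_le_mul_of_nonneg_left h3 (norm_nonneg d))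
      have := neg_le_of_abs_le this
      linarith
    have hx : 0 < 1 + M * t / 2 := by positivity
    -- Bounding e^(-x) by 1/(1 + x) makes the difference quotient an explicit rational function with
    -- limit M/2.
    have h5 : Real.exp (-(M * t / 2)) ≤ 1 / (1 + M * t / 2) := by
      rw [Real.exp_neg, ← one_div]
      refine one_div_le_one_div_of_le hx ?_
      linarith [Real.add_one_le_exp (M * t / 2)]
    have h6 : t * (M / 2 / (1 + M * t / 2)) = 1 - 1 / (1 + M * t / 2) := by
      field_simp
      ring
    refine le_of_mul_le_mul_left ?_ ht
    rw [h6]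
    linarith [mul_comm t E, show t * (E + ‖d‖ * c * t) = t * E + ‖d‖ * (c * t ^ 2) by ring]
  have l1 : Tendsto (fun t : ℝ => M / 2 / (1 + M * t / 2)) (𝓝[>] 0)
      (𝓝 (M / 2 / (1 + M * 0 / 2))) := by
    have : ContinuousAt (fun t : ℝ => M / 2 / (1 + M * t / 2)) 0 := by
      refine continuousAt_const.div (by fun_prop) (by simp)
    exact this.tendsto.mono_left nhdsWithin_le_nhds
  have l2 : Tendsto (fun t : ℝ => E + ‖d‖ * c * t) (𝓝[>] 0) (𝓝 (E + ‖d‖ * c * 0)) := by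
    have : Continuous (fun t : ℝ => E + ‖d‖ * c * t) := by fun_prop
    exact (this.tendsto 0).mono_left nhdsWithin_le_nhds
  have := le_of_tendsto_of_tendsto l1 l2 (by
    filter_upwards [self_mem_nhdsWithin] with t ht
    exact key t ht)
  simpa using this

theorem decay_le_energy (hV : Continuous V) (h : IsModerateYoung Φ B) {M : ℝ}
    (hM : 0 < M) (hD : ExponentialDecay V Φ M) {v : Lp ℝ 2 (gibbs V)} {l : ℝ} (hl : 0 < l)
    {G : EuclideanSpace ℝ (Fin n) → EuclideanSpace ℝ (Fin n)}
    (hw : IsFormPair V (formResolvent V l (formResolvent V l v)) G) {K : ℝ}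
    (hK : ∀ᵐ x ∂gibbs V, |v x| ≤ K) (h0 : ∫ x, v x ∂gibbs V = 0) {s : ℝ} (hs : 0 < s)
    (h1 : ∫ x, Φ (formResolvent V l (formResolvent V l v) x / s) ∂gibbs V = 1) :
    M / 2 * s ^ 2 ≤ ∫ x, ‖G x‖ ^ 2 *
      deriv (deriv Φ) (formResolvent V l (formResolvent V l v) x / s) ∂gibbs V := by
  have hsm : ∀ f : Lp ℝ 2 (gibbs V), ∀ᵐ x ∂gibbs V, (s⁻¹ • f : Lp ℝ 2 (gibbs V)) x = f x / s := by
    intro f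
    filter_upwards [Lp.coeFn_smul s⁻¹ f] with x hx
    rw [hx, Pi.smul_apply, smul_eq_mul, inv_mul_eq_div]
  have e : formResolvent V l (formResolvent V l (s⁻¹ • v)) =
      s⁻¹ • formResolvent V l (formResolvent V l v) := by rw [map_smul, map_smul]
  set w := formResolvent V l (formResolvent V l v)
  have hw' : IsFormPair V (formResolvent V l (formResolvent V l (s⁻¹ • v))) fun x => s⁻¹ • G x := by
    rw [e]
    refine (hw.const_mul s⁻¹).congr_ae ?_ EventuallyEq.rfl
    filter_upwards [hsm w] with x hx
    rw [hx, inv_mul_eq_div]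
  have h2 := decay_le_energy_of_normalized hV h hM hD hl hw' (K := K / s)
    (by
      filter_upwards [hsm v, hK] with x a1 a2
      rw [a1, abs_div, abs_of_pos hs]
      gcongr)
    (by rw [integral_congr_ae (hsm v), integral_div, h0, zero_div])
    (by
      rw [e, ← h1]
      exact integral_congr_ae ((hsm w).mono fun x hx => by simp only [hx]))
  rw [e] at h2
  have h3 : ∫ x, ‖s⁻¹ • G x‖ ^ 2 * deriv (deriv Φ) ((s⁻¹ • w : Lp ℝ 2 (gibbs V)) x) ∂gibbs V =
      (s ^ 2)⁻¹ * ∫ x, ‖G x‖ ^ 2 * deriv (deriv Φ) (w x / s) ∂gibbs V := by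
    rw [← integral_const_mul]
    refine integral_congr_ae ((hsm w).mono fun x hx => ?_)
    simp only [hx, norm_smul, mul_pow, Real.norm_eq_abs, sq_abs, inv_pow]
    ring
  rwa [h3, inv_mul_eq_div, le_div_iff₀ (by positivity)] at h2

/-- Approximate v by R_l² v in the form norm. These stay bounded by K, so their norms and energies
converge; each is divided by its norm, which is nearly 1. -/
theorem ExponentialDecay.formInequality (hV : Continuous V) (h : IsModerateYoung Φ B) {M : ℝ}
    (hM : 0 < M) (hD : ExponentialDecay V Φ M) : FormInequality V Φ (2 / M) := by
  intro v H hvH K hK hv0 hv1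
  have hvm := hvH.1.1
  set v' : Lp ℝ 2 (gibbs V) := hvH.1.toLp v with hv'_def
  have hvv : v' =ᵐ[gibbs V] v := hvH.1.coeFn_toLp
  have hvH' : IsFormPair V v' H := hvH.congr_ae hvv EventuallyEq.rfl
  have hK' : ∀ᵐ x ∂gibbs V, |v' x| ≤ K := by
    filter_upwards [hvv, hK] with x a1 a2
    rwa [a1]
  choose l hl G hG hval hgrad using fun k : ℕ =>
    exists_resolvent_sq_near hV hvH' (show (0 : ℝ) < 1 / ((k : ℝ) + 1) by positivity)
  set w : ℕ → Lp ℝ 2 (gibbs V) := fun k => formResolvent V (l k) (formResolvent V (l k) v')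
  have h0 : Tendsto (fun k : ℕ => ENNReal.ofReal (1 / ((k : ℝ) + 1))) atTop (𝓝 0) := by
    have := (ENNReal.continuous_ofReal.tendsto _).comp
      (tendsto_one_div_add_atTop_nhds_zero_nat (𝕜 := ℝ))
    rwa [ENNReal.ofReal_zero] at this
  have hval' : Tendsto (fun k => eLpNorm (fun x => w k x - v x) 2 (gibbs V)) atTop (𝓝 0) := by
    refine tendsto_of_tendsto_of_tendsto_of_le_of_le tendsto_const_nhds h0 (fun _ => zero_le)
      fun k => le_of_eq_of_le (eLpNorm_congr_ae ?_) (hval k)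
    filter_upwards [hvv] with x hx
    rw [hx]
  have hgrad' : Tendsto (fun k => eLpNorm (fun x => G k x - H x) 2 (gibbs V)) atTop (𝓝 0) :=
    tendsto_of_tendsto_of_tendsto_of_le_of_le tendsto_const_nhds h0 (fun _ => zero_le) hgrad
  have hwm : ∀ k, AEStronglyMeasurable (w k) (gibbs V) := fun k => Lp.aestronglyMeasurable _
  obtain ⟨ns, hns, hae⟩ := exists_seq_tendsto_ae_of_eLpNorm two_ne_zero hwm hvm hval'
  have hwK : ∀ k, ∀ᵐ x ∂gibbs V, |w k x| ≤ K := fun k =>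
    abs_formResolvent_le (hl k) (abs_formResolvent_le (hl k) hK')
  have hv1' : ∫⁻ x, ENNReal.ofReal (Φ (v x)) ∂gibbs V = 1 := by
    rw [lintegral_young_eq h hvm hK, hv1, ENNReal.ofReal_one]
  have hN := tendsto_luxemburgNorm h (fun k => hwm (ns k)) hvm (fun k => hwK (ns k)) hae hv1'
  set N : ℕ → ℝ := fun k => (luxemburgNorm Φ (gibbs V) (w (ns k))).toReal with hN_def
  have hN' : Tendsto N atTop (𝓝 1) := by
    have := (ENNReal.tendsto_toReal ENNReal.one_ne_top).comp hN
    rwa [ENNReal.toReal_one] at this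
  set s : ℕ → ℝ := fun k => max (N k) (1 / 2) with hs_def
  have hs : Tendsto s atTop (𝓝 1) := by
    have := hN'.max (tendsto_const_nhds (x := (1 / 2 : ℝ)))
    rwa [max_eq_left (by norm_num : (1 / 2 : ℝ) ≤ 1)] at this
  have hs0 : ∀ k, 1 / 2 ≤ s k := fun k => le_max_right _ _
  have hsb : ∀ k, ∀ᵐ x ∂gibbs V, |w (ns k) x / s k| ≤ 2 * K := by
    intro k
    filter_upwards [hwK (ns k)] with x hx
    have := hs0 k
    rw [abs_div, abs_of_pos (show 0 < s k by linarith), div_le_iff₀ (by linarith)]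
    nlinarith [abs_nonneg (w (ns k) x)]
  have hslim : ∀ᵐ x ∂gibbs V, Tendsto (fun k => w (ns k) x / s k) atTop (𝓝 (v x)) := by
    filter_upwards [hae] with x hx
    have := hx.div hs one_ne_zero
    rwa [div_one] at this
  have hE := tendsto_integral_energy h.continuous_deriv_deriv h.deriv_deriv_nonneg
    (fun k => aestronglyMeasurable_div_const (hwm (ns k)) (s k)) hvm hsb hslim
    (fun k => (hG (ns k)).2) hvH.2 (hgrad'.comp hns.tendsto_atTop)
  have hs2 : Tendsto (fun k => M / 2 * s k ^ 2) atTop (𝓝 (M / 2 * 1 ^ 2)) := (hs.pow 2).const_mul _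
  have hfin : M / 2 * 1 ^ 2 ≤ ∫ x, ‖H x‖ ^ 2 * deriv (deriv Φ) (v x) ∂gibbs V := by
    refine le_of_tendsto_of_tendsto hs2 hE ?_
    filter_upwards [hN'.eventually (lt_mem_nhds (show (1 / 2 : ℝ) < 1 by norm_num))] with k hk
    have hsk : s k = N k := max_eq_left hk.le
    have hNk := ENNReal.toReal_pos_iff.1 (show 0 < (luxemburgNorm Φ (gibbs V) (w (ns k))).toReal by
      change 0 < N k; linarith)
    refine decay_le_energy hV h hM hD (hl (ns k)) (hG (ns k)) hK'
      ((integral_congr_ae hvv).trans hv0) (by linarith [hs0 k]) ?_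
    have h3 := lintegral_young_eq_one h hNk.2 hNk.1.ne'
    change ∫⁻ x, ENNReal.ofReal (Φ (w (ns k) x / N k)) ∂gibbs V = 1 at h3
    rw [← hsk, lintegral_young_eq h (aestronglyMeasurable_div_const (hwm (ns k)) (s k)) (hsb k),
      ENNReal.ofReal_eq_one] at h3
    exact h3
  rw [one_pow, mul_one] at hfin
  rw [div_mul_eq_mul_div, le_div_iff₀ hM]
  linarith

end OrliczDecay

namespace OrliczDecay

/-! ### Locality of the gradient and truncation of smooth functions -/

variable {n : ℕ} {V : EuclideanSpace ℝ (Fin n) → ℝ} [IsProbabilityMeasure (gibbs V)]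

section Locality

variable {v w : EuclideanSpace ℝ (Fin n) → ℝ}
  {G K : EuclideanSpace ℝ (Fin n) → EuclideanSpace ℝ (Fin n)}

/-- Compute the gradient of v⁺ = (|v| + v)/2 in two ways, directly and as that of |v⁺|. Where v = 0
the first gives G/2 and the second 0, since the sign of 0 is 0; gradients are unique. -/
theorem IsFormPair.ae_grad_eq_zero (hV : Continuous V) (h : IsFormPair V v G) :
    ∀ᵐ x ∂gibbs V, v x = 0 → G x = 0 := by
  have h1 := (h.abs.add h).const_mul (1 / 2)
  have h2 : IsFormPair V (fun x => 1 / 2 * (|v x| + v x)) _ := h1.abs.congr_ae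
    (Eventually.of_forall fun x => (abs_of_nonneg (mul_nonneg (by norm_num)
      (by linarith [neg_abs_le (v x)]))).symm) EventuallyEq.rfl
  filter_upwards [h1.grad_unique hV h2] with x hx h0
  simpa [h0] using hx

theorem IsFormPair.ae_grad_eq (hV : Continuous V) (h : IsFormPair V v G)
    (h' : IsFormPair V w K) : ∀ᵐ x ∂gibbs V, v x = w x → G x = K x := by
  filter_upwards [(h.sub h').ae_grad_eq_zero hV] with x hx hvw
  exact sub_eq_zero.1 (hx (sub_eq_zero.2 hvw))

end Locality

theorem IsTest.grad_eq_zero_of_norm {φ : EuclideanSpace ℝ (Fin n) → ℝ} {R : ℝ}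
    (hR : tsupport φ ⊆ Metric.closedBall 0 R) {x : EuclideanSpace ℝ (Fin n)} (hx : R < ‖x‖) :
    φ x = 0 ∧ ∇ φ x = 0 := by
  have h1 : x ∉ tsupport φ := fun hx' => by
    have := hR hx'
    rw [mem_closedBall_zero_iff] at this
    linarith
  refine ⟨image_eq_zero_of_notMem_tsupport h1, ?_⟩
  rw [← norm_eq_zero, norm_gradient, fderiv_of_notMem_tsupport (𝕜 := ℝ) h1, norm_zero]

theorem exists_radius {φ : EuclideanSpace ℝ (Fin n) → ℝ} (hφ : IsTest φ) :
    ∃ R : ℝ, 0 < R ∧ tsupport φ ⊆ Metric.closedBall 0 R := by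
  obtain ⟨R, hR⟩ := hφ.hasCompactSupport.isCompact.isBounded.subset_closedBall 0
  exact ⟨max R 1, by positivity, hR.trans (Metric.closedBall_subset_closedBall (le_max_left _ _))⟩

/-- Truncation of a smooth function to a bounded compactly supported function which is `u` on a
large part of the ball of radius `R`, and whose gradient is that of `u` or very small. -/
theorem exists_truncation (hV : Continuous V) {u : EuclideanSpace ℝ (Fin n) → ℝ}
    (hu : ContDiff ℝ ∞ u) {K R δ : ℝ} (hK : 0 ≤ K) (hδ : 0 < δ) : ∃ w J, IsFormPair V w J ∧
      (∀ x, |w x| ≤ |u x|) ∧ (∀ x, |w x| ≤ K) ∧ (∀ x, ‖x‖ ≤ R → |u x| ≤ K → w x = u x) ∧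
      (∀ᵐ x ∂gibbs V, ‖x‖ ≤ R → w x = u x → J x = ∇ u x) ∧
      ∀ᵐ x ∂gibbs V, (w x = u x ∧ J x = ∇ u x) ∨ ‖J x‖ ≤ δ := by
  obtain ⟨C, hC, hcut⟩ := exists_cutoff n
  -- The last summand makes |K∇χ| ≤ KC/ρ ≤ δ; the others make ρ positive and larger than R.
  set ρ : ℝ := max R 0 + 1 + K * C / δ with hρ_def
  have hρ1 : K * C / δ ≤ ρ := by
    have := le_max_right R 0
    linarith
  have hRρ : R < ρ := by
    have := le_max_left R 0
    have : 0 ≤ K * C / δ := by positivity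
    linarith
  have hρ : 0 < ρ := by positivity
  obtain ⟨χ, hχ, hχ01, hχ1, hχg⟩ := hcut ρ hρ
  obtain ⟨S, hS, hχS⟩ := exists_radius hχ
  -- A second cutoff, equal to 1 around the support of χ, turns u into a test function without
  -- changing its values or gradient there.
  obtain ⟨ψ, hψ, -, hψ1, -⟩ := hcut (max S ρ + 1) (by positivity)
  have hũ : IsTest fun x => ψ x * u x := ⟨hψ.contDiff.mul hu, hψ.hasCompactSupport.mul_right⟩
  have hũe : ∀ x, ‖x‖ ≤ max S ρ → ψ x * u x = u x ∧ ∇ (fun y => ψ y * u y) x = ∇ u x := by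
    intro x hx
    refine ⟨by rw [hψ1 x (by linarith), one_mul], ?_⟩
    refine Filter.EventuallyEq.gradient_eq ?_
    filter_upwards [Metric.ball_mem_nhds x one_pos] with y hy
    rw [hψ1 y, one_mul]
    have := norm_le_norm_add_norm_sub x y
    rw [mem_ball_iff_norm, norm_sub_rev] at hy
    linarith
  have hχ0 : ∀ x, max S ρ < ‖x‖ → χ x = 0 := fun x hx =>
    (IsTest.grad_eq_zero_of_norm hχS ((le_max_left _ _).trans_lt hx)).1
  have pχ := (IsFormPair.of_isTest (V := V) hχ).const_mul K
  obtain ⟨J₁, hJ₁, -⟩ := pχ.inf (IsFormPair.of_isTest (V := V) hũ)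
  obtain ⟨J, hJ⟩ := pχ.neg.sup hJ₁
  set w : EuclideanSpace ℝ (Fin n) → ℝ := fun x => max (-(K * χ x)) (min (K * χ x) (ψ x * u x))
  have hw : ∀ x, w x = clip (K * χ x) (ψ x * u x) := fun x => rfl
  have hKχ : ∀ x, 0 ≤ K * χ x := fun x => mul_nonneg hK (hχ01 x).1
  have hw0 : ∀ x, max S ρ < ‖x‖ → w x = 0 := fun x hx => by
    have := abs_clip_le (hKχ x) (ψ x * u x)
    rw [← hw, hχ0 x hx, mul_zero] at this
    exact abs_nonpos_iff.1 this
  have hzero : ∀ᵐ x ∂gibbs V, w x = 0 → J x = 0 := hJ.ae_grad_eq_zero hV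
  have hJu := hJ.ae_grad_eq hV (IsFormPair.of_isTest (V := V) hũ)
  refine ⟨w, J, hJ, fun x => ?_, fun x => ?_, fun x hx hux => ?_, ?_, ?_⟩
  · rcases le_or_gt ‖x‖ (max S ρ) with hx | hx
    · rw [hw, (hũe x hx).1]
      exact abs_clip_le_abs (hKχ x) _
    · rw [hw0 x hx, abs_zero]
      exact abs_nonneg _
  · rw [hw]
    exact (abs_clip_le (hKχ x) _).trans (mul_le_of_le_one_right hK (hχ01 x).2)
  · rw [hw, (hũe x (by linarith [le_max_right S ρ])).1, hχ1 x (by linarith), mul_one]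
    exact clip_of_abs_le hux
  · filter_upwards [hJu] with x h1 hx hwu
    obtain ⟨e1, e2⟩ := hũe x (by linarith [le_max_right S ρ])
    rw [h1 (hwu.trans e1.symm), e2]
  -- At each point w is u, Kχ or -Kχ, or vanishes outside the support of χ; by locality J is the
  -- corresponding gradient almost everywhere.
  · filter_upwards [hJu, hzero, hJ.ae_grad_eq hV pχ, hJ.ae_grad_eq hV pχ.neg] with x h1 h2 h3 h4
    have hb : ‖K • ∇ χ x‖ ≤ δ := by
      rw [norm_smul, Real.norm_of_nonneg hK]
      refine (mul_le_mul_of_nonneg_left (hχg x) hK).trans ?_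
      rw [← mul_div_assoc, div_le_iff₀ hρ]
      rwa [div_le_iff₀ hδ, mul_comm ρ] at hρ1
    rcases le_or_gt ‖x‖ (max S ρ) with hx | hx
    · obtain ⟨e1, e2⟩ := hũe x hx
      rcases max_choice (-(K * χ x)) (min (K * χ x) (ψ x * u x)) with e | e
      · right
        rw [h4 e, norm_neg]
        exact hb
      · rcases min_choice (K * χ x) (ψ x * u x) with e' | e'
        · right
          rw [h3 (e.trans e')]
          exact hb
        · left
          exact ⟨(e.trans e').trans e1, (h1 (e.trans e')).trans e2⟩
    · right
      rw [h2 (hw0 x hx), norm_zero]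
      exact hδ.le

/-! ### Bumps -/

theorem isOpenPosMeasure_gibbs (hV : Continuous V) : (gibbs V).IsOpenPosMeasure :=
  (volume_absolutelyContinuous_gibbs hV).isOpenPosMeasure

theorem exists_bump (hV : Continuous V) {U : Set (EuclideanSpace ℝ (Fin n))} (hU : IsOpen U)
    (hne : U.Nonempty) : ∃ p : EuclideanSpace ℝ (Fin n) → ℝ, IsTest p ∧ (∀ x, 0 ≤ p x) ∧
      ∫ x, p x ∂gibbs V = 1 ∧ ∀ x, p x ≠ 0 → x ∈ U := by
  have := isOpenPosMeasure_gibbs hV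
  obtain ⟨x, hx⟩ := hne
  obtain ⟨g, hgU, hgc, hg, hg01, hgx⟩ := exists_contDiff_tsupport_subset (n := ⊤) (hU.mem_nhds hx)
  have hgt : IsTest g := ⟨hg, hgc⟩
  have hg0 : ∀ y, 0 ≤ g y := fun y => (hg01 ⟨y, rfl⟩).1
  have hpos : 0 < ∫ y, g y ∂gibbs V :=
    hg.continuous.integral_pos_of_hasCompactSupport_nonneg_nonzero hgc hg0
      (x := x) (by rw [hgx]; exact one_ne_zero)
  refine ⟨fun y => (∫ y, g y ∂gibbs V)⁻¹ * g y, hgt.const_mul _,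
    fun y => mul_nonneg (inv_pos.2 hpos).le (hg0 y), ?_, fun y hy => hgU (subset_tsupport _ ?_)⟩
  · rw [integral_const_mul, inv_mul_cancel₀ hpos.ne']
  · exact right_ne_zero_of_mul hy

/-- Take d = p - q with bumps p and q of mass 1 on {u > c} and {u < -c}. Then d has mean zero and
the sign of u, so adding it moves the modular without moving the mean, while q serves to correct the
mean. -/
theorem exists_signed_bump (hV : Continuous V) {u : EuclideanSpace ℝ (Fin n) → ℝ}
    (hu : Continuous u) (h1 : ∃ x, 0 < u x) (h2 : ∃ x, u x < 0) :
    ∃ (d q : EuclideanSpace ℝ (Fin n) → ℝ) (c : ℝ), IsTest d ∧ IsTest q ∧ 0 < c ∧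
      ∫ x, d x ∂gibbs V = 0 ∧ ∫ x, q x ∂gibbs V = 1 ∧
      (∀ x, d x ≠ 0 → c ≤ |u x| ∧ 0 < u x * d x) ∧ ∃ x, d x ≠ 0 := by
  obtain ⟨x, hx⟩ := h1
  obtain ⟨y, hy⟩ := h2
  -- Half the smaller of a positive value and an absolute negative value, so that both open sets are
  -- nonempty.
  set c := min (u x) (-u y) / 2 with hc_def
  have hm : 0 < min (u x) (-u y) := lt_min hx (by linarith)
  have hc : 0 < c := half_pos hm
  have hcx : c < u x := (half_lt_self hm).trans_le (min_le_left _ _)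
  have hcy : c < -u y := (half_lt_self hm).trans_le (min_le_right _ _)
  obtain ⟨p, hp, hp0, hp1, hpU⟩ := exists_bump hV (isOpen_lt continuous_const hu)
    (⟨x, hcx⟩ : {x | c < u x}.Nonempty)
  obtain ⟨q, hq, hq0, hq1, hqU⟩ := exists_bump hV (isOpen_lt continuous_const hu.neg)
    (⟨y, hcy⟩ : {x | c < -u x}.Nonempty)
  have hpU' : ∀ x, p x ≠ 0 → c < u x := hpU
  have hqU' : ∀ x, q x ≠ 0 → c < -u x := hqU
  have hd : ∀ x, (p x ≠ 0 ∧ q x = 0 ∧ c < u x) ∨ (p x = 0 ∧ q x ≠ 0 ∧ c < -u x) ∨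
      (p x = 0 ∧ q x = 0) := by
    intro x
    by_cases h1 : p x = 0 <;> by_cases h2 : q x = 0
    · exact Or.inr (Or.inr ⟨h1, h2⟩)
    · exact Or.inr (Or.inl ⟨h1, h2, hqU' x h2⟩)
    · exact Or.inl ⟨h1, h2, hpU' x h1⟩
    · linarith [hpU' x h1, hqU' x h2]
  refine ⟨fun x => p x + -1 * q x, q, c, hp.add (hq.const_mul (-1)), hq, hc, ?_, hq1,
    fun x hx => ?_, ?_⟩
  · rw [integral_add ((hp.memLp 1).integrable le_rfl)
        (((hq.memLp 1).integrable le_rfl).const_mul _),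
      integral_const_mul, hp1, hq1]
    norm_num
  · rcases hd x with ⟨h1, h2, h3⟩ | ⟨h1, h2, h3⟩ | ⟨h1, h2⟩
    · have hp' : 0 < p x := lt_of_le_of_ne (hp0 x) (Ne.symm h1)
      refine ⟨h3.le.trans (le_abs_self _), ?_⟩
      change 0 < u x * (p x + -1 * q x)
      rw [h2, mul_zero, add_zero]
      exact mul_pos (hc.trans h3) hp'
    · have hq' : 0 < q x := lt_of_le_of_ne (hq0 x) (Ne.symm h2)
      refine ⟨h3.le.trans (neg_le_abs _), ?_⟩
      change 0 < u x * (p x + -1 * q x)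
      rw [h1, zero_add]
      nlinarith
    · simp [h1, h2] at hx
  · by_contra! hall
    have : ∀ x, p x = 0 := by
      intro x
      rcases hd x with ⟨h1, h2, -⟩ | ⟨h1, -⟩ | ⟨h1, -⟩
      · have := hall x
        rw [h2, mul_zero, add_zero] at this
        exact this
      · exact h1
      · exact h1
    simp [this] at hp1

end OrliczDecay

namespace OrliczDecay

/-! ### Perturbations of the modular -/

theorem IsModerateYoung.mul_deriv_pos {Φ : ℝ → ℝ} {B : ℝ} (h : IsModerateYoung Φ B) {y : ℝ}
    (hy : y ≠ 0) : 0 < y * deriv Φ y := by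
  have := h.tangent_le y 0
  rw [h.zero] at this
  linarith [h.pos hy]

theorem IsModerateYoung.apply_add_le {Φ : ℝ → ℝ} {B : ℝ} (h : IsModerateYoung Φ B) {w u r ρ : ℝ}
    (hw : |w| ≤ |u|) (hr : |r| ≤ ρ) : Φ (w + r) ≤ Φ (2 * u) + Φ (2 * ρ) := by
  have hρ : 0 ≤ ρ := (abs_nonneg r).trans hr
  have h1 : Φ (w + r) ≤ Φ (|u| + ρ) := h.mono_abs (by
    rw [abs_of_nonneg (add_nonneg (abs_nonneg u) hρ)]
    exact (abs_add_le _ _).trans (add_le_add hw hr))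
  have h2 := h.convex.2 (Set.mem_univ (2 * |u|)) (Set.mem_univ (2 * ρ))
    (by norm_num : (0 : ℝ) ≤ 1 / 2) (by norm_num : (0 : ℝ) ≤ 1 / 2) (by norm_num)
  simp only [smul_eq_mul] at h2
  rw [show 1 / 2 * (2 * |u|) + 1 / 2 * (2 * ρ) = |u| + ρ by ring] at h2
  have h3 : Φ (2 * |u|) = Φ (2 * u) := by
    rw [← h.apply_abs (2 * u), abs_mul, abs_two]
  rw [h3] at h2
  linarith [h.nonneg (2 * u), h.nonneg (2 * ρ)]

section Perturbation

variable {X : Type*} [MeasurableSpace X] {μ : Measure X} [IsProbabilityMeasure μ]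
  {Φ : ℝ → ℝ} {B : ℝ} {u d q : X → ℝ} {D : ℝ}

theorem integrable_young_add (h : IsModerateYoung Φ B)
    (hu2 : Integrable (fun x => Φ (2 * u x)) μ) {w r : X → ℝ} (hwm : AEStronglyMeasurable w μ)
    (hrm : AEStronglyMeasurable r μ) (hw : ∀ x, |w x| ≤ |u x|) {ρ : ℝ} (hr : ∀ x, |r x| ≤ ρ) :
    Integrable (fun x => Φ (w x + r x)) μ := by
  refine (hu2.add (integrable_const (Φ (2 * ρ)))).mono'
    (h.continuous.comp_aestronglyMeasurable (hwm.add hrm)) (Eventually.of_forall fun x => ?_)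
  rw [Real.norm_of_nonneg (h.nonneg _)]
  exact h.apply_add_le (hw x) (hr x)

/-- At the two endpoints the modulars converge to values on either side of 1, so for large k they
too lie on either side; the intermediate value theorem in α concludes. -/
theorem eventually_exists_integral_young_eq_one (h : IsModerateYoung Φ B)
    (hu2 : Integrable (fun x => Φ (2 * u x)) μ) (hd : AEStronglyMeasurable d μ)
    (hq : AEStronglyMeasurable q μ) (hdb : ∀ x, |d x| ≤ D) (hqb : ∀ x, |q x| ≤ D)
    {w : ℕ → X → ℝ} (hwm : ∀ k, AEStronglyMeasurable (w k) μ) (hw : ∀ k x, |w k x| ≤ |u x|)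
    (hlim : ∀ x, Tendsto (fun k => w k x) atTop (𝓝 (u x))) {e : ℕ → ℝ}
    (he : Tendsto e atTop (𝓝 0)) {a : ℝ} (ha : 0 ≤ a) (hlo : ∫ x, Φ (u x + -a * d x) ∂μ < 1)
    (hhi : 1 < ∫ x, Φ (u x + a * d x) ∂μ) :
    ∀ᶠ k in atTop, ∃ α ∈ Set.Icc (-a) a, ∫ x, Φ (w k x + (α * d x - e k * q x)) ∂μ = 1 := by
  have hm : ∀ (α : ℝ) k, AEStronglyMeasurable (fun x => α * d x - e k * q x) μ := fun α k =>
    (hd.const_mul α).sub (hq.const_mul (e k))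
  have hb : ∀ (α : ℝ) k x, |α * d x - e k * q x| ≤ |α| * D + |e k| * D := fun α k x => by
    refine (abs_sub _ _).trans ?_
    rw [abs_mul, abs_mul]
    gcongr
    exacts [hdb x, hqb x]
  have hconv : ∀ α : ℝ, Tendsto (fun k => ∫ x, Φ (w k x + (α * d x - e k * q x)) ∂μ) atTop
      (𝓝 (∫ x, Φ (u x + α * d x) ∂μ)) := by
    intro α
    refine tendsto_integral_filter_of_dominated_convergence
      (fun x => Φ (2 * u x) + Φ (2 * (|α| * D + 1 * D)))
      (Eventually.of_forall fun k =>
        h.continuous.comp_aestronglyMeasurable ((hwm k).add (hm α k))) ?_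
      (hu2.add (integrable_const _)) (Eventually.of_forall fun x => ?_)
    · have h1 : ∀ᶠ k in atTop, |e k| < 1 := by
        have := he.abs
        rw [abs_zero] at this
        exact this.eventually (gt_mem_nhds one_pos)
      filter_upwards [h1] with k hk
      refine Eventually.of_forall fun x => ?_
      rw [Real.norm_of_nonneg (h.nonneg _)]
      refine h.apply_add_le (hw k x) ((hb α k x).trans ?_)
      have : 0 ≤ D := (abs_nonneg _).trans (hdb x)
      gcongr
    · have h1 := (hlim x).add ((tendsto_const_nhds (x := α * d x)).sub (he.mul_const (q x)))
      rw [zero_mul, sub_zero] at h1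
      exact (h.continuous.tendsto _).comp h1
  filter_upwards [(hconv (-a)).eventually (gt_mem_nhds hlo),
    (hconv a).eventually (lt_mem_nhds hhi)] with k h1 h2
  have hcont : ContinuousOn (fun α => ∫ x, Φ (w k x + (α * d x - e k * q x)) ∂μ)
      (Set.Icc (-a) a) := by
    refine continuousOn_of_dominated (bound := fun x => Φ (2 * u x) + Φ (2 * (a * D + |e k| * D)))
      (fun α _ => h.continuous.comp_aestronglyMeasurable ((hwm k).add (hm α k)))
      (fun α hα => Eventually.of_forall fun x => ?_) (hu2.add (integrable_const _))
      (Eventually.of_forall fun x => ?_)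
    · rw [Real.norm_of_nonneg (h.nonneg _)]
      refine h.apply_add_le (hw k x) ((hb α k x).trans ?_)
      have : 0 ≤ D := (abs_nonneg _).trans (hdb x)
      have := abs_le.2 hα
      gcongr
    · exact (h.continuous.comp (by fun_prop)).continuousOn
  exact intermediate_value_Icc (by linarith) hcont ⟨h1.le, h2.le⟩

end Perturbation

variable {n : ℕ} {V : EuclideanSpace ℝ (Fin n) → ℝ} {Φ : ℝ → ℝ} {B : ℝ}
  [IsProbabilityMeasure (gibbs V)]

/-- By the tangent inequality the increase is at least a ∫ Φ'(z) d, whose integrand is continuous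
and positive wherever d ≠ 0, and μ charges open sets. -/
theorem integral_young_lt_add (hV : Continuous V) (h : IsModerateYoung Φ B)
    {z d : EuclideanSpace ℝ (Fin n) → ℝ} (hz : Continuous z) (hd : IsTest d) {a : ℝ} (ha : 0 < a)
    (hi : Integrable (fun x => Φ (z x)) (gibbs V))
    (hi' : Integrable (fun x => Φ (z x + a * d x)) (gibbs V))
    (hzd : ∀ x, d x ≠ 0 → 0 < z x * d x) (hne : ∃ x, d x ≠ 0) :
    ∫ x, Φ (z x) ∂gibbs V < ∫ x, Φ (z x + a * d x) ∂gibbs V := by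
  have := isOpenPosMeasure_gibbs hV
  have hpos : ∀ x, d x ≠ 0 → 0 < deriv Φ (z x) * d x := by
    intro x hx
    have h1 := hzd x hx
    have hzx : z x ≠ 0 := fun h0 => by simp [h0] at h1
    have h2 := mul_pos (h.mul_deriv_pos hzx) h1
    have h3 : 0 < z x ^ 2 := by positivity
    refine pos_of_mul_pos_right (a := z x ^ 2) ?_ h3.le
    linarith [show z x * deriv Φ (z x) * (z x * d x) = z x ^ 2 * (deriv Φ (z x) * d x) by ring]
  have hc : Continuous fun x => deriv Φ (z x) * d x :=
    (h.continuous_deriv.comp hz).mul hd.contDiff.continuous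
  have hcs : HasCompactSupport fun x => deriv Φ (z x) * d x := hd.hasCompactSupport.mul_left
  obtain ⟨x₀, hx₀⟩ := hne
  have h1 : 0 < ∫ x, deriv Φ (z x) * d x ∂gibbs V := by
    refine hc.integral_pos_of_hasCompactSupport_nonneg_nonzero hcs (fun x => ?_) (hpos x₀ hx₀).ne'
    by_cases hx : d x = 0
    · simp [hx]
    · exact (hpos x hx).le
  have i1 : Integrable (fun x => a * (deriv Φ (z x) * d x)) (gibbs V) :=
    (hc.integrable_of_hasCompactSupport hcs).const_mul a
  have h2 : ∫ x, Φ (z x) + a * (deriv Φ (z x) * d x) ∂gibbs V ≤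
      ∫ x, Φ (z x + a * d x) ∂gibbs V := by
    refine integral_mono (hi.add i1) hi' fun x => ?_
    have := h.tangent_le (z x) (z x + a * d x)
    simp only
    linarith [show deriv Φ (z x) * (z x + a * d x - z x) = a * (deriv Φ (z x) * d x) by ring]
  rw [integral_add hi i1, integral_const_mul] at h2
  have := mul_pos ha h1
  linarith

theorem exists_pos_of_integral_eq_zero {X : Type*} [MeasurableSpace X] {μ : Measure X} {u : X → ℝ}
    (hu : Integrable u μ) (h0 : ∫ x, u x ∂μ = 0) (hne : ¬ u =ᵐ[μ] 0) : ∃ x, 0 < u x := by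
  by_contra! hall
  refine hne ?_
  have h1 : 0 ≤ fun x => -u x := fun x => neg_nonneg.2 (hall x)
  have h2 := (integral_eq_zero_iff_of_nonneg h1 hu.neg).1 (by rw [integral_neg, h0, neg_zero])
  filter_upwards [h2] with x hx
  exact neg_eq_zero.1 hx

theorem IsTest.exists_bound {φ : EuclideanSpace ℝ (Fin n) → ℝ} (hφ : IsTest φ) :
    ∃ C, ∀ x, |φ x| ≤ C :=
  hφ.contDiff.continuous.bounded_above_of_compact_support hφ.hasCompactSupport

end OrliczDecay

namespace OrliczDecay

/-! ### From bounded elements of the form domain to smooth functions -/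

variable {n : ℕ} {V : EuclideanSpace ℝ (Fin n) → ℝ} {Φ : ℝ → ℝ} {B : ℝ}
  [IsProbabilityMeasure (gibbs V)]

/-- Bounded elements of the form domain that agree with a smooth function `u` on large sets and
have energy density at most that of `u` plus `1`. -/
theorem exists_truncation_seq (hV : Continuous V) (h : IsModerateYoung Φ B)
    {u : EuclideanSpace ℝ (Fin n) → ℝ} (hu : ContDiff ℝ ∞ u) :
    ∃ (w : ℕ → EuclideanSpace ℝ (Fin n) → ℝ)
      (J : ℕ → EuclideanSpace ℝ (Fin n) → EuclideanSpace ℝ (Fin n)),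
      (∀ k, IsFormPair V (w k) (J k)) ∧ (∀ k x, |w k x| ≤ |u x|) ∧ (∀ k x, |w k x| ≤ k) ∧
      (∀ (k : ℕ) x, ‖x‖ ≤ k → |u x| ≤ k → w k x = u x) ∧
      (∀ᵐ x ∂gibbs V, ∀ k : ℕ, ‖x‖ ≤ k → |u x| ≤ k → J k x = ∇ u x) ∧
      ∀ᵐ x ∂gibbs V, ∀ k, ‖J k x‖ ^ 2 * deriv (deriv Φ) (w k x) ≤
        ‖∇ u x‖ ^ 2 * deriv (deriv Φ) (u x) + 1 := by
  -- S k bounds Φ'' on [-k, k]; with gradient at most δ = 1/(|S k| + 1), the density is at most 1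
  -- wherever the truncation departs from u.
  choose S hS using exists_forall_abs_le h.continuous_deriv_deriv
  choose w J h1 h2 h3 h4 h5 h6 using fun k : ℕ => exists_truncation hV hu (R := k)
    (δ := 1 / (|S k| + 1)) (Nat.cast_nonneg k) (by positivity)
  refine ⟨w, J, h1, h2, h3, h4, ?_, ?_⟩
  · filter_upwards [ae_all_iff.2 h5] with x hx k hxk huk
    exact hx k hxk (h4 k x hxk huk)
  · filter_upwards [ae_all_iff.2 h6] with x hx k
    rcases hx k with ⟨e1, e2⟩ | hJ
    · rw [e1, e2]
      linarith
    · have hp : 0 ≤ ‖∇ u x‖ ^ 2 * deriv (deriv Φ) (u x) :=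
        mul_nonneg (sq_nonneg _) (h.deriv_deriv_nonneg _)
      have hSk : deriv (deriv Φ) (w k x) ≤ |S k| :=
        (le_abs_self _).trans ((hS k _ (h3 k x)).trans (le_abs_self _))
      have ha : 0 < |S k| + 1 := by positivity
      have h7 : ‖J k x‖ ^ 2 ≤ 1 / (|S k| + 1) := by
        have hδ : 1 / (|S k| + 1) ≤ 1 := by
          rw [div_le_one ha]
          linarith [abs_nonneg (S k)]
        calc ‖J k x‖ ^ 2 ≤ (1 / (|S k| + 1)) ^ 2 := pow_le_pow_left₀ (norm_nonneg _) hJ 2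
          _ ≤ 1 / (|S k| + 1) := by
            rw [sq]
            exact mul_le_of_le_one_left (by positivity) hδ
      have h8 : ‖J k x‖ ^ 2 * deriv (deriv Φ) (w k x) ≤ 1 / (|S k| + 1) * |S k| :=
        mul_le_mul h7 hSk (h.deriv_deriv_nonneg _) (by positivity)
      have h9 : 1 / (|S k| + 1) * |S k| ≤ 1 := by
        rw [one_div, inv_mul_le_iff₀ ha]
        linarith
      linarith

/-- Normalised bounded elements of the form domain converging to `u`. -/
theorem exists_normalized_perturbation (hV : Continuous V) (h : IsModerateYoung Φ B)
    {u : EuclideanSpace ℝ (Fin n) → ℝ} (hu : Continuous u) (hui : Integrable u (gibbs V))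
    (hu0 : ∫ x, u x ∂gibbs V = 0) (hu2 : Integrable (fun x => Φ (2 * u x)) (gibbs V))
    (hu1 : ∫ x, Φ (u x) ∂gibbs V = 1) {w : ℕ → EuclideanSpace ℝ (Fin n) → ℝ}
    (hwm : ∀ k, AEStronglyMeasurable (w k) (gibbs V)) (hw : ∀ k x, |w k x| ≤ |u x|)
    (hlim : ∀ x, Tendsto (fun k => w k x) atTop (𝓝 (u x))) :
    ∃ (d q : EuclideanSpace ℝ (Fin n) → ℝ) (κ : ℕ → ℕ) (α e : ℕ → ℝ), IsTest d ∧ IsTest q ∧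
      (∀ j, j ≤ κ j) ∧ (∀ j, |α j| ≤ 1) ∧ (∀ j, |e j| ≤ 1) ∧ Tendsto α atTop (𝓝 0) ∧
      Tendsto e atTop (𝓝 0) ∧
      (∀ j, ∫ x, w (κ j) x + (α j * d x - e j * q x) ∂gibbs V = 0) ∧
      ∀ j, ∫ x, Φ (w (κ j) x + (α j * d x - e j * q x)) ∂gibbs V = 1 := by
  have hne : ¬ u =ᵐ[gibbs V] 0 := by
    intro h0
    have : ∫ x, Φ (u x) ∂gibbs V = 0 := by
      rw [integral_congr_ae (g := fun _ => (0 : ℝ)) (h0.mono fun x hx => by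
        simp only [hx, Pi.zero_apply, h.zero]), integral_zero]
    linarith
  have hneg : ∃ x, u x < 0 := by
    obtain ⟨x, hx⟩ := exists_pos_of_integral_eq_zero (u := fun x => -u x) hui.neg
      (by rw [integral_neg, hu0, neg_zero]) (fun h0 => hne (h0.mono fun x hx => neg_eq_zero.1 hx))
    exact ⟨x, neg_pos.1 hx⟩
  obtain ⟨d, q, c, hd, hq, hc, hd0, hq1, hdu, hdne⟩ :=
    exists_signed_bump hV hu (exists_pos_of_integral_eq_zero hui hu0 hne) hneg
  obtain ⟨D₁, hD₁⟩ := hd.exists_bound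
  obtain ⟨D₂, hD₂⟩ := hq.exists_bound
  set D := max D₁ D₂
  have hdb : ∀ x, |d x| ≤ D := fun x => (hD₁ x).trans (le_max_left _ _)
  have hqb : ∀ x, |q x| ≤ D := fun x => (hD₂ x).trans (le_max_right _ _)
  have hD0 : 0 ≤ D := (abs_nonneg _).trans (hdb 0)
  have hdi : Integrable d (gibbs V) := (hd.memLp 1).integrable le_rfl
  have hqi : Integrable q (gibbs V) := (hq.memLp 1).integrable le_rfl
  have hwi : ∀ k, Integrable (w k) (gibbs V) := fun k =>
    hui.mono (hwm k) (Eventually.of_forall (hw k))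
  set m : ℕ → ℝ := fun k => ∫ x, w k x ∂gibbs V
  have hm : Tendsto m atTop (𝓝 0) := by
    rw [← hu0]
    exact tendsto_integral_of_dominated_convergence (fun x => |u x|) hwm hui.abs
      (fun k => Eventually.of_forall (hw k)) (Eventually.of_forall hlim)
  have hpert : ∀ a : ℝ, Integrable (fun x => Φ (u x + a * d x)) (gibbs V) := fun a =>
    integrable_young_add h hu2 hui.1 (hdi.1.const_mul a) (fun x => le_rfl)
      (ρ := |a| * D) fun x => by
        rw [abs_mul]
        exact mul_le_mul_of_nonneg_left (hdb x) (abs_nonneg _)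
  have hΦu : Integrable (fun x => Φ (u x)) (gibbs V) := by simpa using hpert 0
  have key : ∀ j : ℕ, ∃ k, j ≤ k ∧ |m k| ≤ 1 ∧
      ∃ α, |α| ≤ 1 / ((j : ℝ) + 1) ∧ ∫ x, Φ (w k x + (α * d x - m k * q x)) ∂gibbs V = 1 := by
    intro j
    -- The first bound sends the perturbation to 0; the second keeps the sign of u - a d equal to
    -- that of u on the support of d, so the modular is strictly increased in passing from u - a d
    -- to u.
    set a := min (1 / ((j : ℝ) + 1)) (c / (D + 1))
    have ha : 0 < a := lt_min (by positivity) (by positivity)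
    have haD : a * D < c := by
      have h1 : a * (D + 1) ≤ c := by
        rw [← le_div_iff₀ (by positivity)]
        exact min_le_right _ _
      linarith
    have hhi : 1 < ∫ x, Φ (u x + a * d x) ∂gibbs V := by
      rw [← hu1]
      exact integral_young_lt_add hV h hu hd ha hΦu (hpert a) (fun x hx => (hdu x hx).2) hdne
    have hlo : ∫ x, Φ (u x + -a * d x) ∂gibbs V < 1 := by
      have e1 : ∀ x, u x + -a * d x + a * d x = u x := fun x => by ring
      have h1 := integral_young_lt_add hV h (z := fun x => u x + -a * d x)
        (hu.add (continuous_const.mul hd.contDiff.continuous)) hd ha (hpert (-a))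
        (by simpa only [e1] using hΦu) (fun x hx => ?_) hdne
      · simp only [e1, hu1] at h1
        exact h1
      · obtain ⟨h2, h3⟩ := hdu x hx
        have h4 : a * |d x| < |u x| :=
          ((mul_le_mul_of_nonneg_left (hdb x) ha.le).trans_lt haD).trans_le h2
        have h5 : u x * d x = |u x| * |d x| := by rw [← abs_mul, abs_of_pos h3]
        have h6 : d x * d x = |d x| * |d x| := (abs_mul_abs_self _).symm
        have h7 : 0 < |d x| := abs_pos.2 hx
        have h8 : (u x + -a * d x) * d x = (|u x| - a * |d x|) * |d x| := by
          rw [add_mul, sub_mul, h5, mul_assoc, mul_assoc, h6]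
          ring
        rw [h8]
        exact mul_pos (sub_pos.2 h4) h7
    have hev := eventually_exists_integral_young_eq_one h hu2 hdi.1 hqi.1 hdb hqb hwm hw hlim hm
      ha.le hlo hhi
    have hm1 : ∀ᶠ k in atTop, |m k| < 1 := by
      have := hm.abs
      rw [abs_zero] at this
      exact this.eventually (gt_mem_nhds one_pos)
    obtain ⟨k, ⟨⟨α, hα, hk1⟩, hk2⟩, hk3⟩ :=
      ((hev.and hm1).and (eventually_ge_atTop j)).exists
    exact ⟨k, hk3, hk2.le, α, (abs_le.2 hα).trans (min_le_left _ _), hk1⟩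
  choose κ hκ hmκ α hα hone using key
  have hα0 : Tendsto α atTop (𝓝 0) :=
    squeeze_zero_norm hα (tendsto_one_div_add_atTop_nhds_zero_nat (𝕜 := ℝ))
  have hκt : Tendsto κ atTop atTop :=
    tendsto_atTop_mono hκ tendsto_id
  -- Subtracting m(κ j) q removes exactly the mean of the truncation, since q has mass 1 and d has
  -- mean 0.
  refine ⟨d, q, κ, α, fun j => m (κ j), hd, hq, hκ, fun j => (hα j).trans ?_, hmκ, hα0,
    hm.comp hκt, fun j => ?_, hone⟩
  · rw [div_le_one (by positivity)]
    linarith [(Nat.cast_nonneg j : (0 : ℝ) ≤ j)]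
  · have i1 : Integrable (fun x => α j * d x - m (κ j) * q x) (gibbs V) :=
      (hdi.const_mul _).sub (hqi.const_mul _)
    rw [integral_add (hwi _) i1, integral_sub (hdi.const_mul _) (hqi.const_mul _),
      integral_const_mul, integral_const_mul, hd0, hq1]
    simp [m]

/-- Dominated convergence along normalised perturbed truncations. Outside a fixed ball the
perturbation vanishes and the density is at most that of u plus 1; inside, the truncation eventually
equals u and the perturbed density is bounded by compactness. -/
theorem FormInequality.one_le_energy (hV : Continuous V) (h : IsModerateYoung Φ B) {C : ℝ}
    (hI : FormInequality V Φ C) {u : EuclideanSpace ℝ (Fin n) → ℝ} (hu : ContDiff ℝ ∞ u)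
    (hui : Integrable u (gibbs V)) (hu0 : ∫ x, u x ∂gibbs V = 0)
    (hu2 : Integrable (fun x => Φ (2 * u x)) (gibbs V)) (hu1 : ∫ x, Φ (u x) ∂gibbs V = 1)
    (hE : Integrable (fun x => ‖∇ u x‖ ^ 2 * deriv (deriv Φ) (u x)) (gibbs V)) :
    1 ≤ C * ∫ x, ‖∇ u x‖ ^ 2 * deriv (deriv Φ) (u x) ∂gibbs V := by
  obtain ⟨w, J, hwJ, hwu, hwk, hwe, hJe, hJb⟩ := exists_truncation_seq hV h hu
  have hlim : ∀ x, ∀ᶠ k : ℕ in atTop, ‖x‖ ≤ k ∧ |u x| ≤ k := fun x =>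
    (tendsto_natCast_atTop_atTop.eventually_ge_atTop ‖x‖).and
      (tendsto_natCast_atTop_atTop.eventually_ge_atTop |u x|)
  have hwlim : ∀ x, Tendsto (fun k => w k x) atTop (𝓝 (u x)) := fun x =>
    tendsto_const_nhds.congr' ((hlim x).mono fun k hk => (hwe k x hk.1 hk.2).symm)
  obtain ⟨d, q, κ, α, e, hd, hq, hκ, hα1, he1, hα, he, hmean, hone⟩ :=
    exists_normalized_perturbation hV h hu.continuous hui hu0 hu2 hu1 (fun k => (hwJ k).1.1) hwu
      hwlim
  have hκt : Tendsto κ atTop atTop := tendsto_atTop_mono hκ tendsto_id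
  obtain ⟨D₁, hD₁⟩ := hd.exists_bound
  obtain ⟨D₂, hD₂⟩ := hq.exists_bound
  have hpair : ∀ j, IsFormPair V (fun x => w (κ j) x + (α j * d x - e j * q x))
      (fun x => J (κ j) x + (α j • ∇ d x - e j • ∇ q x)) := fun j =>
    (hwJ (κ j)).add (((IsFormPair.of_isTest hd).const_mul (α j)).sub
      ((IsFormPair.of_isTest hq).const_mul (e j)))
  have hle : ∀ j, 1 ≤ C * ∫ x, ‖J (κ j) x + (α j • ∇ d x - e j • ∇ q x)‖ ^ 2 *
      deriv (deriv Φ) (w (κ j) x + (α j * d x - e j * q x)) ∂gibbs V := by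
    intro j
    refine hI _ _ (hpair j) (κ j + (1 * D₁ + 1 * D₂)) (Eventually.of_forall fun x => ?_) (hmean j)
      (hone j)
    refine (abs_add_le _ _).trans (add_le_add (hwk _ x) ((abs_sub _ _).trans ?_))
    rw [abs_mul, abs_mul]
    exact add_le_add (mul_le_mul (hα1 j) (hD₁ x) (abs_nonneg _) zero_le_one)
      (mul_le_mul (he1 j) (hD₂ x) (abs_nonneg _) zero_le_one)
  obtain ⟨R₁, -, hR₁⟩ := exists_radius hd
  obtain ⟨R₂, -, hR₂⟩ := exists_radius hq
  set R := max R₁ R₂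
  have hout : ∀ x, R < ‖x‖ → (d x = 0 ∧ ∇ d x = 0) ∧ q x = 0 ∧ ∇ q x = 0 := fun x hx =>
    ⟨IsTest.grad_eq_zero_of_norm hR₁ ((le_max_left _ _).trans_lt hx),
      IsTest.grad_eq_zero_of_norm hR₂ ((le_max_right _ _).trans_lt hx)⟩
  -- The perturbed energy density as a jointly continuous function of the point and both
  -- coefficients: it is bounded over the ball times [-1, 1]², and continuity at (x, 0, 0) gives the
  -- pointwise limit.
  set Ψ : EuclideanSpace ℝ (Fin n) × ℝ × ℝ → ℝ := fun p =>
    ‖∇ u p.1 + (p.2.1 • ∇ d p.1 - p.2.2 • ∇ q p.1)‖ ^ 2 *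
      deriv (deriv Φ) (u p.1 + (p.2.1 * d p.1 - p.2.2 * q p.1)) with hΨ_def
  have hΨ : Continuous Ψ := by
    have c1 := continuous_gradient hu
    have c2 := continuous_gradient hd.contDiff
    have c3 := continuous_gradient hq.contDiff
    have c4 := hu.continuous
    have c5 := hd.contDiff.continuous
    have c6 := hq.contDiff.continuous
    have c7 := h.continuous_deriv_deriv
    fun_prop
  obtain ⟨M, hM⟩ := ((isCompact_closedBall (0 : EuclideanSpace ℝ (Fin n)) R).prod
    ((isCompact_Icc (a := (-1 : ℝ)) (b := 1)).prod
      (isCompact_Icc (a := (-1 : ℝ)) (b := 1)))).exists_bound_of_continuousOn hΨ.continuousOn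
  obtain ⟨M', hM'⟩ := (isCompact_closedBall (0 : EuclideanSpace ℝ (Fin n))
    R).exists_bound_of_continuousOn hu.continuous.continuousOn
  have hlarge : ∀ᶠ j in atTop, R ≤ κ j ∧ M' ≤ κ j :=
    hκt.eventually ((tendsto_natCast_atTop_atTop.eventually_ge_atTop R).and
      (tendsto_natCast_atTop_atTop.eventually_ge_atTop M'))
  have hmeas : ∀ j, AEStronglyMeasurable (fun x =>
      ‖J (κ j) x + (α j • ∇ d x - e j • ∇ q x)‖ ^ 2 *
        deriv (deriv Φ) (w (κ j) x + (α j * d x - e j * q x))) (gibbs V) := fun j =>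
    ((continuous_id.pow 2).comp_aestronglyMeasurable
      (hpair j).memLp_grad.aestronglyMeasurable.norm).mul
      (h.continuous_deriv_deriv.comp_aestronglyMeasurable (hpair j).memLp.aestronglyMeasurable)
  have hbound : Integrable (fun x => ‖∇ u x‖ ^ 2 * deriv (deriv Φ) (u x) + (1 + |M|)) (gibbs V) :=
    hE.add (integrable_const _)
  have hconv : Tendsto (fun j => ∫ x, ‖J (κ j) x + (α j • ∇ d x - e j • ∇ q x)‖ ^ 2 *
      deriv (deriv Φ) (w (κ j) x + (α j * d x - e j * q x)) ∂gibbs V) atTop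
      (𝓝 (∫ x, ‖∇ u x‖ ^ 2 * deriv (deriv Φ) (u x) ∂gibbs V)) := by
    refine tendsto_integral_filter_of_dominated_convergence
      _ (Eventually.of_forall hmeas) ?_ hbound ?_
    · filter_upwards [hlarge] with j hj
      filter_upwards [hJe, hJb] with x h1 h2
      have hp : 0 ≤ ‖∇ u x‖ ^ 2 * deriv (deriv Φ) (u x) :=
        mul_nonneg (sq_nonneg _) (h.deriv_deriv_nonneg _)
      rcases lt_or_ge R ‖x‖ with hx | hx
      · obtain ⟨⟨a1, a2⟩, a3, a4⟩ := hout x hx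
        rw [a1, a2, a3, a4]
        simp only [smul_zero, mul_zero, sub_zero, add_zero]
        rw [Real.norm_of_nonneg (mul_nonneg (sq_nonneg _) (h.deriv_deriv_nonneg _))]
        linarith [h2 (κ j), abs_nonneg M]
      · have hxb : x ∈ Metric.closedBall (0 : EuclideanSpace ℝ (Fin n)) R :=
          mem_closedBall_zero_iff.2 hx
        have b1 := hx.trans hj.1
        have b2 : |u x| ≤ κ j := (hM' x hxb).trans hj.2
        rw [hwe _ x b1 b2, h1 _ b1 b2]
        have := hM (x, α j, e j) ⟨hxb, abs_le.1 (hα1 j), abs_le.1 (he1 j)⟩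
        refine this.trans ?_
        linarith [le_abs_self M]
    · filter_upwards [hJe] with x h1
      have h2 : Tendsto (fun j => Ψ (x, α j, e j)) atTop (𝓝 (Ψ (x, 0, 0))) :=
        (hΨ.tendsto _).comp (tendsto_const_nhds.prodMk_nhds (hα.prodMk_nhds he))
      have h3 : Ψ (x, 0, 0) = ‖∇ u x‖ ^ 2 * deriv (deriv Φ) (u x) := by simp [Ψ]
      rw [h3] at h2
      refine h2.congr' ?_
      filter_upwards [hκt.eventually (hlim x)] with j hj
      rw [hwe _ x hj.1 hj.2, h1 _ hj.1 hj.2]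
  exact ge_of_tendsto' (hconv.const_mul C) hle

/-- Zero norm and infinite energy are immediate; otherwise u = (f - m)/F is normalised with
integrable energy density, and its gradient contributes the factor 1/F². -/
theorem FormInequality.modifiedOrliczSobolev (hV : Continuous V) (h : IsModerateYoung Φ B) {C : ℝ}
    (hC : 0 < C) (hI : FormInequality V Φ C) : ModifiedOrliczSobolev V Φ C := by
  intro f hf hfO
  have hi := hfO.integrable h
  set m := ∫ y, f y ∂gibbs V with hm_def
  have hNt := hfO.luxemburgNorm_sub_const_lt_top h m
  rcases eq_or_ne (luxemburgNorm Φ (gibbs V) fun x => f x - m) 0 with hN0 | hN0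
  · rw [hN0]
    simp
  have h1 := lintegral_young_eq_one h hNt hN0
  set F := (luxemburgNorm Φ (gibbs V) fun x => f x - m).toReal with hF_def
  have hF : 0 < F := ENNReal.toReal_pos hN0 hNt.ne
  rw [show luxemburgNorm Φ (gibbs V) (fun x => f x - m) = ENNReal.ofReal F from
    (ENNReal.ofReal_toReal hNt.ne).symm]
  set u : EuclideanSpace ℝ (Fin n) → ℝ := fun x => (f x - m) / F with hu_def
  have hu : ContDiff ℝ ∞ u := (hf.sub contDiff_const).div_const F
  have hgrad : ∀ x, ∇ u x = F⁻¹ • ∇ f x := by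
    intro x
    have hfd : DifferentiableAt ℝ f x := hf.differentiable (by simp) x
    have e : u = fun y => F⁻¹ * (f y + -m) := by
      funext y
      rw [hu_def, ← sub_eq_add_neg]
      exact (inv_mul_eq_div _ _).symm
    have hfm : DifferentiableAt ℝ (fun y => f y + -m) x := hfd.add (differentiableAt_const _)
    rw [e, gradient_const_mul _ hfm, gradient_add hfd (differentiableAt_const _)]
    simp [gradient]
  have hint : ∀ g : EuclideanSpace ℝ (Fin n) → ℝ, Continuous g →
      ∫⁻ x, ENNReal.ofReal (Φ (g x)) ∂gibbs V < ⊤ → Integrable (fun x => Φ (g x)) (gibbs V) := by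
    intro g hg hfin
    refine ⟨(h.continuous.comp hg).aestronglyMeasurable, ?_⟩
    rwa [hasFiniteIntegral_iff_ofReal (Eventually.of_forall fun x => h.nonneg _)]
  have hΦu : Integrable (fun x => Φ (u x)) (gibbs V) := hint u hu.continuous (by
    rw [h1]; exact ENNReal.one_lt_top)
  have hu2 : Integrable (fun x => Φ (2 * u x)) (gibbs V) := by
    refine hint _ (continuous_const.mul hu.continuous)
      ((lintegral_young_mul_le h one_le_two u).trans_lt ?_)
    rw [h1, mul_one]
    exact ENNReal.ofReal_lt_top
  have hu1 : ∫ x, Φ (u x) ∂gibbs V = 1 := by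
    rw [← ofReal_integral_eq_lintegral_ofReal hΦu (Eventually.of_forall fun x => h.nonneg _),
      ENNReal.ofReal_eq_one] at h1
    exact h1
  have hui : Integrable u (gibbs V) := (hi.sub (integrable_const m)).div_const F
  have hu0 : ∫ x, u x ∂gibbs V = 0 := by
    rw [hu_def, integral_div, integral_sub hi (integrable_const m)]
    simp [hm_def]
  set ℰ := ∫⁻ x, ENNReal.ofReal (‖∇ f x‖ ^ 2 * deriv (deriv Φ) (u x)) ∂gibbs V with hℰ_def
  change ENNReal.ofReal F ^ 2 ≤ ENNReal.ofReal C * ℰ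
  rcases eq_or_ne ℰ ⊤ with hℰ | hℰ
  · rw [hℰ, ENNReal.mul_top (ENNReal.ofReal_pos.2 hC).ne']
    exact le_top
  have hnn : ∀ x, 0 ≤ ‖∇ f x‖ ^ 2 * deriv (deriv Φ) (u x) := fun x =>
    mul_nonneg (sq_nonneg _) (h.deriv_deriv_nonneg _)
  have hEf : Integrable (fun x => ‖∇ f x‖ ^ 2 * deriv (deriv Φ) (u x)) (gibbs V) := by
    refine ⟨(((continuous_gradient hf).norm.pow 2).mul
      (h.continuous_deriv_deriv.comp hu.continuous)).aestronglyMeasurable, ?_⟩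
    rw [hasFiniteIntegral_iff_ofReal (Eventually.of_forall hnn)]
    exact lt_top_iff_ne_top.2 hℰ
  have e : ∀ x, ‖∇ u x‖ ^ 2 * deriv (deriv Φ) (u x) =
      (F ^ 2)⁻¹ * (‖∇ f x‖ ^ 2 * deriv (deriv Φ) (u x)) := by
    intro x
    rw [hgrad, norm_smul, mul_pow, Real.norm_of_nonneg (inv_pos.2 hF).le, inv_pow, mul_assoc]
  have h2 := hI.one_le_energy hV h hu hui hu0 hu2 hu1 (by
    simp only [e]
    exact hEf.const_mul _)
  simp only [e] at h2
  rw [integral_const_mul, mul_left_comm, inv_mul_eq_div, le_div_iff₀ (by positivity), one_mul] at h2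
  rw [← ENNReal.ofReal_pow hF.le, hℰ_def, ← ofReal_integral_eq_lintegral_ofReal hEf
    (Eventually.of_forall hnn), ← ENNReal.ofReal_mul hC.le]
  exact ENNReal.ofReal_le_ofReal h2

end OrliczDecay

end

/-! ### The equivalence and its constants -/

theorem mainTheorem6 (n : ℕ) (V : EuclideanSpace ℝ (Fin n) → ℝ) (hV : Differentiable ℝ V)
    [IsProbabilityMeasure (OrliczDecay.gibbs V)]
    (Φ : ℝ → ℝ) (hΦ : OrliczDecay.IsYoung Φ) (hΦ2 : ContDiff ℝ 2 Φ)
    (B : ℝ) (hB : ∀ x, x * deriv Φ x ≤ B * Φ x) :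
    ((∃ C : ℝ, 0 < C ∧ OrliczDecay.ModifiedOrliczSobolev V Φ C) ↔
      ∃ M : ℝ, 0 < M ∧ OrliczDecay.ExponentialDecay V Φ M) ∧
    (∀ C : ℝ, 0 < C → OrliczDecay.ModifiedOrliczSobolev V Φ C →
      OrliczDecay.ExponentialDecay V Φ (2 / (B * C))) ∧
    (∀ M : ℝ, 0 < M → OrliczDecay.ExponentialDecay V Φ M →
      OrliczDecay.ModifiedOrliczSobolev V Φ (2 / M)) := by
  have h : OrliczDecay.IsModerateYoung Φ B := ⟨hΦ, hΦ2, hB⟩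
  have hB0 : 0 < B := one_pos.trans_le h.one_le
  have h1 : ∀ C : ℝ, 0 < C → OrliczDecay.ModifiedOrliczSobolev V Φ C →
      OrliczDecay.ExponentialDecay V Φ (2 / (B * C)) := fun C hC hS =>
    (hS.formInequality h hC).exponentialDecay h hC
  have h2 : ∀ M : ℝ, 0 < M → OrliczDecay.ExponentialDecay V Φ M →
      OrliczDecay.ModifiedOrliczSobolev V Φ (2 / M) := fun M hM hD =>
    (hD.formInequality hV.continuous h hM).modifiedOrliczSobolev hV.continuous h (by positivity)
  exact ⟨⟨fun ⟨C, hC, hS⟩ => ⟨_, by positivity, h1 C hC hS⟩,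
    fun ⟨M, hM, hD⟩ => ⟨_, by positivity, h2 M hM hD⟩⟩, h1, h2⟩
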